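/- **Setting.** Let $d\ge 1$, $T\ge 2$ with $d\le\sqrt T$, and let $\mathcal A\subset\mathbb R^d$ be a finite set with full-dimensional affine hull. In each round $t=1,\dots,T$ an adversary (who may react to the past) fixes $\theta_t\in\mathbb R^d$ with $|\langle a,\theta_t\rangle|\le 1$ for all $a\in\mathcal A$ and a misspecification $\epsilon_t:\mathcal A\to\mathbb R$; the learner then draws $a_t\sim p_t\in\Delta(\mathcal A)$ and observes $r_t\in[-1,1]$ with $\mathbb E[r_t\mid \text{past},a_t]=\langle a_t,\theta_t\rangle+\epsilon_t(a_t)$. Let $C_\infty\ge 0$ be a number, known to the learner, with $\sum_{t=1}^T\max_{a\in\mathcal A}|\epsilon_t(a)|\le C_\infty$. For $p_\star\in\Delta(\mathcal A)$ let $\mathrm{Reg}_T(p_\star)=\sum_{t=1}^T\langle \mathbb E_{a\sim p_\star}[a]-a_t,\theta_t\rangle$. **Notation.** For $p\in\Delta(\mathcal A)$ put $\mu(p)=\mathbb E_{a\sim p}[a]$, $\mathrm{Cov}(p)=\mathbb E_{a\sim p}[(a-\mu(p))(a-\mu(p))^\top]$, $\Sigma(p)=\mathbb E_{a\sim p}[aa^\top]$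 and $$\widehat{\mathrm{Cov}}(p)=\begin{bmatrix}\mathrm{Cov}(p)+\mu(p)\mu(p)^\top&\mu(p)\\ \mu(p)^\top&1\end{bmatrix}.$$ Let $\rho\in\Delta(\mathcal A)$ be John's exploration over $\mathcal A$: if $\{x:(x-c)^\top M^{-1}(x-c)\le 1\}$ is the minimum-volume ellipsoid enclosing $\mathcal A$, then $\rho$ is supported on points of $\mathcal A$ on its boundary, $\sum_a\rho(a)(a-c)=0$ and $\sum_a\rho(a)(a-c)(a-c)^\top=\frac1d M$. Let $\gamma=d/\sqrt T$, $\Delta_\gamma(\mathcal A)=\{(1-\gamma)p'+\gamma\rho:\ p'\in\Delta(\mathcal A)\}$, $\mathcal H=\{\widehat{\mathrm{Cov}}(p):p\in\Delta_\gamma(\mathcal A)\}$, $G(\pmb H)=-\log\det\pmb H$ and $$\alpha=\max\Big\{\tfrac{C_\infty}{\sqrt{d\log T}},\sqrt T\Big\}.$$ For a positive semidefinite $B$ and a positive definite $\Sigma$, $\mathrm{Bonus}(B,\Sigma)=\Sigma^{-1}$ if $B\preceq\Sigma^{-1}$; otherwise $\mathrm{Bonus}(B,\Sigma)=B^{1/2}\big(\sum_{i}\max\{\lambda_i,1\}v_iv_i^\top\big)B^{1/2}$,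 where $B^{-1/2}\Sigma^{-1}B^{-1/2}=\sum_i\lambda_iv_iv_i^\top$ is an eigendecomposition with orthonormal $v_i$. **Algorithms.** Put $B_0=0$ and, for $t\ge1$, $\Sigma_t=\Sigma(p_t)$, $B_t=\mathrm{Bonus}(B_{t-1},\Sigma_t)$, $\hat\theta_t=\Sigma_t^{-1}a_tr_t$, where $p_t\in\Delta_\gamma(\mathcal A)$ is such that $\pmb H_t=\widehat{\mathrm{Cov}}(p_t)$ satisfies $$\pmb H_t\in\operatorname*{argmax}_{\pmb H\in\mathcal H}\big\{\eta\langle\pmb H,\pmb\Theta\rangle-G(\pmb H)\big\},\qquad \pmb\Theta=\begin{bmatrix}\alpha B&\frac12\sum_{s<t}\hat\theta_s\\ \frac12\sum_{s<t}\hat\theta_s^\top&0\end{bmatrix}.$$ * *Option I (fixed point):* $B=B_t$ (so $p_t$ and $B_t$ are determined jointly) and $\eta=\sqrt{\log T/T}$. * *Option II (standard FTRL):* $B=B_{t-1}$ and $\eta=\min\big\{\frac{\sqrt{\log T}}{16C_\infty},\frac1{16\sqrt T}\big\}$ (the first term is $+\infty$ if $C_\infty=0$). **Theorem.** There is an absolute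 constant $K$ such that, for every $\delta\in(0,1)$, with probability at least $1-\delta$, simultaneously for all $p_\star\in\Delta(\mathcal A)$, $$\mathrm{Reg}_T(p_\star)\le K\big(d\sqrt T\,\log(T/\delta)+C_\infty\sqrt{d\log T}\big)$$ if the learner follows Option I, and $$\mathrm{Reg}_T(p_\star)\le K\big(d\sqrt T\,\log(T/\delta)+d\,C_\infty\sqrt{\log T}\big)$$ if the learner follows Option II. -/

import Mathlib

open MeasureTheory ProbabilityTheory
open scoped Matrix

namespace LogDetBandit

noncomputable section

/-! ### Distributions over a finite action set and their (lifted) covariance matrices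

The action set is a finite set `A` of vectors; a distribution over `A` is a point of
`stdSimplex ℝ A`. -/

/-- `μ(p) = E_{a ∼ p}[a]`. -/
def mean {d : ℕ} {A : Finset (Fin d → ℝ)} (p : A → ℝ) : Fin d → ℝ :=
  ∑ a : A, p a • (a : Fin d → ℝ)

/-- `Σ(p) = E_{a ∼ p}[a aᵀ]`. -/
def secondMoment {d : ℕ} {A : Finset (Fin d → ℝ)} (p : A → ℝ) : Matrix (Fin d) (Fin d) ℝ :=
  ∑ a : A, p a • Matrix.vecMulVec (a : Fin d → ℝ) (a : Fin d → ℝ)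

/-- `Cov(p) = E_{a ∼ p}[(a - μ(p)) (a - μ(p))ᵀ]`. -/
def cov {d : ℕ} {A : Finset (Fin d → ℝ)} (p : A → ℝ) : Matrix (Fin d) (Fin d) ℝ :=
  ∑ a : A, p a • Matrix.vecMulVec ((a : Fin d → ℝ) - mean p) ((a : Fin d → ℝ) - mean p)

/-- The lifted covariance matrix: the symmetric `(d+1) × (d+1)` block matrix with blocks
`Cov(p) + μ(p) μ(p)ᵀ`, `μ(p)`, `μ(p)ᵀ` and `1`. -/
def liftedCov {d : ℕ} {A : Finset (Fin d → ℝ)} (p : A → ℝ) :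
    Matrix (Fin d ⊕ Unit) (Fin d ⊕ Unit) ℝ :=
  Matrix.fromBlocks (cov p + Matrix.vecMulVec (mean p) (mean p))
    (Matrix.replicateCol Unit (mean p)) (Matrix.replicateRow Unit (mean p)) 1

/-! ### John's exploration -/

/-- The ellipsoid `{x | (x - c)ᵀ M⁻¹ (x - c) ≤ 1}`. -/
def ellipsoid {d : ℕ} (c : Fin d → ℝ) (M : Matrix (Fin d) (Fin d) ℝ) : Set (Fin d → ℝ) :=
  {x | (x - c) ⬝ᵥ (M⁻¹ *ᵥ (x - c)) ≤ 1}

/-- `ellipsoid c M` is a minimum-volume ellipsoid enclosing `A`. -/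
structure IsMinVolumeEllipsoid {d : ℕ} (A : Finset (Fin d → ℝ)) (c : Fin d → ℝ)
    (M : Matrix (Fin d) (Fin d) ℝ) : Prop where
  posDef : M.PosDef
  encloses : (A : Set (Fin d → ℝ)) ⊆ ellipsoid c M
  minimal : ∀ (c' : Fin d → ℝ) (M' : Matrix (Fin d) (Fin d) ℝ), M'.PosDef →
    (A : Set (Fin d → ℝ)) ⊆ ellipsoid c' M' →
      volume (ellipsoid c M) ≤ volume (ellipsoid c' M')

/-- `ρ` is a John's exploration distribution over `A`: it is carried by the contact points of `A`
with the boundary of the minimum-volume enclosing ellipsoid `{x | (x - c)ᵀ M⁻¹ (x - c) ≤ 1}`, and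
its weights give the decomposition of John's theorem: `∑ ρ(a) (a - c) = 0` and
`∑ ρ(a) (a - c) (a - c)ᵀ = M / d`. -/
def IsJohnExploration {d : ℕ} (A : Finset (Fin d → ℝ)) (ρ : A → ℝ) : Prop :=
  ρ ∈ stdSimplex ℝ A ∧
  ∃ (c : Fin d → ℝ) (M : Matrix (Fin d) (Fin d) ℝ), IsMinVolumeEllipsoid A c M ∧
    (∀ a : A, ρ a ≠ 0 → ((a : Fin d → ℝ) - c) ⬝ᵥ (M⁻¹ *ᵥ ((a : Fin d → ℝ) - c)) = 1) ∧
    ∑ a : A, ρ a • ((a : Fin d → ℝ) - c) = 0 ∧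
    ∑ a : A, ρ a • Matrix.vecMulVec ((a : Fin d → ℝ) - c) ((a : Fin d → ℝ) - c)
      = (1 / (d : ℝ)) • M

/-! ### The ingredients of the algorithms -/

/-- `Δ_γ(A) = {(1 - γ) p' + γ ρ : p' ∈ Δ(A)}`. -/
def mixedSimplex {d : ℕ} {A : Finset (Fin d → ℝ)} (γ : ℝ) (ρ : A → ℝ) : Set (A → ℝ) :=
  {p | ∃ p' ∈ stdSimplex ℝ A, p = (1 - γ) • p' + γ • ρ}

/-- The feasible set of lifted covariance matrices of the elements of `Δ_γ(A)`. -/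
def feasibleSet {d : ℕ} {A : Finset (Fin d → ℝ)} (γ : ℝ) (ρ : A → ℝ) :
    Set (Matrix (Fin d ⊕ Unit) (Fin d ⊕ Unit) ℝ) :=
  liftedCov '' mixedSimplex γ ρ

/-- The log-determinant barrier `G(H) = - log det H`. -/
def logDetBarrier {d : ℕ} (H : Matrix (Fin d ⊕ Unit) (Fin d ⊕ Unit) ℝ) : ℝ :=
  - Real.log H.det

open Classical in
/-- The bonus function `Bonus(B, S)`, for `B` positive semidefinite and `S` positive definite:
it is `S⁻¹` if `B ⪯ S⁻¹`; otherwise it is `B^{1/2} (∑ᵢ max{λᵢ, 1} vᵢ vᵢᵀ) B^{1/2}`,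
where `∑ᵢ λᵢ vᵢ vᵢᵀ` is the eigendecomposition of `B^{-1/2} S⁻¹ B^{-1/2}`. Functions of symmetric
matrices are taken through the continuous functional calculus `cfc`, that is, on the
eigenvalues. -/
def bonus {d : ℕ} (B S : Matrix (Fin d) (Fin d) ℝ) : Matrix (Fin d) (Fin d) ℝ :=
  if (S⁻¹ - B).PosSemidef then S⁻¹
  else
    cfc Real.sqrt B *
      cfc (fun x : ℝ => max x 1) ((cfc Real.sqrt B)⁻¹ * S⁻¹ * (cfc Real.sqrt B)⁻¹) *
      cfc Real.sqrt B

/-- The bonus matrices `B_0 = 0`, `B_t = Bonus(B_{t-1}, Σ_t)` along a sequence of distributions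
`p_1, p_2, …`, with `Σ_t = Σ(p_t)`. -/
def bonusSeq {d : ℕ} {A : Finset (Fin d → ℝ)} (p : ℕ → A → ℝ) : ℕ → Matrix (Fin d) (Fin d) ℝ
  | 0 => 0
  | t + 1 => bonus (bonusSeq p t) (secondMoment (p (t + 1)))

/-- The reward estimator `θ̂ = Σ(p)⁻¹ a r`. -/
def estimator {d : ℕ} {A : Finset (Fin d → ℝ)} (p : A → ℝ) (a : A) (r : ℝ) : Fin d → ℝ :=
  r • ((secondMoment p)⁻¹ *ᵥ (a : Fin d → ℝ))

/-- The block matrix with blocks `α B`, `v / 2`, `vᵀ / 2` and `0`. -/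
def gainMatrix {d : ℕ} (α : ℝ) (B : Matrix (Fin d) (Fin d) ℝ) (v : Fin d → ℝ) :
    Matrix (Fin d ⊕ Unit) (Fin d ⊕ Unit) ℝ :=
  Matrix.fromBlocks (α • B) (Matrix.replicateCol Unit ((1 / 2 : ℝ) • v))
    (Matrix.replicateRow Unit ((1 / 2 : ℝ) • v)) 0

/-- The objective `η ⟨H, Θ⟩ - G(H)`. -/
def ftrlObjective {d : ℕ} (η : ℝ) (Θ H : Matrix (Fin d ⊕ Unit) (Fin d ⊕ Unit) ℝ) : ℝ :=
  η * (Hᵀ * Θ).trace - logDetBarrier H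

/-- `p` is an element of `Δ_γ(A)` whose lifted covariance matrix maximizes the objective
`η ⟨H, Θ⟩ - G(H)` over the feasible set. -/
def IsFTRLChoice {d : ℕ} {A : Finset (Fin d → ℝ)} (γ η : ℝ) (ρ : A → ℝ)
    (Θ : Matrix (Fin d ⊕ Unit) (Fin d ⊕ Unit) ℝ) (p : A → ℝ) : Prop :=
  p ∈ mixedSimplex γ ρ ∧ IsMaxOn (ftrlObjective η Θ) (feasibleSet γ ρ) (liftedCov p)

/-! ### The two algorithms

A trajectory consists of distributions `p_t`, actions `a_t` and rewards `r_t`, `t = 1, …, T`. -/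

/-- First algorithm: the bonus used in round `t` is `B_t`, which itself depends on `p_t`, so that
`p_t`, `Σ_t` and `B_t` solve a joint fixed-point condition. -/
def FollowsFixedPointFTRL {d : ℕ} {A : Finset (Fin d → ℝ)} (T : ℕ) (γ α η : ℝ) (ρ : A → ℝ)
    (p : ℕ → A → ℝ) (a : ℕ → A) (r : ℕ → ℝ) : Prop :=
  ∀ t ∈ Finset.Icc 1 T,
    IsFTRLChoice γ η ρ
      (gainMatrix α (bonusSeq p t) (∑ s ∈ Finset.Ico 1 t, estimator (p s) (a s) (r s))) (p t)

/-- Second algorithm (standard FTRL): the bonus used in round `t` is `B_{t-1}`. -/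
def FollowsStandardFTRL {d : ℕ} {A : Finset (Fin d → ℝ)} (T : ℕ) (γ α η : ℝ) (ρ : A → ℝ)
    (p : ℕ → A → ℝ) (a : ℕ → A) (r : ℕ → ℝ) : Prop :=
  ∀ t ∈ Finset.Icc 1 T,
    IsFTRLChoice γ η ρ
      (gainMatrix α (bonusSeq p (t - 1)) (∑ s ∈ Finset.Ico 1 t, estimator (p s) (a s) (r s)))
      (p t)

/-- `γ = d / √T`. -/
def mixRate (d T : ℕ) : ℝ := d / √(T : ℝ)

/-- `α = max{C / √(d log T), √T}`. -/
def bonusRate (d T : ℕ) (C : ℝ) : ℝ := max (C / √(d * Real.log T)) √(T : ℝ)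

/-- `η = √(log T / T)`, the learning rate of the first algorithm. -/
def learningRate (T : ℕ) : ℝ := √(Real.log T / T)

/-- `η = min{√(log T) / (16 C), 1 / (16 √T)}` (the first term being `+∞` if `C = 0`), the learning
rate of the second algorithm, written so that nothing is divided by `C`. -/
def learningRateStandard (T : ℕ) (C : ℝ) : ℝ := 1 / (16 * max (C / √(Real.log T)) √(T : ℝ))

/-! ### The interaction with the adversary, and the regret -/

/-- `T` rounds of a misspecified adversarial linear bandit with total misspecification at most `C`.
`ℱ t` is the information generated up to the end of round `t`, together with what the adversary
has fixed for round `t + 1`. In round `t = 1, …, T` the adversary fixes `θ_t` and the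
misspecification `ε_t : A → ℝ`, possibly depending on the past; the learner draws `a_t ∼ p_t`, and
receives `r_t ∈ [-1, 1]` with conditional mean `⟨a_t, θ_t⟩ + ε_t(a_t)`. -/
structure IsMisspecifiedBandit {Ω : Type*} [mΩ : MeasurableSpace Ω] (P : Measure Ω)
    (ℱ : Filtration ℕ mΩ) {d : ℕ} {A : Finset (Fin d → ℝ)} (T : ℕ) (C : ℝ)
    (θ : ℕ → Ω → Fin d → ℝ) (ε : ℕ → Ω → A → ℝ)
    (p : ℕ → Ω → A → ℝ) (a : ℕ → Ω → A) (r : ℕ → Ω → ℝ) : Prop where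
  measurable_theta : ∀ t ∈ Finset.Icc 1 T, Measurable[ℱ (t - 1)] (θ t)
  measurable_eps : ∀ t ∈ Finset.Icc 1 T, Measurable[ℱ (t - 1)] (ε t)
  measurable_dist : ∀ t ∈ Finset.Icc 1 T, Measurable[ℱ (t - 1)] (p t)
  measurable_action : ∀ t ∈ Finset.Icc 1 T, Measurable[ℱ t] (a t)
  measurable_reward : ∀ t ∈ Finset.Icc 1 T, Measurable[ℱ t] (r t)
  abs_inner_le : ∀ t ∈ Finset.Icc 1 T, ∀ ω, ∀ x ∈ A, |x ⬝ᵥ θ t ω| ≤ 1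
  abs_reward_le : ∀ t ∈ Finset.Icc 1 T, ∀ ω, |r t ω| ≤ 1
  misspecification_le : ∀ ω, ∑ t ∈ Finset.Icc 1 T, ⨆ x : A, |ε t ω x| ≤ C
  action_law : ∀ t ∈ Finset.Icc 1 T, ∀ x : A,
    P⟦a t ⁻¹' {x} | ℱ (t - 1)⟧ =ᵐ[P] fun ω => p t ω x
  reward_mean : ∀ t ∈ Finset.Icc 1 T,
    P[r t | ℱ (t - 1) ⊔ MeasurableSpace.comap (a t) inferInstance] =ᵐ[P]
      fun ω => (a t ω : Fin d → ℝ) ⬝ᵥ θ t ω + ε t ω (a t ω)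

/-- The regret `Reg_T(p⋆) = ∑_{t=1}^T ⟨E_{x ∼ p⋆}[x] - a_t, θ_t⟩` against the comparator `p⋆`. -/
def regret {d : ℕ} {A : Finset (Fin d → ℝ)} (T : ℕ) (θ : ℕ → Fin d → ℝ) (a : ℕ → A)
    (pstar : A → ℝ) : ℝ :=
  ∑ t ∈ Finset.Icc 1 T, (mean pstar - (a t : Fin d → ℝ)) ⬝ᵥ θ t

end

end LogDetBandit

/-!
The maximizer property of FTRL with the barrier `-log det` bounds the regret measured by the
estimates `θ̂_t`. The second-order term of `log det` yields the local norms of the played actions,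
and the bonus adds a cost controlled by the potential `log det B_t`, in exchange for the term
`-α tr(Σ(q) B_T)` in the bound against each comparator `q`.

The true regret against an action `x` exceeds its estimate by a sum whose conditional variance and
misspecification bias are both governed by `xᵀ Σ(p_t)⁻¹ x`. As `B_T` dominates every `Σ(p_t)⁻¹`,
the quantity `xᵀ B_T x` controls both, so the term `-α tr(Σ(q) B_T)` absorbs them up to the
stated rates: this is what dictates `α`. An exponential supermartingale makes the deviation bound
hold with high probability for each fixed `x`. A finite net extends it to all actions, and averaging
over `q` to all comparators, once they are mixed with John's exploration `ρ`. The latter ensures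
`(a, 1) (a, 1)ᵀ ⪯ 2 √T H_t` for every action `a`, so all increments are bounded.
-/

namespace LogDetBandit

open scoped MatrixOrder

/-! ### Real symmetric matrices and the Loewner order -/

theorem isSymm_of_posSemidef {n : Type*} {M : Matrix n n ℝ} (hM : M.PosSemidef) : M.IsSymm :=
  Matrix.isHermitian_iff_isSymm.1 hM.isHermitian

theorem posDef_of_posDef_of_le {n : Type*} {M N : Matrix n n ℝ} (hM : M.PosDef) (h : M ≤ N) :
    N.PosDef := by
  have := hM.add_posSemidef (Matrix.le_iff.1 h)
  rwa [add_sub_cancel] at this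

section QuadraticForms

variable {n : Type*} [Fintype n]

theorem dotProduct_mulVec_comm {M : Matrix n n ℝ} (hM : M.IsSymm) (v w : n → ℝ) :
    v ⬝ᵥ (M *ᵥ w) = w ⬝ᵥ (M *ᵥ v) := by
  rw [Matrix.dotProduct_mulVec, ← Matrix.mulVec_transpose, hM.eq, dotProduct_comm]

theorem dotProduct_conj_mulVec {Q : Matrix n n ℝ} (hQ : Q.IsSymm) (M : Matrix n n ℝ)
    (v w : n → ℝ) :
    v ⬝ᵥ ((Q * M * Q) *ᵥ w) = (Q *ᵥ v) ⬝ᵥ (M *ᵥ (Q *ᵥ w)) := by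
  rw [← Matrix.mulVec_mulVec, ← Matrix.mulVec_mulVec, Matrix.dotProduct_mulVec v,
    ← Matrix.mulVec_transpose, hQ.eq]

theorem quad_nonneg {M : Matrix n n ℝ} (hM : M.PosSemidef) (x : n → ℝ) :
    0 ≤ x ⬝ᵥ (M *ᵥ x) :=
  hM.dotProduct_mulVec_nonneg x

theorem quad_pos {M : Matrix n n ℝ} (hM : M.PosDef) {x : n → ℝ} (hx : x ≠ 0) :
    0 < x ⬝ᵥ (M *ᵥ x) :=
  hM.dotProduct_mulVec_pos hx

theorem quad_le_quad {M N : Matrix n n ℝ} (h : M ≤ N) (x : n → ℝ) :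
    x ⬝ᵥ (M *ᵥ x) ≤ x ⬝ᵥ (N *ᵥ x) := by
  have := quad_nonneg (Matrix.le_iff.1 h) x
  rwa [Matrix.sub_mulVec, dotProduct_sub, sub_nonneg] at this

theorem le_of_quad_le_quad {M N : Matrix n n ℝ} (hM : M.IsSymm) (hN : N.IsSymm)
    (h : ∀ x, x ⬝ᵥ (M *ᵥ x) ≤ x ⬝ᵥ (N *ᵥ x)) : M ≤ N := by
  refine Matrix.le_iff.2 (.of_dotProduct_mulVec_nonneg ?_ fun x => ?_)
  · exact Matrix.isHermitian_iff_isSymm.2 (hN.sub hM)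
  · rw [star_trivial, Matrix.sub_mulVec, dotProduct_sub, sub_nonneg]
    exact h x

theorem posDef_of_quad_pos {M : Matrix n n ℝ} (hM : M.IsSymm)
    (h : ∀ x, x ≠ 0 → 0 < x ⬝ᵥ (M *ᵥ x)) : M.PosDef :=
  .of_dotProduct_mulVec_pos (Matrix.isHermitian_iff_isSymm.2 hM) fun x hx => h x hx

theorem sq_dotProduct_mulVec_le {M : Matrix n n ℝ} (hM : M.PosSemidef) (v w : n → ℝ) :
    (v ⬝ᵥ (M *ᵥ w)) ^ 2 ≤ (v ⬝ᵥ (M *ᵥ v)) * (w ⬝ᵥ (M *ᵥ w)) := by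
  have quad_add_smul : ∀ t : ℝ, 0 ≤ (w ⬝ᵥ (M *ᵥ w)) * (t * t) + (2 * (v ⬝ᵥ (M *ᵥ w))) * t
      + v ⬝ᵥ (M *ᵥ v) := by
    intro t
    have := quad_nonneg hM (v + t • w)
    simp only [Matrix.mulVec_add, Matrix.mulVec_smul, dotProduct_add, add_dotProduct,
      dotProduct_smul, smul_dotProduct, smul_eq_mul] at this
    rw [dotProduct_mulVec_comm (isSymm_of_posSemidef hM) w v] at this
    linarith
  have := discrim_le_zero quad_add_smul
  rw [discrim] at this
  linarith

theorem quad_add_le {M : Matrix n n ℝ} (hM : M.PosSemidef) (v w : n → ℝ) :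
    (v + w) ⬝ᵥ (M *ᵥ (v + w)) ≤ 2 * (v ⬝ᵥ (M *ᵥ v)) + 2 * (w ⬝ᵥ (M *ᵥ w)) := by
  have := quad_nonneg hM (v - w)
  simp only [Matrix.mulVec_sub, Matrix.mulVec_add, dotProduct_sub, dotProduct_add, sub_dotProduct,
    add_dotProduct] at this ⊢
  linarith

variable [DecidableEq n]

theorem mul_inv_of_posDef {M : Matrix n n ℝ} (hM : M.PosDef) : M * M⁻¹ = 1 :=
  Matrix.mul_nonsing_inv _ hM.det_pos.ne'.isUnit

theorem inv_mul_of_posDef {M : Matrix n n ℝ} (hM : M.PosDef) : M⁻¹ * M = 1 :=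
  Matrix.nonsing_inv_mul _ hM.det_pos.ne'.isUnit

theorem mulVec_inv_mulVec {M : Matrix n n ℝ} (hM : M.PosDef) (v : n → ℝ) :
    M *ᵥ (M⁻¹ *ᵥ v) = v := by
  rw [Matrix.mulVec_mulVec, mul_inv_of_posDef hM, Matrix.one_mulVec]

theorem sq_dotProduct_le {M : Matrix n n ℝ} (hM : M.PosDef) (v w : n → ℝ) :
    (v ⬝ᵥ w) ^ 2 ≤ (v ⬝ᵥ (M⁻¹ *ᵥ v)) * (w ⬝ᵥ (M *ᵥ w)) := by
  have h := sq_dotProduct_mulVec_le hM.posSemidef (M⁻¹ *ᵥ v) w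
  rwa [mulVec_inv_mulVec hM, dotProduct_comm (M⁻¹ *ᵥ v) v,
    dotProduct_mulVec_comm (isSymm_of_posSemidef hM.posSemidef), mulVec_inv_mulVec hM,
    dotProduct_comm w v] at h

theorem inv_le_smul_inv {M N : Matrix n n ℝ} (hM : M.PosDef) (hN : N.PosDef) {c : ℝ}
    (h : M ≤ c • N) : N⁻¹ ≤ c • M⁻¹ := by
  refine le_of_quad_le_quad (isSymm_of_posSemidef hN.inv.posSemidef)
    ((isSymm_of_posSemidef hM.inv.posSemidef).smul c) fun y => ?_
  rcases eq_or_ne y 0 with rfl | hy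
  · simp
  have cauchy_schwarz := sq_dotProduct_le hM y (N⁻¹ *ᵥ y)
  have quad_le := quad_le_quad h (N⁻¹ *ᵥ y)
  rw [Matrix.smul_mulVec, dotProduct_smul, smul_eq_mul] at quad_le ⊢
  rw [mulVec_inv_mulVec hN, dotProduct_comm (N⁻¹ *ᵥ y) y] at quad_le
  refine le_of_mul_le_mul_right ?_ (quad_pos hN.inv hy)
  nlinarith [mul_le_mul_of_nonneg_left quad_le (quad_nonneg hM.inv.posSemidef y)]

end QuadraticForms

/-! ### Functions of a symmetric matrix -/

section FunctionalCalculus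

variable {n : Type*} [Fintype n] [DecidableEq n]

theorem det_cfc {𝕜 : Type*} [RCLike 𝕜] {X : Matrix n n 𝕜} (hX : X.IsHermitian) (f : ℝ → ℝ) :
    (cfc f X).det = ∏ i, (f (hX.eigenvalues i) : 𝕜) := by
  rw [hX.cfc_eq, Matrix.IsHermitian.cfc, Unitary.conjStarAlgAut_apply, Matrix.det_mul_comm,
    ← mul_assoc, Unitary.coe_star_mul_self, one_mul, Matrix.det_diagonal]
  rfl

theorem trace_cfc {𝕜 : Type*} [RCLike 𝕜] {X : Matrix n n 𝕜} (hX : X.IsHermitian) (f : ℝ → ℝ) :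
    (cfc f X).trace = ∑ i, (f (hX.eigenvalues i) : 𝕜) := by
  rw [hX.cfc_eq, Matrix.IsHermitian.cfc, Unitary.conjStarAlgAut_apply, Matrix.trace_mul_comm,
    ← mul_assoc, Unitary.coe_star_mul_self, one_mul, Matrix.trace_diagonal]
  rfl

theorem continuousOn_spectrum {𝕜 : Type*} [RCLike 𝕜] (X : Matrix n n 𝕜) (f : ℝ → ℝ) :
    ContinuousOn f (spectrum ℝ X) :=
  (Set.toFinite (spectrum ℝ X)).continuousOn f

theorem cfc_sqrt_mul_self {M : Matrix n n ℝ} (hM : M.PosSemidef) :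
    cfc Real.sqrt M * cfc Real.sqrt M = M := by
  have hsa : IsSelfAdjoint M := hM.isHermitian
  have sqrt_mul_sqrt : (spectrum ℝ M).EqOn (fun x => √x * √x) id := fun x hx =>
    Real.mul_self_sqrt (spectrum_nonneg_of_nonneg hM.nonneg hx)
  rw [← cfc_mul _ _ M (continuousOn_spectrum M _) (continuousOn_spectrum M _),
    cfc_congr sqrt_mul_sqrt, cfc_id ℝ M]

theorem posDef_cfc_sqrt {M : Matrix n n ℝ} (hM : M.PosDef) : (cfc Real.sqrt M).PosDef := by
  have posSemidef : (cfc Real.sqrt M).PosSemidef :=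
    Matrix.nonneg_iff_posSemidef.1 (cfc_nonneg fun x _ => Real.sqrt_nonneg x)
  refine posSemidef.posDef_iff_isUnit.2 (isUnit_of_mul_isUnit_left (y := cfc Real.sqrt M) ?_)
  rw [cfc_sqrt_mul_self hM.posSemidef]
  exact hM.isUnit

end FunctionalCalculus

section SquareRoots

variable {n : Type*} [Fintype n]

theorem exists_posDef_mul_self {M : Matrix n n ℝ} (hM : M.PosDef) :
    ∃ Q : Matrix n n ℝ, Q.PosDef ∧ M = Q * Q := by
  classical
  exact ⟨_, posDef_cfc_sqrt hM, (cfc_sqrt_mul_self hM.posSemidef).symm⟩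

theorem posDef_conj {M Q : Matrix n n ℝ} (hM : M.PosDef) (hQ : Q.PosDef) :
    (Q * M * Q).PosDef := by
  classical
  have := hM.conjTranspose_mul_mul_same (Matrix.mulVec_injective_iff_isUnit.2 hQ.isUnit)
  rwa [hQ.isHermitian.eq] at this

theorem trace_mul_nonneg {M N : Matrix n n ℝ} (hM : M.PosDef) (hN : N.PosSemidef) :
    0 ≤ (M * N).trace := by
  classical
  obtain ⟨Q, hQ, rfl⟩ := exists_posDef_mul_self hM
  have := (hN.conjTranspose_mul_mul_same Q).trace_nonneg
  rwa [hQ.isHermitian.eq, Matrix.trace_mul_comm, ← mul_assoc] at this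

end SquareRoots

/-! ### The log-determinant -/

section LogDet

variable {n : Type*} [Fintype n] [DecidableEq n]

theorem log_det_inv {M : Matrix n n ℝ} : Real.log M⁻¹.det = - Real.log M.det := by
  rw [Matrix.det_nonsing_inv, Ring.inverse_eq_inv', Real.log_inv]

theorem log_det_conj {M Q : Matrix n n ℝ} (hM : M.PosDef) (hQ : Q.PosDef) :
    Real.log (Q * M * Q).det = Real.log (Q * Q).det + Real.log M.det := by
  have := hQ.det_pos.ne'
  rw [← Real.log_mul (by simpa using this) hM.det_pos.ne']
  simp only [Matrix.det_mul]
  ring_nf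

theorem log_det_le_trace_sub_card {M : Matrix n n ℝ} (hM : M.PosDef) :
    Real.log M.det ≤ M.trace - Fintype.card n := by
  have det_eq := hM.1.det_eq_prod_eigenvalues
  have trace_eq := hM.1.trace_eq_sum_eigenvalues
  simp only [RCLike.ofReal_real_eq_id, id] at det_eq trace_eq
  rw [det_eq, trace_eq, Real.log_prod (fun i _ => (hM.eigenvalues_pos i).ne')]
  calc _ ≤ ∑ i, (hM.1.eigenvalues i - 1) :=
        Finset.sum_le_sum fun i _ => Real.log_le_sub_one_of_pos (hM.eigenvalues_pos i)
    _ = _ := by simp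

theorem log_det_add_log_det_le {M N : Matrix n n ℝ} (hM : M.PosDef) (hN : N.PosDef) :
    Real.log M.det + Real.log N.det ≤ (M * N).trace - Fintype.card n := by
  obtain ⟨Q, hQ, rfl⟩ := exists_posDef_mul_self hM
  have h := log_det_le_trace_sub_card (posDef_conj hN hQ)
  rwa [log_det_conj hN hQ, Matrix.trace_mul_comm, ← mul_assoc] at h

theorem log_det_le_of_le_smul {M N : Matrix n n ℝ} (hM : M.PosDef) (hN : N.PosDef) {c : ℝ}
    (hc : 0 < c) (h : M ≤ c • N) :
    Real.log M.det ≤ Fintype.card n * Real.log c + Real.log N.det := by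
  have hcN : (c • N).PosDef := hN.smul hc
  have fenchel_young := log_det_add_log_det_le hM hcN.inv
  have trace_nonneg := trace_mul_nonneg hcN.inv (Matrix.le_iff.1 h)
  rw [mul_sub, inv_mul_of_posDef hcN, Matrix.trace_sub, Matrix.trace_one,
    Matrix.trace_mul_comm] at trace_nonneg
  have log_det_smul : Real.log (c • N).det = Fintype.card n * Real.log c + Real.log N.det := by
    rw [Matrix.det_smul, Real.log_mul (pow_pos hc _).ne' hN.det_pos.ne', Real.log_pow]
  rw [log_det_inv] at fenchel_young
  linarith

theorem neg_log_one_sub_le {x : ℝ} (hx : x ≤ 1 / 2) : -Real.log (1 - x) ≤ x + x ^ 2 := by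
  have one_sub_pos : 0 < 1 - x := by linarith
  rcases le_total x 0 with h | h
  · have log_ge := Real.le_log_one_add_of_nonneg (neg_nonneg.2 h)
    have : -x - x ^ 2 ≤ 2 * -x / (-x + 2) := by
      rw [le_div_iff₀ (by linarith)]
      nlinarith [mul_nonneg (neg_nonneg.2 h) (sq_nonneg x), sq_nonneg x]
    rw [← sub_eq_add_neg] at log_ge
    linarith
  · have exp_ge := Real.quadratic_le_exp_of_nonneg (x := x + x ^ 2) (by positivity)
    rw [← Real.log_inv, Real.log_le_iff_le_exp (inv_pos.2 one_sub_pos)]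
    refine le_trans ?_ exp_ge
    rw [inv_le_iff_one_le_mul₀ one_sub_pos]
    have : 0 ≤ x ^ 2 * (1 - 2 * x) := mul_nonneg (sq_nonneg x) (by linarith)
    nlinarith [mul_nonneg (sq_nonneg (x ^ 2)) h, mul_nonneg this h,
      mul_nonneg (mul_nonneg this h) h]

theorem eigenvalues_le_of_le_smul_one {X : Matrix n n ℝ} (hX : X.IsHermitian) {c : ℝ}
    (h : X ≤ c • 1) (i : n) : hX.eigenvalues i ≤ c := by
  have := le_algebraMap_iff_spectrum_le (ha := hX) |>.1
    (by rwa [Algebra.algebraMap_eq_smul_one]) (hX.eigenvalues i)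
    (hX.eigenvalues_mem_spectrum_real i)
  exact this

theorem log_det_one_sub_ge {X : Matrix n n ℝ} (hX : X.IsSymm) (h : X ≤ (1 / 2 : ℝ) • 1) :
    (1 - X).PosDef ∧ -X.trace - (X * X).trace ≤ Real.log (1 - X).det := by
  have hX' : X.IsHermitian := Matrix.isHermitian_iff_isSymm.2 hX
  have hsa : IsSelfAdjoint X := hX'
  have eigenvalues_le := eigenvalues_le_of_le_smul_one hX' h
  have one_sub_eq : 1 - X = cfc (fun x : ℝ => 1 - x) X := by
    rw [cfc_sub (R := ℝ) (fun _ => 1) (fun x => x) X, cfc_const_one ℝ X, cfc_id' ℝ X]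
  have sq_eq : X * X = cfc (fun x : ℝ => x ^ 2) X := by
    rw [cfc_pow_id (R := ℝ) X, sq]
  constructor
  · refine posDef_of_posDef_of_le (Matrix.PosDef.one.smul (one_half_pos (α := ℝ))) ?_
    calc (1 / 2 : ℝ) • (1 : Matrix n n ℝ) = 1 - (1 / 2 : ℝ) • 1 := by module
      _ ≤ 1 - X := sub_le_sub_left h 1
  · rw [one_sub_eq, sq_eq, det_cfc hX', trace_cfc hX', hX'.trace_eq_sum_eigenvalues]
    simp only [RCLike.ofReal_real_eq_id, id]
    rw [Real.log_prod fun i _ => (by linarith [eigenvalues_le i]),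
      ← Finset.sum_neg_distrib, ← Finset.sum_sub_distrib]
    exact Finset.sum_le_sum fun i _ => by linarith [neg_log_one_sub_le (eigenvalues_le i)]

theorem log_det_sub_ge {M N : Matrix n n ℝ} (hM : M.PosDef) (hN : N.IsSymm)
    (h : N ≤ (1 / 2 : ℝ) • M) :
    (M - N).PosDef ∧ Real.log M.det - (M⁻¹ * N).trace - (M⁻¹ * N * (M⁻¹ * N)).trace
      ≤ Real.log (M - N).det := by
  obtain ⟨Q, hQ, rfl⟩ := exists_posDef_mul_self hM
  have hQi : Q⁻¹.IsHermitian := hQ.inv.isHermitian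
  set X := Q⁻¹ * N * Q⁻¹ with hX
  have inv_conj : Q⁻¹ * (Q * Q) * Q⁻¹ = 1 := by
    rw [← mul_assoc, inv_mul_of_posDef hQ, one_mul, mul_inv_of_posDef hQ]
  have sub_eq : Q * Q - N = Q * (1 - X) * Q := by
    have : Q * (Q⁻¹ * N * Q⁻¹) * Q = (Q * Q⁻¹) * N * (Q⁻¹ * Q) := by noncomm_ring
    rw [mul_sub, sub_mul, mul_one, hX, this, mul_inv_of_posDef hQ, inv_mul_of_posDef hQ, one_mul,
      mul_one]
  have hXs : X.IsSymm := by
    rw [hX, Matrix.IsSymm, Matrix.transpose_mul, Matrix.transpose_mul, hN.eq,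
      (isSymm_of_posSemidef hQ.inv.posSemidef).eq, mul_assoc]
  obtain ⟨posDef, log_det_ge⟩ := log_det_one_sub_ge hXs <| by
    have := IsSelfAdjoint.conjugate_le_conjugate h hQi
    rwa [Matrix.mul_smul, Matrix.smul_mul, inv_conj] at this
  have trace_eq : X.trace = ((Q * Q)⁻¹ * N).trace := by
    rw [Matrix.mul_inv_rev, hX, Matrix.trace_mul_comm, mul_assoc]
  have trace_sq_eq : (X * X).trace = ((Q * Q)⁻¹ * N * ((Q * Q)⁻¹ * N)).trace := by
    rw [Matrix.mul_inv_rev, hX, ← mul_assoc, Matrix.trace_mul_comm]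
    simp only [mul_assoc]
  rw [sub_eq]
  refine ⟨posDef_conj posDef hQ, ?_⟩
  rw [log_det_conj posDef hQ]
  linarith

/-- The Bregman divergence of the log-determinant barrier `H ↦ -log det H`, from `H` to `H'`. -/
noncomputable def logDetDiv (H' H : Matrix n n ℝ) : ℝ :=
  (H⁻¹ * H').trace - Fintype.card n - Real.log H'.det + Real.log H.det

theorem trace_sub_trace_le_logDetDiv {H H' N : Matrix n n ℝ} (hH : H.PosDef) (hH' : H'.PosDef)
    (hN : N.IsSymm) (h : N ≤ (1 / 2 : ℝ) • H⁻¹) :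
    (H' * N).trace - (H * N).trace ≤ logDetDiv H' H + (H * N * (H * N)).trace := by
  obtain ⟨posDef, log_det_ge⟩ := log_det_sub_ge hH.inv hN h
  have fenchel_young := log_det_add_log_det_le hH' posDef
  rw [Matrix.nonsing_inv_nonsing_inv _ hH.det_pos.ne'.isUnit, log_det_inv] at log_det_ge
  rw [mul_sub, Matrix.trace_sub, Matrix.trace_mul_comm H' H⁻¹] at fenchel_young
  rw [logDetDiv]
  linarith

theorem nonpos_of_forall_mul_le_sq_mul {x k : ℝ}
    (h : ∀ s ∈ Set.Ioc (0 : ℝ) (1 / 2), s * x ≤ s ^ 2 * k) : x ≤ 0 := by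
  have tendsto : Filter.Tendsto (fun s : ℝ => s * k) (nhdsWithin 0 (Set.Ioi 0)) (nhds 0) :=
    ((continuous_mul_const k).tendsto' 0 0 (zero_mul k)).mono_left nhdsWithin_le_nhds
  refine ge_of_tendsto tendsto ?_
  filter_upwards [Ioc_mem_nhdsGT one_half_pos] with s hs
  refine le_of_mul_le_mul_left ?_ hs.1
  linarith [h s hs]

/-- The slack in the first-order optimality condition at a maximizer of `l + log det` is exactly the
Bregman divergence of the barrier. -/
theorem le_sub_logDetDiv_of_isMaxOn_segment {H H' : Matrix n n ℝ} (hH : H.PosDef)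
    (hH' : H'.PosDef) (l : Matrix n n ℝ →ₗ[ℝ] ℝ)
    (h : IsMaxOn (fun X => l X + Real.log X.det) (segment ℝ H H') H) :
    l H' + Real.log H'.det ≤ l H + Real.log H.det - logDetDiv H' H := by
  suffices l H' - l H + ((H⁻¹ * H').trace - Fintype.card n) ≤ 0 by
    rw [logDetDiv]
    linarith
  refine nonpos_of_forall_mul_le_sq_mul (k := (H⁻¹ * (H - H') * (H⁻¹ * (H - H'))).trace)
    fun s hs => ?_
  have symm : (s • (H - H')).IsSymm :=
    ((isSymm_of_posSemidef hH.posSemidef).sub (isSymm_of_posSemidef hH'.posSemidef)).smul s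
  have le_half : s • (H - H') ≤ (1 / 2 : ℝ) • H := by
    have : 0 ≤ (1 / 2 - s) • H + s • H' := add_nonneg
      (hH.posSemidef.smul (sub_nonneg.2 hs.2)).nonneg (hH'.posSemidef.smul hs.1.le).nonneg
    rw [← sub_nonneg]
    convert this using 1
    module
  have log_det_ge := (log_det_sub_ge hH symm le_half).2
  have maximal : l (H - s • (H - H')) + Real.log (H - s • (H - H')).det ≤ l H + Real.log H.det := by
    refine h ⟨1 - s, s, by linarith [hs.2], hs.1.le, by ring, ?_⟩
    module
  simp only [map_sub, map_smul, smul_eq_mul, Matrix.mul_smul, Matrix.smul_mul, Matrix.trace_smul,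
    mul_sub, Matrix.trace_sub, inv_mul_of_posDef hH, Matrix.trace_one] at log_det_ge maximal ⊢
  linarith

end LogDet

/-! ### Moments of distributions over the actions -/

section Moments

variable {d : ℕ} {A : Finset (Fin d → ℝ)}

theorem dotProduct_vecMulVec_mulVec {n : Type*} [Fintype n] (u v w : n → ℝ) :
    v ⬝ᵥ (Matrix.vecMulVec u u *ᵥ w) = (v ⬝ᵥ u) * (w ⬝ᵥ u) := by
  rw [Matrix.vecMulVec_mulVec, op_smul_eq_smul, dotProduct_smul, smul_eq_mul, dotProduct_comm u w,
    mul_comm]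

theorem isSymm_sum_smul_vecMulVec {ι n : Type*} [Fintype ι] (p : ι → ℝ) (u : ι → n → ℝ) :
    (∑ i, p i • Matrix.vecMulVec (u i) (u i)).IsSymm := by
  simp only [Matrix.IsSymm, Matrix.transpose_sum, Matrix.transpose_smul,
    Matrix.transpose_vecMulVec]

theorem dotProduct_sum_smul_vecMulVec_mulVec {ι n : Type*} [Fintype ι] [Fintype n] (p : ι → ℝ)
    (u : ι → n → ℝ) (v w : n → ℝ) :
    v ⬝ᵥ ((∑ i, p i • Matrix.vecMulVec (u i) (u i)) *ᵥ w)
      = ∑ i, p i * ((v ⬝ᵥ u i) * (w ⬝ᵥ u i)) := by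
  simp only [Matrix.sum_mulVec, dotProduct_sum, Matrix.smul_mulVec, dotProduct_smul,
    dotProduct_vecMulVec_mulVec, smul_eq_mul]

theorem isSymm_secondMoment (p : A → ℝ) : (secondMoment p).IsSymm :=
  isSymm_sum_smul_vecMulVec p _

theorem dotProduct_secondMoment_mulVec (p : A → ℝ) (v w : Fin d → ℝ) :
    v ⬝ᵥ (secondMoment p *ᵥ w) = ∑ a : A, p a * ((v ⬝ᵥ a) * (w ⬝ᵥ a)) :=
  dotProduct_sum_smul_vecMulVec_mulVec p _ v w

theorem quad_secondMoment (p : A → ℝ) (v : Fin d → ℝ) :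
    v ⬝ᵥ (secondMoment p *ᵥ v) = ∑ a : A, p a * (v ⬝ᵥ a) ^ 2 := by
  simp only [dotProduct_secondMoment_mulVec, sq]

theorem mean_dotProduct (p : A → ℝ) (v : Fin d → ℝ) :
    mean p ⬝ᵥ v = ∑ a : A, p a * (a.1 ⬝ᵥ v) := by
  simp only [mean, sum_dotProduct, smul_dotProduct, smul_eq_mul]

theorem cov_add_vecMulVec_mean {p : A → ℝ} (hp : ∑ a, p a = 1) :
    cov p + Matrix.vecMulVec (mean p) (mean p) = secondMoment p := by
  ext i j
  have mean_apply : ∀ i, mean p i = ∑ a : A, p a * a.1 i := fun i => by simp [mean]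
  have expand : ∀ a : A, p a * ((a.1 i - mean p i) * (a.1 j - mean p j)) = p a * (a.1 i * a.1 j)
      - (p a * a.1 i) * mean p j - (p a * a.1 j) * mean p i + p a * (mean p i * mean p j) := by
    intro a
    ring
  simp only [cov, secondMoment, Matrix.add_apply, Matrix.sum_apply, Matrix.smul_apply,
    Matrix.vecMulVec_apply, Pi.sub_apply, smul_eq_mul, expand, Finset.sum_add_distrib,
    Finset.sum_sub_distrib, ← Finset.sum_mul, hp, ← mean_apply]
  ring

/-- The lift `(a, 1)` of a vector `a`, whose second moment is `liftedCov`. -/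
def liftVec (a : Fin d → ℝ) : Fin d ⊕ Unit → ℝ := Sum.elim a fun _ => 1

theorem exists_eq_sum_elim (z : Fin d ⊕ Unit → ℝ) : ∃ y s, z = Sum.elim y fun _ => s :=
  ⟨z ∘ Sum.inl, z (Sum.inr ()), by ext (i | i) <;> rfl⟩

theorem sum_elim_dotProduct_sum_elim (y v : Fin d → ℝ) (s r : ℝ) :
    (Sum.elim y fun _ : Unit => s) ⬝ᵥ (Sum.elim v fun _ => r) = y ⬝ᵥ v + s * r := by
  simp [dotProduct]

theorem sum_elim_dotProduct_liftVec (y : Fin d → ℝ) (s : ℝ) (a : Fin d → ℝ) :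
    (Sum.elim y fun _ => s) ⬝ᵥ liftVec a = y ⬝ᵥ a + s := by
  simp [dotProduct, liftVec]

theorem liftedCov_eq_sum {p : A → ℝ} (hp : ∑ a, p a = 1) :
    liftedCov p = ∑ a : A, p a • Matrix.vecMulVec (liftVec a.1) (liftVec a.1) := by
  rw [liftedCov, cov_add_vecMulVec_mean hp]
  ext (i | i) (j | j)
  · simp [liftVec, secondMoment, Matrix.sum_apply, Matrix.vecMulVec_apply]
  · simp [liftVec, mean, Matrix.sum_apply, Matrix.vecMulVec_apply]
  · simp [liftVec, mean, Matrix.sum_apply, Matrix.vecMulVec_apply]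
  · simp [liftVec, Matrix.sum_apply, Matrix.vecMulVec_apply, hp, -Finset.univ_eq_attach]

theorem isSymm_liftedCov {p : A → ℝ} (hp : ∑ a, p a = 1) : (liftedCov p).IsSymm := by
  rw [liftedCov_eq_sum hp]
  exact isSymm_sum_smul_vecMulVec p _

theorem quad_liftedCov {p : A → ℝ} (hp : ∑ a, p a = 1) (z : Fin d ⊕ Unit → ℝ) :
    z ⬝ᵥ (liftedCov p *ᵥ z) = ∑ a : A, p a * (z ⬝ᵥ liftVec a.1) ^ 2 := by
  simp only [liftedCov_eq_sum hp, dotProduct_sum_smul_vecMulVec_mulVec, sq]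

theorem quad_liftedCov_sum_elim_zero {p : A → ℝ} (hp : ∑ a, p a = 1) (y : Fin d → ℝ) :
    (Sum.elim y fun _ => 0) ⬝ᵥ (liftedCov p *ᵥ Sum.elim y fun _ => 0)
      = y ⬝ᵥ (secondMoment p *ᵥ y) := by
  simp only [quad_liftedCov hp, sum_elim_dotProduct_liftVec, quad_secondMoment, add_zero]

theorem quad_liftedCov_sum_elim_one {p : A → ℝ} (hp : ∑ a, p a = 1) :
    (Sum.elim 0 fun _ => 1) ⬝ᵥ (liftedCov p *ᵥ Sum.elim 0 fun _ => 1) = 1 := by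
  simp only [quad_liftedCov hp, sum_elim_dotProduct_liftVec, zero_dotProduct, zero_add, one_pow,
    mul_one, hp]

theorem liftedCov_convexCombo {p q : A → ℝ} (hp : ∑ a, p a = 1) (hq : ∑ a, q a = 1) {s t : ℝ}
    (hst : s + t = 1) : liftedCov (s • p + t • q) = s • liftedCov p + t • liftedCov q := by
  have sum_eq_one : ∑ a, (s • p + t • q) a = 1 := by
    simp only [Pi.add_apply, Pi.smul_apply, smul_eq_mul, Finset.sum_add_distrib, ← Finset.mul_sum,
      hp, hq, mul_one, hst]
  rw [liftedCov_eq_sum sum_eq_one, liftedCov_eq_sum hp, liftedCov_eq_sum hq, Finset.smul_sum,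
    Finset.smul_sum, ← Finset.sum_add_distrib]
  refine Finset.sum_congr rfl fun a _ => ?_
  simp only [Pi.add_apply, Pi.smul_apply, smul_eq_mul]
  module

theorem mixedSimplex_subset {γ : ℝ} {ρ : A → ℝ} (hγ₀ : 0 ≤ γ) (hγ₁ : γ ≤ 1)
    (hρ : ρ ∈ stdSimplex ℝ A) : mixedSimplex γ ρ ⊆ stdSimplex ℝ A := by
  rintro _ ⟨p', hp', rfl⟩
  exact convex_stdSimplex ℝ A hp' hρ (by linarith) hγ₀ (by ring)

theorem convex_mixedSimplex (γ : ℝ) (ρ : A → ℝ) : Convex ℝ (mixedSimplex γ ρ) := by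
  rintro _ ⟨p, hp, rfl⟩ _ ⟨q, hq, rfl⟩ s t hs ht hst
  refine ⟨s • p + t • q, convex_stdSimplex ℝ A hp hq hs ht hst, ?_⟩
  obtain rfl : t = 1 - s := by linarith
  module

theorem segment_subset_feasibleSet {γ : ℝ} {ρ p q : A → ℝ} (hp : p ∈ mixedSimplex γ ρ)
    (hq : q ∈ mixedSimplex γ ρ) (hp₁ : ∑ a, p a = 1) (hq₁ : ∑ a, q a = 1) :
    segment ℝ (liftedCov p) (liftedCov q) ⊆ feasibleSet γ ρ := by
  rintro _ ⟨s, t, hs, ht, hst, rfl⟩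
  exact ⟨s • p + t • q, convex_mixedSimplex γ ρ hp hq hs ht hst, liftedCov_convexCombo hp₁ hq₁ hst⟩

end Moments

/-! ### Spread distributions -/

section Spread

variable {d : ℕ} {A : Finset (Fin d → ℝ)}

/-- A distribution whose lifted covariance is nondegenerate and dominates every lifted action up
to the factor `β`, that is `(a, 1) (a, 1)ᵀ ⪯ β H` for every action `a`. This is all that is
needed of the forced exploration. -/
structure IsSpread (β : ℝ) (p : A → ℝ) : Prop where
  mem : p ∈ stdSimplex ℝ A
  posDef : (liftedCov p).PosDef
  sq_le : ∀ (a : A) (z : Fin d ⊕ Unit → ℝ),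
    (z ⬝ᵥ liftVec a.1) ^ 2 ≤ β * (z ⬝ᵥ (liftedCov p *ᵥ z))

namespace IsSpread

variable {β : ℝ} {p : A → ℝ}

theorem sq_dotProduct_le_quad (hp : IsSpread β p) (a : A) (y : Fin d → ℝ) :
    (y ⬝ᵥ a.1) ^ 2 ≤ β * (y ⬝ᵥ (secondMoment p *ᵥ y)) := by
  have := hp.sq_le a (Sum.elim y fun _ => 0)
  rwa [sum_elim_dotProduct_liftVec, add_zero, quad_liftedCov_sum_elim_zero hp.mem.2] at this

theorem secondMoment_posDef (hp : IsSpread β p) : (secondMoment p).PosDef := by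
  refine posDef_of_quad_pos (isSymm_secondMoment p) fun y hy => ?_
  rw [← quad_liftedCov_sum_elim_zero hp.mem.2]
  refine quad_pos hp.posDef fun h => hy ?_
  ext i
  exact congrFun h (Sum.inl i)

theorem one_le (hp : IsSpread β p) (a : A) : 1 ≤ β := by
  have := hp.sq_le a (Sum.elim 0 fun _ => 1)
  rwa [sum_elim_dotProduct_liftVec, quad_liftedCov_sum_elim_one hp.mem.2, zero_dotProduct, zero_add,
    one_pow, mul_one] at this

theorem liftedCov_le (hp : IsSpread β p) {q : A → ℝ} (hq : q ∈ stdSimplex ℝ A) :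
    liftedCov q ≤ β • liftedCov p := by
  refine le_of_quad_le_quad (isSymm_liftedCov hq.2) ((isSymm_liftedCov hp.mem.2).smul β)
    fun z => ?_
  rw [Matrix.smul_mulVec, dotProduct_smul, smul_eq_mul, quad_liftedCov hq.2]
  calc ∑ a : A, q a * (z ⬝ᵥ liftVec a.1) ^ 2
      ≤ ∑ a : A, q a * (β * (z ⬝ᵥ (liftedCov p *ᵥ z))) :=
        Finset.sum_le_sum fun a _ => mul_le_mul_of_nonneg_left (hp.sq_le a z) (hq.1 a)
    _ = β * (z ⬝ᵥ (liftedCov p *ᵥ z)) := by rw [← Finset.sum_mul, hq.2, one_mul]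

theorem secondMoment_le (hp : IsSpread β p) {q : A → ℝ} (hq : q ∈ stdSimplex ℝ A) :
    secondMoment q ≤ β • secondMoment p := by
  refine le_of_quad_le_quad (isSymm_secondMoment q) ((isSymm_secondMoment p).smul β) fun y => ?_
  have := quad_le_quad (hp.liftedCov_le hq) (Sum.elim y fun _ => 0)
  rwa [Matrix.smul_mulVec, dotProduct_smul, quad_liftedCov_sum_elim_zero hq.2,
    quad_liftedCov_sum_elim_zero hp.mem.2, ← dotProduct_smul, ← Matrix.smul_mulVec] at this

theorem quad_inv_action_le (hp : IsSpread β p) (a : A) :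
    a.1 ⬝ᵥ ((secondMoment p)⁻¹ *ᵥ a.1) ≤ β := by
  have sq_le := hp.sq_dotProduct_le_quad a ((secondMoment p)⁻¹ *ᵥ a.1)
  rw [mulVec_inv_mulVec hp.secondMoment_posDef, dotProduct_comm] at sq_le
  rcases (quad_nonneg hp.secondMoment_posDef.inv.posSemidef a.1).eq_or_lt with quad_eq | quad_pos
  · rw [← quad_eq]
    exact zero_le_one.trans (hp.one_le a)
  · exact le_of_mul_le_mul_right (by rwa [← sq]) quad_pos

theorem sum_quad_inv_action (hp : IsSpread β p) :
    ∑ a : A, p a * (a.1 ⬝ᵥ ((secondMoment p)⁻¹ *ᵥ a.1)) = d := by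
  have trace_eq : ((secondMoment p)⁻¹ * secondMoment p).trace = d := by
    rw [inv_mul_of_posDef hp.secondMoment_posDef, Matrix.trace_one, Fintype.card_fin]
  rw [← trace_eq]
  nth_rw 3 [secondMoment]
  simp only [Matrix.mul_sum, Matrix.trace_sum, Matrix.mul_smul, Matrix.trace_smul, smul_eq_mul,
    Matrix.mul_vecMulVec, Matrix.trace_vecMulVec]
  exact Finset.sum_congr rfl fun a _ => by rw [dotProduct_comm]

theorem sum_mul_dotProduct_inv (hp : IsSpread β p) (v w : Fin d → ℝ) :
    ∑ a : A, p a * ((v ⬝ᵥ ((secondMoment p)⁻¹ *ᵥ a.1)) * (a.1 ⬝ᵥ w)) = v ⬝ᵥ w := by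
  have bilin := dotProduct_secondMoment_mulVec p ((secondMoment p)⁻¹ *ᵥ v) w
  rw [dotProduct_mulVec_comm (isSymm_secondMoment p), mulVec_inv_mulVec hp.secondMoment_posDef,
    dotProduct_comm] at bilin
  rw [bilin]
  refine Finset.sum_congr rfl fun a _ => ?_
  rw [dotProduct_comm a.1 w,
    dotProduct_mulVec_comm (isSymm_of_posSemidef hp.secondMoment_posDef.inv.posSemidef),
    dotProduct_comm a.1]

theorem sum_mul_sq_dotProduct_inv (hp : IsSpread β p) (v : Fin d → ℝ) :
    ∑ a : A, p a * (v ⬝ᵥ ((secondMoment p)⁻¹ *ᵥ a.1)) ^ 2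
      = v ⬝ᵥ ((secondMoment p)⁻¹ *ᵥ v) := by
  rw [← hp.sum_mul_dotProduct_inv v]
  refine Finset.sum_congr rfl fun a _ => ?_
  rw [dotProduct_mulVec_comm (isSymm_of_posSemidef hp.secondMoment_posDef.inv.posSemidef) a.1 v, sq]

theorem quad_inv_mean_le (hp : IsSpread β p) :
    mean p ⬝ᵥ ((secondMoment p)⁻¹ *ᵥ mean p) ≤ 1 := by
  set v := (secondMoment p)⁻¹ *ᵥ mean p with hv
  have quad_eq : v ⬝ᵥ (secondMoment p *ᵥ v) = mean p ⬝ᵥ v := by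
    rw [hv, mulVec_inv_mulVec hp.secondMoment_posDef, dotProduct_comm]
  have jensen : (mean p ⬝ᵥ v) ^ 2 ≤ v ⬝ᵥ (secondMoment p *ᵥ v) := by
    rw [mean_dotProduct, quad_secondMoment]
    simp only [dotProduct_comm v]
    have := (even_two.convexOn_pow : ConvexOn ℝ Set.univ fun x : ℝ => x ^ 2).map_sum_le
      (t := Finset.univ) (w := p) (p := fun a : A => a.1 ⬝ᵥ v) (fun a _ => hp.mem.1 a) hp.mem.2
      (fun a _ => Set.mem_univ _)
    simpa only [smul_eq_mul] using this
  nlinarith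

theorem mono (hp : IsSpread β p) {β' : ℝ} (hβ : β ≤ β') : IsSpread β' p :=
  ⟨hp.mem, hp.posDef, fun a z => (hp.sq_le a z).trans
    (mul_le_mul_of_nonneg_right hβ (quad_nonneg hp.posDef.posSemidef z))⟩

theorem of_mem_mixedSimplex {γ : ℝ} {ρ : A → ℝ} (hρ : IsSpread β ρ) (hγ₀ : 0 < γ) (hγ₁ : γ ≤ 1)
    (hβ : 0 ≤ β) (hp : p ∈ mixedSimplex γ ρ) : IsSpread (β / γ) p := by
  have mem := mixedSimplex_subset hγ₀.le hγ₁ hρ.mem hp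
  have smul_quad_le : ∀ z : Fin d ⊕ Unit → ℝ,
      γ * (z ⬝ᵥ (liftedCov ρ *ᵥ z)) ≤ z ⬝ᵥ (liftedCov p *ᵥ z) := by
    obtain ⟨p', hp', rfl⟩ := hp
    intro z
    rw [liftedCov_convexCombo hp'.2 hρ.mem.2 (by ring), Matrix.add_mulVec, dotProduct_add,
      Matrix.smul_mulVec, dotProduct_smul, smul_eq_mul, Matrix.smul_mulVec, dotProduct_smul,
      smul_eq_mul, le_add_iff_nonneg_left, quad_liftedCov hp'.2]
    exact mul_nonneg (by linarith) <|
      Finset.sum_nonneg fun a _ => mul_nonneg (hp'.1 a) (sq_nonneg _)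
  refine ⟨mem, posDef_of_quad_pos (isSymm_liftedCov mem.2) fun z hz => ?_, fun a z => ?_⟩
  · exact (mul_pos hγ₀ (quad_pos hρ.posDef hz)).trans_le (smul_quad_le z)
  · refine (hρ.sq_le a z).trans ?_
    rw [div_mul_eq_mul_div, le_div_iff₀ hγ₀]
    calc β * (z ⬝ᵥ (liftedCov ρ *ᵥ z)) * γ = β * (γ * (z ⬝ᵥ (liftedCov ρ *ᵥ z))) := by ring
      _ ≤ β * (z ⬝ᵥ (liftedCov p *ᵥ z)) := mul_le_mul_of_nonneg_left (smul_quad_le z) hβ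

end IsSpread

/-! ### John's exploration is spread -/

theorem quad_liftedCov_of_moments {ρ : A → ℝ} (hρ : ∑ a, ρ a = 1) {c : Fin d → ℝ}
    {N : Matrix (Fin d) (Fin d) ℝ} (first : ∑ a : A, ρ a • (a.1 - c) = 0)
    (second : ∑ a : A, ρ a • Matrix.vecMulVec (a.1 - c) (a.1 - c) = N) (y : Fin d → ℝ) (s : ℝ) :
    (Sum.elim y fun _ => s) ⬝ᵥ (liftedCov ρ *ᵥ Sum.elim y fun _ => s)
      = y ⬝ᵥ (N *ᵥ y) + (y ⬝ᵥ c + s) ^ 2 := by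
  have first_dot : ∑ a : A, ρ a * (y ⬝ᵥ (a.1 - c)) = 0 := by
    have := congrArg (fun v => y ⬝ᵥ v) first
    simpa only [dotProduct_sum, dotProduct_smul, smul_eq_mul, dotProduct_zero] using this
  have second_quad : ∑ a : A, ρ a * (y ⬝ᵥ (a.1 - c)) ^ 2 = y ⬝ᵥ (N *ᵥ y) := by
    simp only [← second, dotProduct_sum_smul_vecMulVec_mulVec, sq]
  have expand : ∀ a : A, ρ a * (y ⬝ᵥ a.1 + s) ^ 2 = ρ a * (y ⬝ᵥ (a.1 - c)) ^ 2
      + 2 * (y ⬝ᵥ c + s) * (ρ a * (y ⬝ᵥ (a.1 - c))) + ρ a * (y ⬝ᵥ c + s) ^ 2 := by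
    intro a
    rw [dotProduct_sub]
    ring
  simp only [quad_liftedCov hρ, sum_elim_dotProduct_liftVec, expand, Finset.sum_add_distrib,
    ← Finset.mul_sum, ← Finset.sum_mul, first_dot, second_quad, hρ]
  ring

theorem sq_add_le_mul_add_sq {x : ℝ} (hx : 0 < x) (u w : ℝ) :
    (u + w) ^ 2 ≤ (x + 1) * (u ^ 2 / x + w ^ 2) := by
  have : (x + 1) * (u ^ 2 / x + w ^ 2) - (u + w) ^ 2 = (u - x * w) ^ 2 / x := by
    field_simp
    ring
  rw [← sub_nonneg, this]
  positivity

theorem IsJohnExploration.isSpread {ρ : A → ℝ} (hd : 1 ≤ d) (h : IsJohnExploration A ρ) :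
    IsSpread (d + 1) ρ := by
  obtain ⟨hρ, c, M, hM, -, first, second⟩ := h
  have hd₀ : (0 : ℝ) < d := by exact_mod_cast hd
  have quad_eq : ∀ y s, (Sum.elim y fun _ => s) ⬝ᵥ (liftedCov ρ *ᵥ Sum.elim y fun _ => s)
      = y ⬝ᵥ (M *ᵥ y) / d + (y ⬝ᵥ c + s) ^ 2 := by
    intro y s
    rw [quad_liftedCov_of_moments hρ.2 first second, Matrix.smul_mulVec, dotProduct_smul,
      smul_eq_mul, one_div, inv_mul_eq_div]
  refine ⟨hρ, posDef_of_quad_pos (isSymm_liftedCov hρ.2) fun z hz => ?_, fun a z => ?_⟩ <;>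
    obtain ⟨y, s, rfl⟩ := exists_eq_sum_elim z <;> rw [quad_eq]
  · rcases eq_or_ne y 0 with rfl | hy
    · have hs : s ≠ 0 := by
        rintro rfl
        exact hz (by ext (i | i) <;> rfl)
      rw [Matrix.mulVec_zero, zero_dotProduct, zero_div, zero_dotProduct, zero_add, zero_add]
      positivity
    · have := quad_pos hM.posDef hy
      positivity
  · have sq_le : (y ⬝ᵥ (a.1 - c)) ^ 2 ≤ y ⬝ᵥ (M *ᵥ y) := by
      rw [dotProduct_comm]
      exact (sq_dotProduct_le hM.posDef _ _).trans
        (mul_le_of_le_one_left (quad_nonneg hM.posDef.posSemidef y) (hM.encloses a.2))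
    rw [sum_elim_dotProduct_liftVec]
    calc (y ⬝ᵥ a.1 + s) ^ 2 = (y ⬝ᵥ (a.1 - c) + (y ⬝ᵥ c + s)) ^ 2 := by
          rw [dotProduct_sub]
          ring
      _ ≤ (d + 1) * ((y ⬝ᵥ (a.1 - c)) ^ 2 / d + (y ⬝ᵥ c + s) ^ 2) := sq_add_le_mul_add_sq hd₀ _ _
      _ ≤ (d + 1) * (y ⬝ᵥ (M *ᵥ y) / d + (y ⬝ᵥ c + s) ^ 2) := by gcongr

end Spread

/-! ### The bonus recursion -/

section CfcMax

variable {n : Type*} [Fintype n] [DecidableEq n] {K : Matrix n n ℝ}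

theorem le_cfc_max_one (hK : K.IsHermitian) : K ≤ cfc (fun x : ℝ => max x 1) K := by
  have hsa : IsSelfAdjoint K := hK
  calc K = cfc (fun x : ℝ => x) K := (cfc_id' ℝ K).symm
    _ ≤ cfc (fun x : ℝ => max x 1) K := cfc_mono (fun x _ => le_max_left x 1)
      (continuousOn_spectrum K _) (continuousOn_spectrum K _)

theorem one_le_cfc_max_one (hK : K.IsHermitian) : 1 ≤ cfc (fun x : ℝ => max x 1) K := by
  have hsa : IsSelfAdjoint K := hK
  calc (1 : Matrix n n ℝ) = cfc (fun _ : ℝ => 1) K := (cfc_const_one ℝ K).symm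
    _ ≤ cfc (fun x : ℝ => max x 1) K := cfc_mono (fun x _ => le_max_right x 1)
      (continuousOn_spectrum K _) (continuousOn_spectrum K _)

theorem cfc_max_one_le_one_add (hK : K.PosSemidef) :
    cfc (fun x : ℝ => max x 1) K ≤ 1 + K := by
  have hsa : IsSelfAdjoint K := hK.isHermitian
  calc cfc (fun x : ℝ => max x 1) K ≤ cfc (fun x : ℝ => 1 + x) K :=
      cfc_mono (fun x hx => max_le (by linarith)
        (by linarith [spectrum_nonneg_of_nonneg hK.nonneg hx]))
        (continuousOn_spectrum K _) (continuousOn_spectrum K _)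
    _ = 1 + K := by
      rw [cfc_add (R := ℝ) (a := K) (fun _ => 1) (fun x => x), cfc_const_one ℝ K, cfc_id' ℝ K]

theorem inv_mul_cfc_max_one_sub_one (hK : K.PosDef) :
    K⁻¹ * (cfc (fun x : ℝ => max x 1) K - 1) = 1 - (cfc (fun x : ℝ => max x 1) K)⁻¹ := by
  have hsa : IsSelfAdjoint K := hK.isHermitian
  have posDef := posDef_of_posDef_of_le Matrix.PosDef.one (one_le_cfc_max_one hK.isHermitian)
  set m := cfc (fun x : ℝ => max x 1) K with hm
  have mul_eq : (m - 1) * m = K * (m - 1) := by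
    have sub_one_eq : m - 1 = cfc (fun x : ℝ => max x 1 - 1) K := by
      rw [cfc_sub _ _ K (continuousOn_spectrum K _) (continuousOn_spectrum K _), cfc_const_one ℝ K]
    rw [sub_one_eq, hm, ← cfc_mul _ _ K (continuousOn_spectrum K _) (continuousOn_spectrum K _)]
    nth_rw 2 [← cfc_id' ℝ K]
    rw [← cfc_mul _ _ K (continuousOn_spectrum K _) (continuousOn_spectrum K _)]
    refine cfc_congr fun x _ => ?_
    rcases max_cases x 1 with h | h <;> simp [h.1, mul_comm]
  calc K⁻¹ * (m - 1) = K⁻¹ * ((m - 1) * m) * m⁻¹ := by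
        rw [mul_assoc, mul_assoc (m - 1), mul_inv_of_posDef posDef, mul_one]
    _ = (m - 1) * m⁻¹ := by rw [mul_eq, ← mul_assoc, inv_mul_of_posDef hK, one_mul]
    _ = 1 - m⁻¹ := by rw [sub_mul, mul_inv_of_posDef posDef, one_mul]

end CfcMax

/-- The properties of a step `B ↦ B' = Bonus(B, S)` of the bonus recursion that the analysis uses:
`B'` dominates `B` and `S⁻¹`, does not exceed their sum, and grows only in the directions in which
it coincides with `S⁻¹` (`eq_inv`, a complementary slackness condition). -/
structure IsBonusStep {n : Type*} [Fintype n] [DecidableEq n] (B S B' : Matrix n n ℝ) : Prop where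
  posDef : B'.PosDef
  le : B ≤ B'
  inv_le : S⁻¹ ≤ B'
  sub_le : B' - B ≤ S⁻¹
  eq_inv : S * (B' - B) = 1 - B'⁻¹ * B

theorem IsBonusStep.inv_of_le {n : Type*} [Fintype n] [DecidableEq n] {B S : Matrix n n ℝ}
    (hB : B.PosSemidef) (hS : S.PosDef) (h : B ≤ S⁻¹) : IsBonusStep B S S⁻¹ where
  posDef := hS.inv
  le := h
  inv_le := le_rfl
  sub_le := sub_le_self _ hB.nonneg
  eq_inv := by
    rw [mul_sub, mul_inv_of_posDef hS, Matrix.nonsing_inv_nonsing_inv _ hS.det_pos.ne'.isUnit]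

theorem IsBonusStep.conj_cfc_max_one {n : Type*} [Fintype n] [DecidableEq n]
    {Q S : Matrix n n ℝ} (hQ : Q.PosDef) (hS : S.PosDef) :
    IsBonusStep (Q * Q) S (Q * cfc (fun x : ℝ => max x 1) (Q⁻¹ * S⁻¹ * Q⁻¹) * Q) := by
  set K := Q⁻¹ * S⁻¹ * Q⁻¹ with hK
  have hKp : K.PosDef := posDef_conj hS.inv hQ.inv
  have one_le := one_le_cfc_max_one hKp.isHermitian
  have le := le_cfc_max_one hKp.isHermitian
  have le_one_add := cfc_max_one_le_one_add hKp.posSemidef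
  have inv_mul := inv_mul_cfc_max_one_sub_one hKp
  set m := cfc (fun x : ℝ => max x 1) K
  have conj_mono : ∀ {X Y : Matrix n n ℝ}, X ≤ Y → Q * X * Q ≤ Q * Y * Q :=
    fun h => IsSelfAdjoint.conjugate_le_conjugate h hQ.isHermitian
  have conj_K : Q * K * Q = S⁻¹ := by
    rw [hK, show Q * (Q⁻¹ * S⁻¹ * Q⁻¹) * Q = Q * Q⁻¹ * S⁻¹ * (Q⁻¹ * Q) by noncomm_ring,
      mul_inv_of_posDef hQ, inv_mul_of_posDef hQ, one_mul, mul_one]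
  have conj_one : Q * 1 * Q = Q * Q := by rw [mul_one]
  have inv_K : S = Q⁻¹ * K⁻¹ * Q⁻¹ := by
    rw [← Matrix.nonsing_inv_nonsing_inv S hS.det_pos.ne'.isUnit, ← conj_K, Matrix.mul_inv_rev,
      Matrix.mul_inv_rev, mul_assoc]
  refine ⟨posDef_conj (posDef_of_posDef_of_le .one one_le) hQ, ?_, ?_, ?_, ?_⟩
  · exact conj_one ▸ conj_mono one_le
  · exact conj_K ▸ conj_mono le
  · rw [sub_le_iff_le_add', ← conj_K, ← conj_one, ← add_mul, ← mul_add]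
    exact conj_mono le_one_add
  · calc S * (Q * m * Q - Q * Q) = Q⁻¹ * K⁻¹ * (Q⁻¹ * Q) * (m - 1) * Q := by
          rw [inv_K]
          noncomm_ring
      _ = Q⁻¹ * (K⁻¹ * (m - 1)) * Q := by rw [inv_mul_of_posDef hQ, mul_one, mul_assoc Q⁻¹]
      _ = Q⁻¹ * Q - Q⁻¹ * m⁻¹ * Q := by
          rw [inv_mul]
          noncomm_ring
      _ = 1 - (Q * m * Q)⁻¹ * (Q * Q) := by
          rw [Matrix.mul_inv_rev, Matrix.mul_inv_rev,
            show Q⁻¹ * (m⁻¹ * Q⁻¹) * (Q * Q) = Q⁻¹ * m⁻¹ * (Q⁻¹ * Q) * Q by noncomm_ring,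
            inv_mul_of_posDef hQ, mul_one]

theorem IsBonusStep.trace_le {n : Type*} [Fintype n] [DecidableEq n] {B S B' : Matrix n n ℝ}
    (h : IsBonusStep B S B') (hB : B.PosDef) :
    (S * (B' - B)).trace ≤ Real.log B'.det - Real.log B.det := by
  have fenchel_young := log_det_add_log_det_le h.posDef.inv hB
  rw [log_det_inv] at fenchel_young
  rw [h.eq_inv, Matrix.trace_sub, Matrix.trace_one]
  linarith

section Bonus

variable {d : ℕ} {S : Matrix (Fin d) (Fin d) ℝ}

theorem bonus_zero (hS : S.PosDef) : bonus 0 S = S⁻¹ := by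
  rw [bonus, if_pos (by rw [sub_zero]; exact hS.inv.posSemidef)]

theorem isBonusStep_bonus_zero (hS : S.PosDef) : IsBonusStep 0 S (bonus 0 S) := by
  rw [bonus_zero hS]
  exact .inv_of_le .zero hS hS.inv.posSemidef.nonneg

theorem isBonusStep_bonus {B : Matrix (Fin d) (Fin d) ℝ} (hB : B.PosDef) (hS : S.PosDef) :
    IsBonusStep B S (bonus B S) := by
  rw [bonus]
  split_ifs with h
  · exact .inv_of_le hB.posSemidef hS (Matrix.le_iff.2 h)
  · have := IsBonusStep.conj_cfc_max_one (posDef_cfc_sqrt hB) hS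
    rwa [cfc_sqrt_mul_self hB.posSemidef] at this

end Bonus

section BonusSeq

variable {d : ℕ} {A : Finset (Fin d → ℝ)} {β : ℝ} {p : ℕ → A → ℝ} {T : ℕ}

theorem isBonusStep_bonusSeq (hp : ∀ t ∈ Finset.Icc 1 T, IsSpread β (p t)) {t : ℕ}
    (ht : t + 1 ≤ T) :
    IsBonusStep (bonusSeq p t) (secondMoment (p (t + 1))) (bonusSeq p (t + 1)) := by
  induction t with
  | zero => exact isBonusStep_bonus_zero (hp 1 (Finset.mem_Icc.2 ⟨le_rfl, ht⟩)).secondMoment_posDef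
  | succ t ih =>
    exact isBonusStep_bonus (ih (by omega)).posDef
      (hp _ (Finset.mem_Icc.2 ⟨by omega, ht⟩)).secondMoment_posDef

theorem bonusSeq_mono (hp : ∀ t ∈ Finset.Icc 1 T, IsSpread β (p t)) :
    MonotoneOn (bonusSeq p) (Set.Iic T) := by
  intro s _ t ht hst
  induction t, hst using Nat.le_induction with
  | base => exact le_rfl
  | succ t _ ih => exact (ih (Nat.le_of_succ_le ht)).trans (isBonusStep_bonusSeq hp ht).le

theorem bonusSeq_posSemidef (hp : ∀ t ∈ Finset.Icc 1 T, IsSpread β (p t)) :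
    (bonusSeq p T).PosSemidef :=
  Matrix.nonneg_iff_posSemidef.1
    (bonusSeq_mono hp (Set.mem_Iic.2 T.zero_le) Set.self_mem_Iic T.zero_le)

theorem bonusSeq_sub_posSemidef (hp : ∀ t ∈ Finset.Icc 1 T, IsSpread β (p t)) {t : ℕ}
    (ht : t ∈ Finset.Icc 1 T) : (bonusSeq p t - bonusSeq p (t - 1)).PosSemidef := by
  obtain ⟨t, rfl⟩ := Nat.exists_eq_add_of_le' (Finset.mem_Icc.1 ht).1
  exact Matrix.le_iff.1 (isBonusStep_bonusSeq hp (Finset.mem_Icc.1 ht).2).le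

theorem bonusSeq_sub_le (hp : ∀ t ∈ Finset.Icc 1 T, IsSpread β (p t)) {t : ℕ}
    (ht : t ∈ Finset.Icc 1 T) : bonusSeq p t - bonusSeq p (t - 1) ≤ (secondMoment (p t))⁻¹ := by
  obtain ⟨t, rfl⟩ := Nat.exists_eq_add_of_le' (Finset.mem_Icc.1 ht).1
  exact (isBonusStep_bonusSeq hp (Finset.mem_Icc.1 ht).2).sub_le

theorem inv_secondMoment_le_bonusSeq (hp : ∀ t ∈ Finset.Icc 1 T, IsSpread β (p t)) {t : ℕ}
    (ht : t ∈ Finset.Icc 1 T) : (secondMoment (p t))⁻¹ ≤ bonusSeq p T := by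
  obtain ⟨t, rfl⟩ := Nat.exists_eq_add_of_le' (Finset.mem_Icc.1 ht).1
  have ht' := (Finset.mem_Icc.1 ht).2
  exact (isBonusStep_bonusSeq hp ht').inv_le.trans (bonusSeq_mono hp ht' Set.self_mem_Iic ht')

theorem bonusSeq_le_smul (hp : ∀ t ∈ Finset.Icc 1 T, IsSpread β (p t)) {t : ℕ} (ht : t ≤ T) :
    bonusSeq p t ≤ (t * β) • bonusSeq p 1 := by
  induction t with
  | zero => simp [bonusSeq]
  | succ t ih =>
    have hpt := hp (t + 1) (Finset.mem_Icc.2 ⟨by omega, ht⟩)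
    have hp₁ := hp 1 (Finset.mem_Icc.2 ⟨le_rfl, by omega⟩)
    have inv_le : (secondMoment (p (t + 1)))⁻¹ ≤ β • bonusSeq p 1 := by
      rw [bonusSeq, bonusSeq, bonus_zero hp₁.secondMoment_posDef]
      exact inv_le_smul_inv hp₁.secondMoment_posDef hpt.secondMoment_posDef
        (hpt.secondMoment_le hp₁.mem)
    calc bonusSeq p (t + 1) ≤ (secondMoment (p (t + 1)))⁻¹ + bonusSeq p t :=
          sub_le_iff_le_add.1 (isBonusStep_bonusSeq hp ht).sub_le
      _ ≤ β • bonusSeq p 1 + (t * β) • bonusSeq p 1 := add_le_add inv_le (ih (by omega))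
      _ = ((t + 1 : ℕ) * β) • bonusSeq p 1 := by
          push_cast
          module

theorem sum_trace_bonus_le_log_det (hp : ∀ t ∈ Finset.Icc 1 T, IsSpread β (p t)) {n : ℕ}
    (hn : 1 ≤ n) (hnT : n ≤ T) :
    ∑ t ∈ Finset.Icc 1 n, (secondMoment (p t) * (bonusSeq p t - bonusSeq p (t - 1))).trace
      ≤ d + Real.log (bonusSeq p n).det - Real.log (bonusSeq p 1).det := by
  induction n, hn using Nat.le_induction with
  | base =>
    have step := isBonusStep_bonusSeq hp hnT
    rw [Finset.Icc_self, Finset.sum_singleton, add_sub_cancel_right]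
    change (secondMoment (p (0 + 1)) * (bonusSeq p (0 + 1) - bonusSeq p 0)).trace ≤ d
    rw [step.eq_inv, bonusSeq, mul_zero, sub_zero, Matrix.trace_one, Fintype.card_fin]
  | succ n hn ih =>
    obtain ⟨k, rfl⟩ := Nat.exists_eq_add_of_le' hn
    have trace_le := (isBonusStep_bonusSeq hp hnT).trace_le
      (isBonusStep_bonusSeq hp (Nat.le_of_succ_le hnT)).posDef
    rw [Finset.sum_Icc_succ_top (by omega), Nat.add_sub_cancel]
    linarith [ih (Nat.le_of_succ_le hnT)]

/-- The potential argument: each increment of `log det B_t` pays for the bonus of its round. -/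
theorem sum_trace_bonus_le (hp : ∀ t ∈ Finset.Icc 1 T, IsSpread β (p t)) (hT : 1 ≤ T)
    (hβ : 0 < β) :
    ∑ t ∈ Finset.Icc 1 T, (secondMoment (p t) * (bonusSeq p t - bonusSeq p (t - 1))).trace
      ≤ d + d * Real.log (T * β) := by
  have posDef : ∀ n, 1 ≤ n → n ≤ T → (bonusSeq p n).PosDef := fun n hn hnT => by
    obtain ⟨k, rfl⟩ := Nat.exists_eq_add_of_le' hn
    exact (isBonusStep_bonusSeq hp hnT).posDef
  have log_det_le := log_det_le_of_le_smul (posDef T hT le_rfl) (posDef 1 le_rfl hT)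
    (mul_pos (by exact_mod_cast hT) hβ) (bonusSeq_le_smul hp le_rfl)
  rw [Fintype.card_fin] at log_det_le
  linarith [sum_trace_bonus_le_log_det hp hT le_rfl]

end BonusSeq

/-! ### Follow the regularized leader -/

section TraceSum

variable {ι n : Type*} [Fintype ι] [Fintype n]

theorem trace_sum_smul_vecMulVec_mul (p : ι → ℝ) (u : ι → n → ℝ) (N : Matrix n n ℝ) :
    ((∑ i, p i • Matrix.vecMulVec (u i) (u i)) * N).trace = ∑ i, p i * (u i ⬝ᵥ (N *ᵥ u i)) := by
  simp only [Matrix.sum_mul, Matrix.trace_sum, Matrix.smul_mul, Matrix.trace_smul, smul_eq_mul,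
    Matrix.vecMulVec_mul, Matrix.trace_vecMulVec]
  refine Finset.sum_congr rfl fun i _ => ?_
  rw [Matrix.dotProduct_mulVec, dotProduct_comm]

theorem trace_sum_smul_vecMulVec_mul_conj (p : ι → ℝ) (u : ι → n → ℝ) {N : Matrix n n ℝ}
    (hN : N.IsSymm) (H : Matrix n n ℝ) :
    ((∑ i, p i • Matrix.vecMulVec (u i) (u i)) * N * (H * N)).trace
      = ∑ i, p i * ((N *ᵥ u i) ⬝ᵥ (H *ᵥ (N *ᵥ u i))) := by
  rw [mul_assoc, ← mul_assoc N, trace_sum_smul_vecMulVec_mul]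
  simp only [dotProduct_conj_mulVec hN]

end TraceSum

section Gain

variable {d : ℕ} {A : Finset (Fin d → ℝ)}

theorem isSymm_gainMatrix {α : ℝ} {B : Matrix (Fin d) (Fin d) ℝ} (hB : B.IsSymm)
    (v : Fin d → ℝ) : (gainMatrix α B v).IsSymm := by
  rw [Matrix.IsSymm, gainMatrix, Matrix.fromBlocks_transpose, Matrix.transpose_smul, hB.eq,
    Matrix.transpose_replicateCol, Matrix.transpose_replicateRow, Matrix.transpose_zero]

theorem gainMatrix_mulVec (α : ℝ) (B : Matrix (Fin d) (Fin d) ℝ) (v y : Fin d → ℝ) (s : ℝ) :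
    gainMatrix α B v *ᵥ (Sum.elim y fun _ => s)
      = Sum.elim (α • B *ᵥ y + (s / 2) • v) fun _ => (v ⬝ᵥ y) / 2 := by
  rw [gainMatrix, Matrix.fromBlocks_mulVec]
  ext (i | i)
  · simp [Matrix.mulVec, dotProduct, Finset.mul_sum, mul_assoc, div_eq_inv_mul, mul_comm s]
  · simp [Matrix.mulVec, dotProduct, Finset.mul_sum, mul_assoc, div_eq_inv_mul]

theorem quad_gainMatrix (α : ℝ) (B : Matrix (Fin d) (Fin d) ℝ) (v y : Fin d → ℝ) (s : ℝ) :
    (Sum.elim y fun _ => s) ⬝ᵥ (gainMatrix α B v *ᵥ Sum.elim y fun _ => s)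
      = α * (y ⬝ᵥ (B *ᵥ y)) + s * (y ⬝ᵥ v) := by
  rw [gainMatrix_mulVec, sum_elim_dotProduct_sum_elim, dotProduct_add, dotProduct_smul,
    dotProduct_smul, dotProduct_comm v, smul_eq_mul, smul_eq_mul]
  ring

theorem trace_liftedCov_mul_gainMatrix {p : A → ℝ} (hp : ∑ a, p a = 1) (α : ℝ)
    (B : Matrix (Fin d) (Fin d) ℝ) (v : Fin d → ℝ) :
    (liftedCov p * gainMatrix α B v).trace = α * (secondMoment p * B).trace + mean p ⬝ᵥ v := by
  rw [liftedCov_eq_sum hp, secondMoment, trace_sum_smul_vecMulVec_mul,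
    trace_sum_smul_vecMulVec_mul, mean_dotProduct, Finset.mul_sum, ← Finset.sum_add_distrib]
  refine Finset.sum_congr rfl fun a _ => ?_
  rw [liftVec, quad_gainMatrix]
  ring

/-- The regularized cumulative gain `η ⟨H, Θ⟩ + log det H` of a distribution `q` with lifted
covariance matrix `H`, where `Θ = gainMatrix α B v`. -/
noncomputable def regularizedGain (η α : ℝ) (B : Matrix (Fin d) (Fin d) ℝ) (v : Fin d → ℝ)
    (q : A → ℝ) : ℝ :=
  η * (α * (secondMoment q * B).trace + mean q ⬝ᵥ v) + Real.log (liftedCov q).det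

theorem regularizedGain_zero (η α : ℝ) (q : A → ℝ) :
    regularizedGain η α 0 0 q = Real.log (liftedCov q).det := by
  rw [regularizedGain, mul_zero, Matrix.trace_zero, dotProduct_zero, mul_zero, add_zero, mul_zero,
    zero_add]

theorem regularizedGain_add (η α : ℝ) (B B' : Matrix (Fin d) (Fin d) ℝ) (v v' : Fin d → ℝ)
    (q : A → ℝ) :
    regularizedGain η α (B + B') (v + v') q = regularizedGain η α B v q
      + η * (α * (secondMoment q * B').trace + mean q ⬝ᵥ v') := by
  rw [regularizedGain, regularizedGain, Matrix.mul_add, Matrix.trace_add, dotProduct_add]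
  ring

theorem ftrlObjective_liftedCov {q : A → ℝ} (hq : ∑ a, q a = 1) (η α : ℝ)
    (B : Matrix (Fin d) (Fin d) ℝ) (v : Fin d → ℝ) :
    ftrlObjective η (gainMatrix α B v) (liftedCov q) = regularizedGain η α B v q := by
  rw [ftrlObjective, logDetBarrier, isSymm_liftedCov hq, trace_liftedCov_mul_gainMatrix hq,
    regularizedGain, sub_neg_eq_add]

theorem IsFTRLChoice.regularizedGain_le {γ η α β β' : ℝ} {ρ : A → ℝ}
    {B : Matrix (Fin d) (Fin d) ℝ} {v : Fin d → ℝ} {p q : A → ℝ}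
    (h : IsFTRLChoice γ η ρ (gainMatrix α B v) p) (hp : IsSpread β p) (hq : IsSpread β' q)
    (hqm : q ∈ mixedSimplex γ ρ) :
    regularizedGain η α B v q ≤ regularizedGain η α B v p
      - logDetDiv (liftedCov q) (liftedCov p) := by
  let gain : Matrix (Fin d ⊕ Unit) (Fin d ⊕ Unit) ℝ →ₗ[ℝ] ℝ :=
    η • (Matrix.traceLinearMap _ ℝ ℝ ∘ₗ LinearMap.mulRight ℝ (gainMatrix α B v) ∘ₗ
      (Matrix.transposeLinearEquiv _ _ ℝ ℝ).toLinearMap)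
  have objective_eq : ∀ H, gain H + Real.log H.det = ftrlObjective η (gainMatrix α B v) H :=
    fun H => (sub_neg_eq_add _ _).symm
  have maximal := le_sub_logDetDiv_of_isMaxOn_segment hp.posDef hq.posDef gain <| by
    simp only [objective_eq]
    exact h.2.on_subset (segment_subset_feasibleSet h.1 hqm hp.mem.2 hq.mem.2)
  rwa [objective_eq, objective_eq, ftrlObjective_liftedCov hp.mem.2,
    ftrlObjective_liftedCov hq.mem.2] at maximal

end Gain

section Stability

variable {d : ℕ} {A : Finset (Fin d → ℝ)} {β : ℝ} {p : A → ℝ}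

theorem IsSpread.gainMatrix_le_smul_inv (hp : IsSpread β p) {v : Fin d → ℝ}
    (hv : v ⬝ᵥ (secondMoment p *ᵥ v) ≤ 1 / 4) :
    gainMatrix 0 0 v ≤ (1 / 2 : ℝ) • (liftedCov p)⁻¹ := by
  have psd := hp.posDef.inv.posSemidef
  refine le_of_quad_le_quad (isSymm_gainMatrix Matrix.isSymm_zero v)
    ((isSymm_of_posSemidef psd).smul _) fun z => ?_
  obtain ⟨y, s, rfl⟩ := exists_eq_sum_elim z
  rw [quad_gainMatrix, Matrix.smul_mulVec, dotProduct_smul, smul_eq_mul, zero_mul, zero_add]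
  have inner_sq_le := sq_dotProduct_le hp.posDef (Sum.elim y fun _ => s) (Sum.elim v fun _ => 0)
  have height_sq_le := sq_dotProduct_le hp.posDef (Sum.elim y fun _ => s) (Sum.elim 0 fun _ => 1)
  have nonneg := quad_nonneg psd (Sum.elim y fun _ => s)
  set Z := (Sum.elim y fun _ => s) ⬝ᵥ ((liftedCov p)⁻¹ *ᵥ Sum.elim y fun _ => s)
  rw [quad_liftedCov_sum_elim_zero hp.mem.2, sum_elim_dotProduct_sum_elim, mul_zero, add_zero]
    at inner_sq_le
  rw [quad_liftedCov_sum_elim_one hp.mem.2, sum_elim_dotProduct_sum_elim, dotProduct_zero, zero_add,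
    mul_one, mul_one] at height_sq_le
  nlinarith [sq_nonneg (2 * (y ⬝ᵥ v) - s), mul_le_mul_of_nonneg_left hv nonneg]

theorem IsSpread.trace_sq_gainMatrix_le (hp : IsSpread β p) (v : Fin d → ℝ) :
    (liftedCov p * gainMatrix 0 0 v * (liftedCov p * gainMatrix 0 0 v)).trace
      ≤ v ⬝ᵥ (secondMoment p *ᵥ v) := by
  have gain_dotProduct : ∀ a b : A, (gainMatrix 0 0 v *ᵥ liftVec a.1) ⬝ᵥ liftVec b.1
      = (v ⬝ᵥ a.1 + v ⬝ᵥ b.1) / 2 := by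
    intro a b
    rw [liftVec, gainMatrix_mulVec, sum_elim_dotProduct_liftVec, zero_smul, zero_add,
      smul_dotProduct, smul_eq_mul]
    ring
  nth_rw 1 [liftedCov_eq_sum hp.mem.2]
  rw [trace_sum_smul_vecMulVec_mul_conj _ _ (isSymm_gainMatrix Matrix.isSymm_zero v)]
  simp only [quad_liftedCov hp.mem.2, gain_dotProduct]
  have average : ∀ (f : A → ℝ) (c : ℝ),
      ∑ a : A, p a * ((f a + c) / 2) = (∑ a : A, p a * f a + c) / 2 := by
    intro f c
    simp only [← mul_div_assoc, mul_add, ← Finset.sum_div, Finset.sum_add_distrib,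
      ← Finset.sum_mul, hp.mem.2, one_mul]
  calc ∑ a : A, p a * ∑ b : A, p b * ((v ⬝ᵥ a.1 + v ⬝ᵥ b.1) / 2) ^ 2
      ≤ ∑ a : A, p a * ∑ b : A, p b * (((v ⬝ᵥ b.1) ^ 2 + (v ⬝ᵥ a.1) ^ 2) / 2) := by
        gcongr with a _ b _
        · exact hp.mem.1 a
        · exact hp.mem.1 b
        · nlinarith [sq_nonneg (v ⬝ᵥ a.1 - v ⬝ᵥ b.1)]
    _ = v ⬝ᵥ (secondMoment p *ᵥ v) := by
        rw [quad_secondMoment]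
        simp only [average]
        simp only [add_comm _ ((v ⬝ᵥ _) ^ 2), average]
        ring

theorem IsSpread.mean_sub_mean_dotProduct_le (hp : IsSpread β p) {β' : ℝ} {q : A → ℝ}
    (hq : IsSpread β' q) {v : Fin d → ℝ} (hv : v ⬝ᵥ (secondMoment p *ᵥ v) ≤ 1 / 4) :
    (mean q - mean p) ⬝ᵥ v
      ≤ logDetDiv (liftedCov q) (liftedCov p) + v ⬝ᵥ (secondMoment p *ᵥ v) := by
  have stability := trace_sub_trace_le_logDetDiv hp.posDef hq.posDef
    (isSymm_gainMatrix Matrix.isSymm_zero v) (hp.gainMatrix_le_smul_inv hv)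
  rw [trace_liftedCov_mul_gainMatrix hp.mem.2, trace_liftedCov_mul_gainMatrix hq.mem.2] at stability
  rw [sub_dotProduct]
  linarith [hp.trace_sq_gainMatrix_le v]

theorem IsSpread.quad_inv_secondMoment_le (hp : IsSpread β p) (y : Fin d → ℝ) (s : ℝ) :
    y ⬝ᵥ ((secondMoment p)⁻¹ *ᵥ y)
      ≤ (Sum.elim y fun _ => s) ⬝ᵥ ((liftedCov p)⁻¹ *ᵥ Sum.elim y fun _ => s) := by
  set v := (secondMoment p)⁻¹ *ᵥ y with hv
  have cauchy_schwarz := sq_dotProduct_le hp.posDef (Sum.elim y fun _ => s) (Sum.elim v fun _ => 0)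
  rw [quad_liftedCov_sum_elim_zero hp.mem.2, sum_elim_dotProduct_sum_elim, mul_zero, add_zero, hv,
    mulVec_inv_mulVec hp.secondMoment_posDef, dotProduct_comm _ y, ← hv] at cauchy_schwarz
  rcases (quad_nonneg hp.secondMoment_posDef.inv.posSemidef y).eq_or_lt with h | h
  · exact h.symm.trans_le (quad_nonneg hp.posDef.inv.posSemidef _)
  · exact le_of_mul_le_mul_right (by rwa [sq] at cauchy_schwarz) h

theorem quad_mulVec_le_mul {n : Type*} [Fintype n] [DecidableEq n] {S D : Matrix n n ℝ}
    (hS : S.PosDef) (hD : D.PosSemidef) {c : ℝ} (h : D ≤ c • S⁻¹) (x : n → ℝ) :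
    (D *ᵥ x) ⬝ᵥ (S *ᵥ (D *ᵥ x)) ≤ c * (x ⬝ᵥ (D *ᵥ x)) := by
  rcases eq_or_ne (D *ᵥ x) 0 with hDx | hDx
  · rw [hDx, zero_dotProduct, dotProduct_zero, mul_zero]
  set v := D *ᵥ x with hv
  have cauchy_schwarz := sq_dotProduct_mulVec_le hD (S *ᵥ v) x
  have quad_le := quad_le_quad h (S *ᵥ v)
  rw [Matrix.smul_mulVec, dotProduct_smul, smul_eq_mul, Matrix.mulVec_mulVec _ S⁻¹,
    inv_mul_of_posDef hS, Matrix.one_mulVec, dotProduct_comm _ v] at quad_le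
  rw [← hv, dotProduct_comm _ v] at cauchy_schwarz
  refine le_of_mul_le_mul_left ?_ (quad_pos hS hDx)
  linarith [mul_le_mul_of_nonneg_right quad_le (quad_nonneg hD x)]

theorem IsSpread.gainMatrix_one_le_smul_inv (hp : IsSpread β p) {D : Matrix (Fin d) (Fin d) ℝ}
    (hD : D.IsSymm) {c : ℝ} (hc : c ≤ 1 / 2) (h : D ≤ c • (secondMoment p)⁻¹) :
    gainMatrix 1 D 0 ≤ (1 / 2 : ℝ) • (liftedCov p)⁻¹ := by
  refine le_of_quad_le_quad (isSymm_gainMatrix hD 0)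
    ((isSymm_of_posSemidef hp.posDef.inv.posSemidef).smul _) fun z => ?_
  obtain ⟨y, s, rfl⟩ := exists_eq_sum_elim z
  have quad_le := quad_le_quad h y
  have nonneg := quad_nonneg hp.secondMoment_posDef.inv.posSemidef y
  rw [Matrix.smul_mulVec, dotProduct_smul, smul_eq_mul] at quad_le
  rw [quad_gainMatrix, Matrix.smul_mulVec, dotProduct_smul, smul_eq_mul, dotProduct_zero, mul_zero,
    add_zero, one_mul]
  nlinarith [hp.quad_inv_secondMoment_le y s]

theorem IsSpread.trace_sub_trace_le (hp : IsSpread β p) {β' : ℝ} {q : A → ℝ} (hq : IsSpread β' q)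
    {D : Matrix (Fin d) (Fin d) ℝ} (hD : D.PosSemidef) {c : ℝ} (hc : c ≤ 1 / 2)
    (h : D ≤ c • (secondMoment p)⁻¹) :
    (secondMoment q * D).trace - (secondMoment p * D).trace
      ≤ logDetDiv (liftedCov q) (liftedCov p) + c * (secondMoment p * D).trace := by
  have symm := isSymm_of_posSemidef hD
  have stability := trace_sub_trace_le_logDetDiv hp.posDef hq.posDef (isSymm_gainMatrix symm 0)
    (hp.gainMatrix_one_le_smul_inv symm hc h)
  rw [trace_liftedCov_mul_gainMatrix hp.mem.2, trace_liftedCov_mul_gainMatrix hq.mem.2] at stability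
  have remainder : (liftedCov p * gainMatrix 1 D 0 * (liftedCov p * gainMatrix 1 D 0)).trace
      ≤ c * (secondMoment p * D).trace := by
    nth_rw 1 [liftedCov_eq_sum hp.mem.2]
    rw [trace_sum_smul_vecMulVec_mul_conj _ _ (isSymm_gainMatrix symm 0), secondMoment,
      trace_sum_smul_vecMulVec_mul, Finset.mul_sum]
    refine Finset.sum_le_sum fun a _ => ?_
    rw [liftVec, gainMatrix_mulVec, zero_dotProduct, zero_div, smul_zero, add_zero, one_smul,
      quad_liftedCov_sum_elim_zero hp.mem.2, mul_left_comm]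
    exact mul_le_mul_of_nonneg_left (quad_mulVec_le_mul hp.secondMoment_posDef hD h _) (hp.mem.1 a)
  simp only [dotProduct_zero, add_zero, one_mul] at stability
  linarith

end Stability

section Steps

variable {d : ℕ} {A : Finset (Fin d → ℝ)} {γ η α β β' : ℝ} {ρ p q : A → ℝ}
  {B : Matrix (Fin d) (Fin d) ℝ} {v w : Fin d → ℝ}

theorem IsFTRLChoice.regularizedGain_add_le (h : IsFTRLChoice γ η ρ (gainMatrix α B v) p)
    (hp : IsSpread β p) (hq : IsSpread β' q) (hqm : q ∈ mixedSimplex γ ρ)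
    (hw : η ^ 2 * (w ⬝ᵥ (secondMoment p *ᵥ w)) ≤ 1 / 4) :
    regularizedGain η α B (v + w) q ≤ regularizedGain η α B v p
      + η * (mean p ⬝ᵥ w + η * (w ⬝ᵥ (secondMoment p *ᵥ w))) := by
  have quad_smul : (η • w) ⬝ᵥ (secondMoment p *ᵥ (η • w))
      = η ^ 2 * (w ⬝ᵥ (secondMoment p *ᵥ w)) := by
    rw [Matrix.mulVec_smul, dotProduct_smul, smul_dotProduct, smul_eq_mul, smul_eq_mul]
    ring
  have stability := hp.mean_sub_mean_dotProduct_le hq (quad_smul.trans_le hw)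
  rw [quad_smul, dotProduct_smul, smul_eq_mul, sub_dotProduct] at stability
  have add_eq := regularizedGain_add η α B 0 v w q
  rw [add_zero, mul_zero, Matrix.trace_zero, mul_zero, zero_add] at add_eq
  linarith [h.regularizedGain_le hp hq hqm]

theorem IsFTRLChoice.regularizedGain_add_add_le (h : IsFTRLChoice γ η ρ (gainMatrix α B v) p)
    (hp : IsSpread β p) (hq : IsSpread β' q) (hqm : q ∈ mixedSimplex γ ρ)
    (hw : 4 * (η ^ 2 * (w ⬝ᵥ (secondMoment p *ᵥ w))) ≤ 1 / 4) (hηα₀ : 0 ≤ η * α)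
    (hηα : η * α ≤ 1 / 4) {D : Matrix (Fin d) (Fin d) ℝ} (hD : D.PosSemidef)
    (hDp : D ≤ (secondMoment p)⁻¹) :
    regularizedGain η α (B + D) (v + w) q ≤ regularizedGain η α B v p
      + η * (2 * α * (secondMoment p * D).trace + mean p ⬝ᵥ w
        + 2 * η * (w ⬝ᵥ (secondMoment p *ᵥ w))) := by
  have quad_smul : ((2 * η) • w) ⬝ᵥ (secondMoment p *ᵥ ((2 * η) • w))
      = 4 * (η ^ 2 * (w ⬝ᵥ (secondMoment p *ᵥ w))) := by
    rw [Matrix.mulVec_smul, dotProduct_smul, smul_dotProduct, smul_eq_mul, smul_eq_mul]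
    ring
  have reward_stability := hp.mean_sub_mean_dotProduct_le hq (quad_smul.trans_le hw)
  rw [quad_smul, dotProduct_smul, smul_eq_mul, sub_dotProduct] at reward_stability
  have bonus_stability := hp.trace_sub_trace_le hq (hD.smul (mul_nonneg zero_le_two hηα₀))
    (c := 2 * (η * α)) (by linarith) (smul_le_smul_of_nonneg_left hDp (by positivity))
  simp only [Matrix.mul_smul, Matrix.trace_smul, smul_eq_mul] at bonus_stability
  have trace_nonneg := trace_mul_nonneg hp.secondMoment_posDef hD
  have sq_trace_le : 2 * (η * α) * (2 * (η * α) * (secondMoment p * D).trace)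
      ≤ η * α * (2 * (secondMoment p * D).trace) := by
    nlinarith [mul_nonneg hηα₀ trace_nonneg]
  rw [regularizedGain_add]
  linarith [h.regularizedGain_le hp hq hqm]

end Steps

section EstimatedRegret

variable {d : ℕ} {A : Finset (Fin d → ℝ)} {γ η α β : ℝ} {ρ : A → ℝ}

theorem IsSpread.quad_estimator_le {p : A → ℝ} (hp : IsSpread β p) (a : A) {r : ℝ}
    (hr : |r| ≤ 1) :
    estimator p a r ⬝ᵥ (secondMoment p *ᵥ estimator p a r)
      ≤ a.1 ⬝ᵥ ((secondMoment p)⁻¹ *ᵥ a.1) := by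
  rw [estimator, Matrix.mulVec_smul, mulVec_inv_mulVec hp.secondMoment_posDef, smul_dotProduct,
    dotProduct_smul, smul_eq_mul, smul_eq_mul, dotProduct_comm, ← mul_assoc, ← sq]
  exact mul_le_of_le_one_left (quad_nonneg hp.secondMoment_posDef.inv.posSemidef _)
    ((sq_le_one_iff_abs_le_one r).2 hr)

theorem IsSpread.log_det_liftedCov_le {p q : A → ℝ} (hp : IsSpread β p) (hβ : 0 < β) {β' : ℝ}
    (hq : IsSpread β' q) :
    Real.log (liftedCov q).det ≤ (d + 1) * Real.log β + Real.log (liftedCov p).det := by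
  simpa using log_det_le_of_le_smul hq.posDef hp.posDef hβ (hp.liftedCov_le hq.mem)

theorem estimated_regret_le_of_step {T : ℕ} {K : Set (A → ℝ)} {L : ℝ} {p : ℕ → A → ℝ}
    {B : ℕ → Matrix (Fin d) (Fin d) ℝ} {w : ℕ → Fin d → ℝ} {c : ℕ → ℝ} (hη : 0 < η) (hB : B 0 = 0)
    (osc : ∀ q ∈ K, ∀ q' ∈ K,
      Real.log (liftedCov q').det ≤ L + Real.log (liftedCov q).det)
    (hp : ∀ t ∈ Finset.Icc 1 T, p t ∈ K)
    (step : ∀ t ∈ Finset.Icc 1 T, ∀ q ∈ K,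
      regularizedGain η α (B t) (∑ s ∈ Finset.Ico 1 t, w s + w t) q
        ≤ regularizedGain η α (B (t - 1)) (∑ s ∈ Finset.Ico 1 t, w s) (p t)
          + η * (c t + mean (p t) ⬝ᵥ w t)) {q : A → ℝ} (hq : q ∈ K) :
    ∑ t ∈ Finset.Icc 1 T, (mean q - mean (p t)) ⬝ᵥ w t + α * (secondMoment q * B T).trace
      ≤ L / η + ∑ t ∈ Finset.Icc 1 T, c t := by
  have gain_le : ∀ n ≤ T, ∀ q' ∈ K,
      regularizedGain η α (B n) (∑ s ∈ Finset.Icc 1 n, w s) q'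
        ≤ L + Real.log (liftedCov q).det
          + ∑ t ∈ Finset.Icc 1 n, η * (c t + mean (p t) ⬝ᵥ w t) := by
    intro n
    induction n with
    | zero =>
      intro _ q' hq'
      simpa [hB, regularizedGain_zero] using osc q hq q' hq'
    | succ n ih =>
      intro hn q' hq'
      have mem : n + 1 ∈ Finset.Icc 1 T := Finset.mem_Icc.2 ⟨by omega, hn⟩
      have step_le := step _ mem q' hq'
      rw [Nat.add_sub_cancel, Finset.Ico_add_one_right_eq_Icc] at step_le
      rw [Finset.sum_Icc_succ_top (by omega), Finset.sum_Icc_succ_top (by omega)]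
      linarith [ih (by omega) _ (hp _ mem)]
  have gain_q_le := gain_le T le_rfl q hq
  rw [regularizedGain, ← Finset.mul_sum, Finset.sum_add_distrib, dotProduct_sum] at gain_q_le
  rw [← sub_le_iff_le_add, le_div_iff₀' hη]
  simp only [sub_dotProduct, Finset.sum_sub_distrib]
  linarith

/-- The log-determinant FTRL bound on the estimated regret against `q`: the range `(d + 1) log β` of
the barrier divided by `η`, plus the growth of the bonus matrices, plus the local norms of the
played actions. The bonus `α tr(Σ(q) B_T)` stays on the left, where it can absorb deviations. -/
def EstimatedRegretBound {d : ℕ} {A : Finset (Fin d → ℝ)} (T : ℕ) (α β η : ℝ) (p : ℕ → A → ℝ)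
    (a : ℕ → A) (r : ℕ → ℝ) (q : A → ℝ) : Prop :=
    ∑ t ∈ Finset.Icc 1 T, (mean q - mean (p t)) ⬝ᵥ estimator (p t) (a t) (r t)
        + α * (secondMoment q * bonusSeq p T).trace
      ≤ (d + 1) * Real.log β / η + ∑ t ∈ Finset.Icc 1 T,
        (2 * α * (secondMoment (p t) * (bonusSeq p t - bonusSeq p (t - 1))).trace
          + 2 * η * ((a t).1 ⬝ᵥ ((secondMoment (p t))⁻¹ *ᵥ (a t).1)))

theorem FollowsFixedPointFTRL.estimatedRegretBound {T : ℕ} {p : ℕ → A → ℝ} {a : ℕ → A} {r : ℕ → ℝ}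
    (h : FollowsFixedPointFTRL T γ α η ρ p a r) (hη : 0 < η) (hα : 0 ≤ α) (hβ : 0 < β)
    (hηβ : η ^ 2 * β ≤ 1 / 4) (hr : ∀ t ∈ Finset.Icc 1 T, |r t| ≤ 1)
    (spread : ∀ q ∈ mixedSimplex γ ρ, IsSpread β q) {q : A → ℝ} (hq : q ∈ mixedSimplex γ ρ) :
    EstimatedRegretBound T α β η p a r q := by
  have hps : ∀ t ∈ Finset.Icc 1 T, IsSpread β (p t) := fun t ht => spread _ (h t ht).1
  refine estimated_regret_le_of_step (K := mixedSimplex γ ρ) hη rfl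
    (fun q hq q' hq' => (spread q hq).log_det_liftedCov_le hβ (spread q' hq'))
    (fun t ht => (h t ht).1) (fun t ht q hq => ?_) hq
  have quad_le := (hps t ht).quad_estimator_le (a t) (hr t ht)
  have quad_le_β := (hps t ht).quad_inv_action_le (a t)
  have nonneg := quad_nonneg (hps t ht).secondMoment_posDef.inv.posSemidef (a t).1
  have step := (h t ht).regularizedGain_add_le (hps t ht) (spread q hq) hq
    (w := estimator (p t) (a t) (r t))
    ((mul_le_mul_of_nonneg_left (quad_le.trans quad_le_β) (sq_nonneg η)).trans hηβ)
  have posSemidef := bonusSeq_sub_posSemidef hps ht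
  have trace_nonneg := trace_mul_nonneg (hps t ht).secondMoment_posDef posSemidef
  have gain_p := regularizedGain_add η α (bonusSeq p (t - 1)) (bonusSeq p t - bonusSeq p (t - 1))
    (∑ s ∈ Finset.Ico 1 t, estimator (p s) (a s) (r s)) 0 (p t)
  rw [add_sub_cancel, add_zero, dotProduct_zero, add_zero] at gain_p
  refine step.trans ?_
  rw [gain_p, add_assoc, ← mul_add]
  refine add_le_add le_rfl (mul_le_mul_of_nonneg_left ?_ hη.le)
  linarith [mul_nonneg hα trace_nonneg, mul_le_mul_of_nonneg_left quad_le hη.le,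
    mul_nonneg hη.le nonneg]

theorem FollowsStandardFTRL.estimatedRegretBound {T : ℕ} {p : ℕ → A → ℝ} {a : ℕ → A} {r : ℕ → ℝ}
    (h : FollowsStandardFTRL T γ α η ρ p a r) (hη : 0 < η) (hα : 0 ≤ α) (hβ : 0 < β)
    (hηβ : 4 * (η ^ 2 * β) ≤ 1 / 4) (hηα : η * α ≤ 1 / 4) (hr : ∀ t ∈ Finset.Icc 1 T, |r t| ≤ 1)
    (spread : ∀ q ∈ mixedSimplex γ ρ, IsSpread β q) {q : A → ℝ} (hq : q ∈ mixedSimplex γ ρ) :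
    EstimatedRegretBound T α β η p a r q := by
  have hps : ∀ t ∈ Finset.Icc 1 T, IsSpread β (p t) := fun t ht => spread _ (h t ht).1
  refine estimated_regret_le_of_step (K := mixedSimplex γ ρ) hη rfl
    (fun q hq q' hq' => (spread q hq).log_det_liftedCov_le hβ (spread q' hq'))
    (fun t ht => (h t ht).1) (fun t ht q hq => ?_) hq
  have quad_le := (hps t ht).quad_estimator_le (a t) (hr t ht)
  have quad_le_β := (hps t ht).quad_inv_action_le (a t)
  have step := (h t ht).regularizedGain_add_add_le (hps t ht) (spread q hq) hq
    (w := estimator (p t) (a t) (r t))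
    (by linarith [mul_le_mul_of_nonneg_left (quad_le.trans quad_le_β) (sq_nonneg η)])
    (mul_nonneg hη.le hα) hηα (bonusSeq_sub_posSemidef hps ht) (bonusSeq_sub_le hps ht)
  rw [add_sub_cancel] at step
  refine step.trans (add_le_add le_rfl (mul_le_mul_of_nonneg_left ?_ hη.le))
  linarith [mul_le_mul_of_nonneg_left quad_le hη.le]

end EstimatedRegret

/-! ### Concentration for bandits with finitely many actions -/

section Concentration

theorem integral_mul_condExp {Ω : Type*} {m m' : MeasurableSpace Ω} (hm : m ≤ m')
    {P : Measure Ω} [IsFiniteMeasure P] {φ f : Ω → ℝ} (hφ : Measurable[m] φ) {b : ℝ}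
    (hb : ∀ ω, |φ ω| ≤ b) (hf : Integrable f P) :
    ∫ ω, φ ω * f ω ∂P = ∫ ω, φ ω * (P[f | m]) ω ∂P := by
  have integrable_mul : Integrable (φ * f) P :=
    hf.bdd_mul (c := b) (hφ.mono hm le_rfl).aestronglyMeasurable (.of_forall hb)
  calc ∫ ω, φ ω * f ω ∂P = ∫ ω, (P[φ * f | m]) ω ∂P := (integral_condExp hm).symm
    _ = ∫ ω, φ ω * (P[f | m]) ω ∂P := integral_congr_ae
        (condExp_mul_of_stronglyMeasurable_left hφ.stronglyMeasurable integrable_mul hf)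

theorem integrable_of_abs_le {Ω : Type*} {_ : MeasurableSpace Ω} {P : Measure Ω}
    [IsFiniteMeasure P] {f : Ω → ℝ} (hf : Measurable f) {b : ℝ} (hb : ∀ ω, |f ω| ≤ b) :
    Integrable f P :=
  .of_bound hf.aestronglyMeasurable b (.of_forall hb)

theorem measurable_eval_of_finite {Ω ι : Type*} {_ : MeasurableSpace Ω} [Finite ι]
    [MeasurableSpace ι] [MeasurableSingletonClass ι] {f : Ω → ι → ℝ} (hf : Measurable f)
    {a : Ω → ι} (ha : Measurable a) : Measurable fun ω => f ω (a ω) :=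
  (measurable_from_prod_countable_left (f := fun z : Ω × ι => f z.1 z.2)
    fun x => (measurable_pi_apply x).comp hf).comp (measurable_id.prodMk ha)

theorem exp_add_mul_le {g h r : ℝ} (hgh : |g| + |h| ≤ 1) (hr : |r| ≤ 1) :
    Real.exp (g + r * h) ≤ 1 + (g + 2 * g ^ 2 + 2 * h ^ 2) + r * h := by
  have abs_mul_le : |r * h| ≤ |h| := by
    rw [abs_mul]
    exact mul_le_of_le_one_left (abs_nonneg h) hr
  have abs_add_le_one : |g + r * h| ≤ 1 := (abs_add_le _ _).trans (by linarith)
  have exp_le := (abs_le.1 (Real.abs_exp_sub_one_sub_id_le abs_add_le_one)).2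
  nlinarith [sq_nonneg (g - r * h), sq_le_sq.2 abs_mul_le]

section Compensator

variable {ι : Type*} [Fintype ι]

theorem abs_add_two_mul_sq_le {g h : ℝ} (hgh : |g| + |h| ≤ 1) :
    |g + 2 * g ^ 2 + 2 * h ^ 2| ≤ 3 := by
  have sq_add_sq_le : g ^ 2 + h ^ 2 ≤ 1 := by
    nlinarith [abs_nonneg g, abs_nonneg h, sq_abs g, sq_abs h]
  have abs_g_le : |g| ≤ 1 := by linarith [abs_nonneg h]
  rw [abs_le] at abs_g_le ⊢
  constructor <;> linarith [sq_nonneg g, sq_nonneg h]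

/-- An upper bound for the logarithm of the conditional exponential moment of `g(a) + r h(a)`, when
`a ∼ p` and `r` has conditional mean `R(a)`. -/
noncomputable def compensator (R p g h : ι → ℝ) : ℝ :=
  ∑ x, p x * (g x + 2 * g x ^ 2 + 2 * h x ^ 2 + R x * h x)

theorem measurable_compensator {Ω : Type*} {_ : MeasurableSpace Ω} {R p g h : Ω → ι → ℝ}
    (hR : Measurable R) (hp : Measurable p) (hg : Measurable g) (hh : Measurable h) :
    Measurable fun ω => compensator (R ω) (p ω) (g ω) (h ω) := by
  unfold compensator
  fun_prop

theorem abs_compensator_le {c : ℝ} {R p g h : ι → ℝ} (hp : p ∈ stdSimplex ℝ ι)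
    (hR : ∀ x, |R x| ≤ c) (hgh : ∀ x, |g x| + |h x| ≤ 1) : |compensator R p g h| ≤ 3 + c := by
  have term_le : ∀ x, |g x + 2 * g x ^ 2 + 2 * h x ^ 2 + R x * h x| ≤ 3 + c := by
    intro x
    refine (abs_add_le _ _).trans (add_le_add (abs_add_two_mul_sq_le (hgh x)) ?_)
    rw [abs_mul]
    exact (mul_le_of_le_one_right (abs_nonneg _)
      (by linarith [hgh x, abs_nonneg (g x)])).trans (hR x)
  calc |compensator R p g h|
      ≤ ∑ x, |p x * (g x + 2 * g x ^ 2 + 2 * h x ^ 2 + R x * h x)| :=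
        Finset.abs_sum_le_sum_abs _ _
    _ ≤ ∑ x, p x * (3 + c) := Finset.sum_le_sum fun x _ => by
        rw [abs_mul, abs_of_nonneg (hp.1 x)]
        exact mul_le_mul_of_nonneg_left (term_le x) (hp.1 x)
    _ = 3 + c := by rw [← Finset.sum_mul, hp.2, one_mul]

/-- The sum of the compensated increments `g_t(a_t) + r_t h_t(a_t)` of the first `n` rounds, whose
exponential is a supermartingale. -/
noncomputable def compensatedSum (R p g h : ℕ → ι → ℝ) (a : ℕ → ι) (r : ℕ → ℝ) (n : ℕ) : ℝ :=
  ∑ t ∈ Finset.Icc 1 n, (g t (a t) + r t * h t (a t) - compensator (R t) (p t) (g t) (h t))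

theorem compensatedSum_succ (R p g h : ℕ → ι → ℝ) (a : ℕ → ι) (r : ℕ → ℝ) (n : ℕ) :
    compensatedSum R p g h a r (n + 1) = compensatedSum R p g h a r n
      + (g (n + 1) (a (n + 1)) + r (n + 1) * h (n + 1) (a (n + 1))
        - compensator (R (n + 1)) (p (n + 1)) (g (n + 1)) (h (n + 1))) :=
  Finset.sum_Icc_succ_top (by omega) _

end Compensator

variable {Ω ι : Type*} [mΩ : MeasurableSpace Ω]

/-- The coefficients `g_t`, `h_t` of the increments `g_t(a_t) + r_t h_t(a_t)`, fixed before the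
round and small enough for the exponential of the increment to be controlled by its first two
moments. -/
structure IsPredictablePair (ℱ : Filtration ℕ mΩ) (T : ℕ) (g h : ℕ → Ω → ι → ℝ) : Prop where
  measurable_fst : ∀ t ∈ Finset.Icc 1 T, Measurable[ℱ (t - 1)] (g t)
  measurable_snd : ∀ t ∈ Finset.Icc 1 T, Measurable[ℱ (t - 1)] (h t)
  abs_add_abs_le : ∀ t ∈ Finset.Icc 1 T, ∀ ω x, |g t ω x| + |h t ω x| ≤ 1

namespace IsPredictablePair

variable {ℱ : Filtration ℕ mΩ} {T : ℕ} {g h : ℕ → Ω → ι → ℝ}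

theorem abs_snd_le (hgh : IsPredictablePair ℱ T g h) {t : ℕ} (ht : t ∈ Finset.Icc 1 T) (ω : Ω)
    (x : ι) : |h t ω x| ≤ 1 := by
  linarith [hgh.abs_add_abs_le t ht ω x, abs_nonneg (g t ω x)]

theorem measurable_add_two_mul_sq (hgh : IsPredictablePair ℱ T g h) {t : ℕ}
    (ht : t ∈ Finset.Icc 1 T) (x : ι) :
    Measurable[ℱ (t - 1)] fun ω => g t ω x + 2 * g t ω x ^ 2 + 2 * h t ω x ^ 2 := by
  have hg : Measurable[ℱ (t - 1)] fun ω => g t ω x :=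
    (measurable_pi_apply x).comp (hgh.measurable_fst t ht)
  have hh : Measurable[ℱ (t - 1)] fun ω => h t ω x :=
    (measurable_pi_apply x).comp (hgh.measurable_snd t ht)
  exact (hg.add ((hg.pow_const 2).const_mul 2)).add ((hh.pow_const 2).const_mul 2)

end IsPredictablePair

variable [Fintype ι]

/-- `T` rounds of a bandit with the finite action set `ι`: in round `t` the action `a_t` is drawn
from `p_t`, and the reward `r_t ∈ [-1, 1]` has conditional mean `R_t(a_t)`, where `p_t` and `R_t`
are fixed before the round and `R_t` is bounded by `c`. -/
structure IsFiniteBandit [MeasurableSpace ι] (P : Measure Ω) (ℱ : Filtration ℕ mΩ) (T : ℕ) (c : ℝ)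
    (R p : ℕ → Ω → ι → ℝ) (a : ℕ → Ω → ι) (r : ℕ → Ω → ℝ) : Prop where
  measurable_mean : ∀ t ∈ Finset.Icc 1 T, Measurable[ℱ (t - 1)] (R t)
  measurable_dist : ∀ t ∈ Finset.Icc 1 T, Measurable[ℱ (t - 1)] (p t)
  measurable_action : ∀ t ∈ Finset.Icc 1 T, Measurable[ℱ t] (a t)
  measurable_reward : ∀ t ∈ Finset.Icc 1 T, Measurable[ℱ t] (r t)
  dist_mem : ∀ t ∈ Finset.Icc 1 T, ∀ ω, p t ω ∈ stdSimplex ℝ ι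
  abs_mean_le : ∀ t ∈ Finset.Icc 1 T, ∀ ω x, |R t ω x| ≤ c
  abs_reward_le : ∀ t ∈ Finset.Icc 1 T, ∀ ω, |r t ω| ≤ 1
  action_law : ∀ t ∈ Finset.Icc 1 T, ∀ x,
    P⟦a t ⁻¹' {x} | ℱ (t - 1)⟧ =ᵐ[P] fun ω => p t ω x
  reward_mean : ∀ t ∈ Finset.Icc 1 T,
    P[r t | ℱ (t - 1) ⊔ MeasurableSpace.comap (a t) inferInstance] =ᵐ[P] fun ω => R t ω (a t ω)

namespace IsFiniteBandit

variable [MeasurableSpace ι] {P : Measure Ω} {ℱ : Filtration ℕ mΩ} {T : ℕ} {c : ℝ}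
  {R p g h : ℕ → Ω → ι → ℝ} {a : ℕ → Ω → ι} {r : ℕ → Ω → ℝ}

theorem compensatedSum_le (hb : IsFiniteBandit P ℱ T c R p a r)
    (hgh : IsPredictablePair ℱ T g h) {n : ℕ} (hn : n ≤ T) (ω : Ω) :
    compensatedSum (R · ω) (p · ω) (g · ω) (h · ω) (a · ω) (r · ω) n ≤ n * (4 + c) := by
  have term_le : ∀ t ∈ Finset.Icc 1 n, g t ω (a t ω) + r t ω * h t ω (a t ω)
      - compensator (R t ω) (p t ω) (g t ω) (h t ω) ≤ 4 + c := by
    intro t ht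
    obtain ⟨one_le, le_n⟩ := Finset.mem_Icc.1 ht
    have ht : t ∈ Finset.Icc 1 T := Finset.mem_Icc.2 ⟨one_le, le_n.trans hn⟩
    have reward_term_le : |r t ω * h t ω (a t ω)| ≤ |h t ω (a t ω)| := by
      rw [abs_mul]
      exact mul_le_of_le_one_left (abs_nonneg _) (hb.abs_reward_le t ht ω)
    have compensator_ge := (abs_le.1 (abs_compensator_le (hb.dist_mem t ht ω)
      (hb.abs_mean_le t ht ω) (hgh.abs_add_abs_le t ht ω))).1
    linarith [le_abs_self (g t ω (a t ω)), le_abs_self (r t ω * h t ω (a t ω)),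
      hgh.abs_add_abs_le t ht ω (a t ω)]
  exact (Finset.sum_le_card_nsmul _ _ _ term_le).trans_eq
    (by rw [Nat.card_Icc, Nat.add_sub_cancel, nsmul_eq_mul])

theorem integrable_reward [IsFiniteMeasure P] (hb : IsFiniteBandit P ℱ T c R p a r) {t : ℕ}
    (ht : t ∈ Finset.Icc 1 T) : Integrable (r t) P :=
  integrable_of_abs_le ((hb.measurable_reward t ht).mono (ℱ.le t) le_rfl) (hb.abs_reward_le t ht)

variable [MeasurableSingletonClass ι]

theorem measurable_compensatedSum (hb : IsFiniteBandit P ℱ T c R p a r)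
    (hgh : IsPredictablePair ℱ T g h) {n : ℕ} (hn : n ≤ T) : Measurable[ℱ n] fun ω =>
      compensatedSum (R · ω) (p · ω) (g · ω) (h · ω) (a · ω) (r · ω) n := by
  refine Finset.measurable_sum _ fun t ht => ?_
  obtain ⟨one_le, le_n⟩ := Finset.mem_Icc.1 ht
  have ht : t ∈ Finset.Icc 1 T := Finset.mem_Icc.2 ⟨one_le, le_n.trans hn⟩
  have past_le : ℱ (t - 1) ≤ ℱ n := ℱ.mono (by omega)
  have measurable_action := (hb.measurable_action t ht).mono (ℱ.mono le_n) le_rfl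
  have measurable_reward := (hb.measurable_reward t ht).mono (ℱ.mono le_n) le_rfl
  have measurable_fst := (hgh.measurable_fst t ht).mono past_le le_rfl
  have measurable_snd := (hgh.measurable_snd t ht).mono past_le le_rfl
  exact ((measurable_eval_of_finite measurable_fst measurable_action).add
    (measurable_reward.mul (measurable_eval_of_finite measurable_snd measurable_action))).sub
    (measurable_compensator ((hb.measurable_mean t ht).mono past_le le_rfl)
      ((hb.measurable_dist t ht).mono past_le le_rfl) measurable_fst measurable_snd)

variable [IsProbabilityMeasure P]

theorem integral_eval_action (hb : IsFiniteBandit P ℱ T c R p a r) {t : ℕ}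
    (ht : t ∈ Finset.Icc 1 T) {f : Ω → ι → ℝ} (hf : Measurable[ℱ (t - 1)] f) {b : ℝ}
    (hfb : ∀ ω x, |f ω x| ≤ b) :
    ∫ ω, f ω (a t ω) ∂P = ∫ ω, ∑ x, p t ω x * f ω x ∂P := by
  classical
  have measurable_eval : ∀ x, Measurable[ℱ (t - 1)] fun ω => f ω x := fun x =>
    (measurable_pi_apply x).comp hf
  have integrable_indicator : ∀ x, Integrable ((a t ⁻¹' {x}).indicator fun _ => (1 : ℝ)) P :=
    fun x => (integrable_const 1).indicator
      (ℱ.le t _ (hb.measurable_action t ht (measurableSet_singleton x)))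
  have integrable_mul : ∀ x {e : Ω → ℝ}, Integrable e P → Integrable (fun ω => f ω x * e ω) P :=
    fun x e he => he.bdd_mul (c := b)
      ((measurable_eval x).mono (ℱ.le _) le_rfl).aestronglyMeasurable (.of_forall fun ω => hfb ω x)
  have integrable_dist : ∀ x, Integrable (fun ω => p t ω x) P := fun x =>
    integrable_condExp.congr (hb.action_law t ht x)
  calc ∫ ω, f ω (a t ω) ∂P
      = ∫ ω, ∑ x, f ω x * (a t ⁻¹' {x}).indicator (fun _ => 1) ω ∂P := by
        simp [Set.indicator_apply]
    _ = ∑ x, ∫ ω, f ω x * (a t ⁻¹' {x}).indicator (fun _ => 1) ω ∂P :=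
        integral_finsetSum _ fun x _ => integrable_mul x (integrable_indicator x)
    _ = ∑ x, ∫ ω, f ω x * p t ω x ∂P := Finset.sum_congr rfl fun x _ => by
        rw [integral_mul_condExp (ℱ.le _) (measurable_eval x) (fun ω => hfb ω x)
          (integrable_indicator x)]
        refine integral_congr_ae ?_
        filter_upwards [hb.action_law t ht x] with ω hω
        rw [hω]
    _ = ∫ ω, ∑ x, p t ω x * f ω x ∂P := by
        simp only [mul_comm (p t _ _)]
        exact (integral_finsetSum _ fun x _ => integrable_mul x (integrable_dist x)).symm

theorem integrable_eval_action (hb : IsFiniteBandit P ℱ T c R p a r) {t : ℕ}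
    (ht : t ∈ Finset.Icc 1 T) {f : Ω → ι → ℝ} (hf : Measurable[ℱ (t - 1)] f) {b : ℝ}
    (hfb : ∀ ω x, |f ω x| ≤ b) : Integrable (fun ω => f ω (a t ω)) P :=
  integrable_of_abs_le (measurable_eval_of_finite (hf.mono (ℱ.le _) le_rfl)
    ((hb.measurable_action t ht).mono (ℱ.le t) le_rfl)) fun ω => hfb ω _

theorem integrable_eval_action_mul_reward (hb : IsFiniteBandit P ℱ T c R p a r) {t : ℕ}
    (ht : t ∈ Finset.Icc 1 T) {f : Ω → ι → ℝ} (hf : Measurable[ℱ (t - 1)] f) {b : ℝ}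
    (hfb : ∀ ω x, |f ω x| ≤ b) : Integrable (fun ω => f ω (a t ω) * r t ω) P :=
  (hb.integrable_reward ht).bdd_mul (hb.integrable_eval_action ht hf hfb).aestronglyMeasurable
    (.of_forall fun ω => hfb ω _)

theorem integral_eval_action_mul_reward (hb : IsFiniteBandit P ℱ T c R p a r) {t : ℕ}
    (ht : t ∈ Finset.Icc 1 T) {f : Ω → ι → ℝ} (hf : Measurable[ℱ (t - 1)] f) {b : ℝ}
    (hfb : ∀ ω x, |f ω x| ≤ b) :
    ∫ ω, f ω (a t ω) * r t ω ∂P = ∫ ω, f ω (a t ω) * R t ω (a t ω) ∂P := by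
  have le_ambient : ℱ (t - 1) ⊔ MeasurableSpace.comap (a t) inferInstance ≤ mΩ :=
    sup_le (ℱ.le _) ((hb.measurable_action t ht).mono (ℱ.le t) le_rfl).comap_le
  have measurable_action :
      Measurable[ℱ (t - 1) ⊔ MeasurableSpace.comap (a t) inferInstance] (a t) :=
    Measurable.mono (comap_measurable (a t)) le_sup_right le_rfl
  have measurable_f : Measurable[ℱ (t - 1) ⊔ MeasurableSpace.comap (a t) inferInstance] f :=
    hf.mono le_sup_left le_rfl
  have measurable_eval := measurable_eval_of_finite measurable_f measurable_action
  rw [integral_mul_condExp le_ambient measurable_eval (fun ω => hfb ω _) (hb.integrable_reward ht)]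
  refine integral_congr_ae ?_
  filter_upwards [hb.reward_mean t ht] with ω hω
  rw [hω]

theorem integral_eval_action_add_mul_reward (hb : IsFiniteBandit P ℱ T c R p a r) {t : ℕ}
    (ht : t ∈ Finset.Icc 1 T) {f k : Ω → ι → ℝ} (hf : Measurable[ℱ (t - 1)] f) {b : ℝ}
    (hfb : ∀ ω x, |f ω x| ≤ b) (hk : Measurable[ℱ (t - 1)] k) {e : ℝ} (hke : ∀ ω x, |k ω x| ≤ e) :
    ∫ ω, (f ω (a t ω) + k ω (a t ω) * r t ω) ∂P
      = ∫ ω, ∑ x, p t ω x * (f ω x + k ω x * R t ω x) ∂P := by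
  have measurable_mul : Measurable[ℱ (t - 1)] fun ω x => k ω x * R t ω x :=
    hk.mul (hb.measurable_mean t ht)
  have abs_mul_le : ∀ ω x, |k ω x * R t ω x| ≤ e * c := fun ω x => by
    rw [abs_mul]
    exact mul_le_mul (hke ω x) (hb.abs_mean_le t ht ω x) (abs_nonneg _)
      ((abs_nonneg _).trans (hke ω x))
  rw [integral_add (hb.integrable_eval_action ht hf hfb)
      (hb.integrable_eval_action_mul_reward ht hk hke),
    hb.integral_eval_action_mul_reward ht hk hke,
    ← integral_add (hb.integrable_eval_action ht hf hfb)
      (hb.integrable_eval_action ht measurable_mul abs_mul_le)]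
  exact hb.integral_eval_action ht (f := fun ω x => f ω x + k ω x * R t ω x)
    (hf.add measurable_mul) fun ω x =>
      (abs_add_le _ _).trans (add_le_add (hfb ω x) (abs_mul_le ω x))

theorem integral_mul_exp_le (hb : IsFiniteBandit P ℱ T c R p a r)
    (hgh : IsPredictablePair ℱ T g h) {t : ℕ} (ht : t ∈ Finset.Icc 1 T) {W : Ω → ℝ}
    (hW : Measurable[ℱ (t - 1)] W) (hW₀ : ∀ ω, 0 ≤ W ω) {b : ℝ} (hWb : ∀ ω, W ω ≤ b) :
    ∫ ω, W ω * Real.exp (g t ω (a t ω) + r t ω * h t ω (a t ω)) ∂P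
      ≤ ∫ ω, W ω * (1 + compensator (R t ω) (p t ω) (g t ω) (h t ω)) ∂P := by
  have abs_W_le : ∀ ω, |W ω| ≤ b := fun ω => (abs_of_nonneg (hW₀ ω)).trans_le (hWb ω)
  let F : Ω → ι → ℝ := fun ω x => W ω * (1 + (g t ω x + 2 * g t ω x ^ 2 + 2 * h t ω x ^ 2))
  let H : Ω → ι → ℝ := fun ω x => W ω * h t ω x
  have measurable_F : Measurable[ℱ (t - 1)] F :=
    @measurable_pi_lambda _ _ _ (_) _ _ fun x =>
      hW.mul (measurable_const.add (hgh.measurable_add_two_mul_sq ht x))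
  have measurable_H : Measurable[ℱ (t - 1)] H :=
    @measurable_pi_lambda _ _ _ (_) _ _ fun x =>
      hW.mul ((measurable_pi_apply x).comp (hgh.measurable_snd t ht))
  have abs_F_le : ∀ ω x, |F ω x| ≤ b * (1 + 3) := fun ω x => by
    rw [abs_mul]
    refine mul_le_mul (abs_W_le ω) ?_ (abs_nonneg _) ((abs_nonneg _).trans (abs_W_le ω))
    refine (abs_add_le _ _).trans (add_le_add abs_one.le ?_)
    exact abs_add_two_mul_sq_le (hgh.abs_add_abs_le t ht ω x)
  have abs_H_le : ∀ ω x, |H ω x| ≤ b := fun ω x => by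
    rw [abs_mul]
    exact (mul_le_of_le_one_right (abs_nonneg _) (hgh.abs_snd_le ht ω x)).trans (abs_W_le ω)
  have eval_add_mul_reward := hb.integral_eval_action_add_mul_reward ht
    measurable_F abs_F_le measurable_H abs_H_le
  calc ∫ ω, W ω * Real.exp (g t ω (a t ω) + r t ω * h t ω (a t ω)) ∂P
      ≤ ∫ ω, (F ω (a t ω) + H ω (a t ω) * r t ω) ∂P := by
        refine integral_mono_of_nonneg (.of_forall fun ω => mul_nonneg (hW₀ ω) (Real.exp_pos _).le)
          ((hb.integrable_eval_action ht measurable_F abs_F_le).add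
            (hb.integrable_eval_action_mul_reward ht measurable_H abs_H_le))
          (.of_forall fun ω => ?_)
        have := mul_le_mul_of_nonneg_left (exp_add_mul_le (hgh.abs_add_abs_le t ht ω (a t ω))
          (hb.abs_reward_le t ht ω)) (hW₀ ω)
        simp only [F, H]
        linarith
    _ = ∫ ω, ∑ x, p t ω x * (F ω x + H ω x * R t ω x) ∂P := eval_add_mul_reward
    _ = ∫ ω, W ω * (1 + compensator (R t ω) (p t ω) (g t ω) (h t ω)) ∂P := by
        refine integral_congr_ae (.of_forall fun ω => ?_)
        simp only [F, H]
        have sum_dist_mul : ∑ x, p t ω x * W ω = W ω * 1 := by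
          rw [← Finset.sum_mul, (hb.dist_mem t ht ω).2, mul_comm]
        rw [compensator, mul_add, ← sum_dist_mul, Finset.mul_sum, ← Finset.sum_add_distrib]
        exact Finset.sum_congr rfl fun x _ => by ring

theorem integrable_exp_compensatedSum (hb : IsFiniteBandit P ℱ T c R p a r)
    (hgh : IsPredictablePair ℱ T g h) {n : ℕ} (hn : n ≤ T) : Integrable (fun ω =>
      Real.exp (compensatedSum (R · ω) (p · ω) (g · ω) (h · ω) (a · ω) (r · ω) n)) P :=
  integrable_of_abs_le
    (Real.measurable_exp.comp ((hb.measurable_compensatedSum hgh hn).mono (ℱ.le n) le_rfl))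
    fun ω => by
      rw [Real.abs_exp]
      exact Real.exp_le_exp.2 (hb.compensatedSum_le hgh hn ω)

theorem integral_exp_add_sub_compensator_le (hb : IsFiniteBandit P ℱ T c R p a r)
    (hgh : IsPredictablePair ℱ T g h) {t : ℕ} (ht : t ∈ Finset.Icc 1 T) {S : Ω → ℝ}
    (hS : Measurable[ℱ (t - 1)] S) {b : ℝ} (hSb : ∀ ω, S ω ≤ b) :
    ∫ ω, Real.exp (S ω + (g t ω (a t ω) + r t ω * h t ω (a t ω)
      - compensator (R t ω) (p t ω) (g t ω) (h t ω))) ∂P ≤ ∫ ω, Real.exp (S ω) ∂P := by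
  set κ : Ω → ℝ := fun ω => compensator (R t ω) (p t ω) (g t ω) (h t ω)
  have abs_κ_le : ∀ ω, |κ ω| ≤ 3 + c := fun ω => abs_compensator_le (hb.dist_mem t ht ω)
    (hb.abs_mean_le t ht ω) (hgh.abs_add_abs_le t ht ω)
  have measurable_κ : Measurable[ℱ (t - 1)] κ :=
    measurable_compensator (hb.measurable_mean t ht) (hb.measurable_dist t ht)
      (hgh.measurable_fst t ht) (hgh.measurable_snd t ht)
  have measurable_W : Measurable[ℱ (t - 1)] fun ω => Real.exp (S ω - κ ω) :=
    Real.measurable_exp.comp (hS.sub measurable_κ)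
  have W_le : ∀ ω, Real.exp (S ω - κ ω) ≤ Real.exp (b + (3 + c)) := fun ω =>
    Real.exp_le_exp.2 (by linarith [hSb ω, (abs_le.1 (abs_κ_le ω)).1])
  have W_mul_le : ∀ ω, Real.exp (S ω - κ ω) * (1 + κ ω) ≤ Real.exp (S ω) := fun ω =>
    calc Real.exp (S ω - κ ω) * (1 + κ ω) ≤ Real.exp (S ω - κ ω) * Real.exp (κ ω) := by
          gcongr
          linarith [Real.add_one_le_exp (κ ω)]
      _ = Real.exp (S ω) := by rw [← Real.exp_add, sub_add_cancel]
  calc ∫ ω, Real.exp (S ω + (g t ω (a t ω) + r t ω * h t ω (a t ω) - κ ω)) ∂P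
      = ∫ ω, Real.exp (S ω - κ ω) * Real.exp (g t ω (a t ω) + r t ω * h t ω (a t ω)) ∂P := by
        refine integral_congr_ae (.of_forall fun ω => ?_)
        simp only [← Real.exp_add]
        ring_nf
    _ ≤ ∫ ω, Real.exp (S ω - κ ω) * (1 + κ ω) ∂P :=
        hb.integral_mul_exp_le hgh ht measurable_W (fun ω => (Real.exp_pos _).le) W_le
    _ ≤ ∫ ω, Real.exp (S ω) ∂P := by
        refine integral_mono (integrable_of_abs_le ((measurable_W.mul
            (measurable_const.add measurable_κ)).mono (ℱ.le _) le_rfl)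
            (b := Real.exp (b + (3 + c)) * (1 + (3 + c))) fun ω => ?_)
          (integrable_of_abs_le ((Real.measurable_exp.comp hS).mono (ℱ.le _) le_rfl)
            (b := Real.exp b) fun ω => ?_) W_mul_le
        · rw [abs_mul, Real.abs_exp]
          exact mul_le_mul (W_le ω) ((abs_add_le _ _).trans (add_le_add abs_one.le (abs_κ_le ω)))
            (abs_nonneg _) (Real.exp_pos _).le
        · exact (Real.abs_exp _).trans_le (Real.exp_le_exp.2 (hSb ω))

theorem integral_exp_compensatedSum_le_one (hb : IsFiniteBandit P ℱ T c R p a r)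
    (hgh : IsPredictablePair ℱ T g h) {n : ℕ} (hn : n ≤ T) :
    ∫ ω, Real.exp (compensatedSum (R · ω) (p · ω) (g · ω) (h · ω) (a · ω) (r · ω) n) ∂P ≤ 1 := by
  induction n with
  | zero => simp [compensatedSum]
  | succ n ih =>
    have hn' : n ≤ T := by omega
    simp only [compensatedSum_succ]
    exact (hb.integral_exp_add_sub_compensator_le hgh (Finset.mem_Icc.2 ⟨by omega, hn⟩)
      (hb.measurable_compensatedSum hgh hn') (hb.compensatedSum_le hgh hn')).trans (ih hn')

theorem measureReal_log_le_compensatedSum_le (hb : IsFiniteBandit P ℱ T c R p a r)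
    (hgh : IsPredictablePair ℱ T g h) {δ : ℝ} (hδ : 0 < δ) :
    P.real {ω | Real.log (1 / δ)
      ≤ compensatedSum (R · ω) (p · ω) (g · ω) (h · ω) (a · ω) (r · ω) T} ≤ δ := by
  have exp_neg_log : Real.exp (-1 * Real.log (1 / δ)) = δ := by
    rw [one_div, Real.log_inv, neg_one_mul, neg_neg, Real.exp_log hδ]
  have chernoff := measure_ge_le_exp_mul_mgf (μ := P) (Real.log (1 / δ)) zero_le_one
    (by simpa only [one_mul] using hb.integrable_exp_compensatedSum hgh le_rfl)
  rw [exp_neg_log] at chernoff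
  refine chernoff.trans (mul_le_of_le_one_right hδ.le ?_)
  simpa only [mgf, one_mul] using hb.integral_exp_compensatedSum_le_one hgh le_rfl

theorem le_measureReal_forall_compensatedSum_le (hb : IsFiniteBandit P ℱ T c R p a r)
    {κ : Type*} [Fintype κ] [Nonempty κ] {g h : κ → ℕ → Ω → ι → ℝ}
    (hgh : ∀ i, IsPredictablePair ℱ T (g i) (h i)) {δ : ℝ} (hδ : 0 < δ) :
    1 - δ ≤ P.real {ω | ∀ i,
      compensatedSum (R · ω) (p · ω) (g i · ω) (h i · ω) (a · ω) (r · ω) T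
        ≤ Real.log (Fintype.card κ / δ)} := by
  set S : κ → Ω → ℝ := fun i ω =>
    compensatedSum (R · ω) (p · ω) (g i · ω) (h i · ω) (a · ω) (r · ω) T
  have card_pos : (0 : ℝ) < Fintype.card κ := by exact_mod_cast Fintype.card_pos
  have exceed_le : ∀ i, P.real {ω | Real.log (Fintype.card κ / δ) ≤ S i ω} ≤ δ / Fintype.card κ :=
    fun i => by
      simpa only [one_div_div] using
        hb.measureReal_log_le_compensatedSum_le (hgh i) (div_pos hδ card_pos)
  have measurableSet_good : MeasurableSet {ω | ∀ i, S i ω ≤ Real.log (Fintype.card κ / δ)} := by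
    rw [Set.ofPred_forall]
    exact .iInter fun i => measurableSet_le
      ((hb.measurable_compensatedSum (hgh i) le_rfl).mono (ℱ.le T) le_rfl) measurable_const
  have bad_subset : {ω | ∀ i, S i ω ≤ Real.log (Fintype.card κ / δ)}ᶜ
      ⊆ ⋃ i, {ω | Real.log (Fintype.card κ / δ) ≤ S i ω} := by
    intro ω hω
    simp only [Set.mem_compl_iff, Set.mem_ofPred_eq, not_forall, not_le] at hω
    obtain ⟨i, hi⟩ := hω
    exact Set.mem_iUnion.2 ⟨i, hi.le⟩
  have bad_le : P.real {ω | ∀ i, S i ω ≤ Real.log (Fintype.card κ / δ)}ᶜ ≤ δ :=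
    calc _ ≤ ∑ i, P.real {ω | Real.log (Fintype.card κ / δ) ≤ S i ω} :=
          (measureReal_mono bad_subset).trans (measureReal_iUnion_fintype_le _)
      _ ≤ ∑ _i : κ, δ / Fintype.card κ := Finset.sum_le_sum fun i _ => exceed_le i
      _ = δ := by
          rw [Finset.sum_const, Finset.card_univ, nsmul_eq_mul, mul_div_cancel₀ _ card_pos.ne']
  rw [probReal_compl_eq_one_sub measurableSet_good] at bad_le
  linarith

end IsFiniteBandit

end Concentration

/-! ### A finite net of actions -/

theorem abs_sub_le_of_floor_eq {u v b m : ℝ} (hb : 0 < b) (hm : 0 < m)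
    (h : ⌊u * m / b⌋ = ⌊v * m / b⌋) : |u - v| ≤ b / m := by
  have abs_sub_lt_one := Int.abs_sub_lt_one_of_floor_eq_floor h
  rw [← sub_div, ← sub_mul, abs_div, abs_mul, abs_of_pos hm, abs_of_pos hb, div_lt_one hb]
    at abs_sub_lt_one
  exact (le_div_iff₀ hm).2 abs_sub_lt_one.le

theorem exists_grid_net {ι κ : Type*} [Fintype κ] (f : ι → κ → ℝ) {b : ℝ} (hb : 0 < b)
    (hf : ∀ x i, |f x i| ≤ b) {m : ℕ} (hm : 1 ≤ m) :
    ∃ N : Finset ι, N.card ≤ (2 * m + 1) ^ Fintype.card κ ∧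
      ∀ x, ∃ y ∈ N, ∀ i, |f x i - f y i| ≤ b / m := by
  classical
  have floor_mem : ∀ x i, ⌊f x i * m / b⌋ ∈ Finset.Icc (-m : ℤ) m := by
    intro x i
    obtain ⟨lower, upper⟩ := abs_le.1 (hf x i)
    rw [Finset.mem_Icc, Int.le_floor, ← Int.cast_le (R := ℝ)]
    refine ⟨(le_div_iff₀ hb).2 ?_, (Int.floor_le _).trans ((div_le_iff₀ hb).2 ?_)⟩ <;>
      · push_cast
        nlinarith [Nat.cast_nonneg (α := ℝ) m]
  let cell : ι → κ → Finset.Icc (-m : ℤ) m := fun x i => ⟨⌊f x i * m / b⌋, floor_mem x i⟩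
  refine ⟨Finset.univ.image (Set.rangeSplitting cell), ?_, fun x =>
    ⟨Set.rangeSplitting cell ⟨cell x, x, rfl⟩, Finset.mem_image_of_mem _ (Finset.mem_univ _),
      fun i => ?_⟩⟩
  · calc (Finset.univ.image (Set.rangeSplitting cell)).card ≤ Fintype.card (Set.range cell) :=
          Finset.card_image_le
      _ ≤ Fintype.card (κ → Finset.Icc (-m : ℤ) m) :=
          Fintype.card_le_of_injective _ Subtype.val_injective
      _ = (2 * m + 1) ^ Fintype.card κ := by
          rw [Fintype.card_fun, Fintype.card_coe, Int.card_Icc]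
          congr
          omega
  · have cell_eq := congrFun (Set.apply_rangeSplitting cell ⟨cell x, x, rfl⟩) i
    exact abs_sub_le_of_floor_eq hb (by exact_mod_cast hm) (congrArg Subtype.val cell_eq).symm

theorem IsSpread.exists_net {d : ℕ} {A : Finset (Fin d → ℝ)} {β : ℝ} {ρ : A → ℝ}
    (hρ : IsSpread β ρ) (hβ : 0 < β) {m : ℕ} (hm : 1 ≤ m) :
    ∃ N : Finset A, N.card ≤ (2 * m + 1) ^ d ∧ ∀ x : A, ∃ y ∈ N,
      (x.1 - y.1) ⬝ᵥ ((secondMoment ρ)⁻¹ *ᵥ (x.1 - y.1)) ≤ d * β / m ^ 2 := by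
  obtain ⟨Q, hQ, inv_eq⟩ := exists_posDef_mul_self hρ.secondMoment_posDef.inv
  have quad_eq : ∀ v : Fin d → ℝ, v ⬝ᵥ ((secondMoment ρ)⁻¹ *ᵥ v) = ∑ i, (Q *ᵥ v) i ^ 2 := by
    intro v
    rw [inv_eq, ← Matrix.mulVec_mulVec,
      dotProduct_mulVec_comm (isSymm_of_posSemidef hQ.posSemidef)]
    simp only [dotProduct, sq]
  have abs_coord_le : ∀ (x : A) i, |(Q *ᵥ x.1) i| ≤ √β := fun x i =>
    Real.abs_le_sqrt ((Finset.single_le_sum (fun j _ => sq_nonneg ((Q *ᵥ x.1) j))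
      (Finset.mem_univ i)).trans (quad_eq x.1 ▸ hρ.quad_inv_action_le x))
  obtain ⟨N, card_le, net⟩ :=
    exists_grid_net (fun x : A => Q *ᵥ x.1) (Real.sqrt_pos.2 hβ) abs_coord_le hm
  refine ⟨N, card_le.trans_eq (by rw [Fintype.card_fin]), fun x => ?_⟩
  obtain ⟨y, hy, coord_sub_le⟩ := net x
  refine ⟨y, hy, ?_⟩
  calc (x.1 - y.1) ⬝ᵥ ((secondMoment ρ)⁻¹ *ᵥ (x.1 - y.1))
      = ∑ i, ((Q *ᵥ x.1) i - (Q *ᵥ y.1) i) ^ 2 := by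
        rw [quad_eq]
        simp only [Matrix.mulVec_sub, Pi.sub_apply]
    _ ≤ ∑ _i : Fin d, β / m ^ 2 := Finset.sum_le_sum fun i _ => by
        rw [← Real.sq_sqrt hβ.le, ← div_pow]
        exact sq_le_sq.2 ((coord_sub_le i).trans (le_abs_self _))
    _ = d * β / m ^ 2 := by
        rw [Finset.sum_const, Finset.card_univ, Fintype.card_fin, nsmul_eq_mul, mul_div_assoc]

/-! ### The one-round deviation -/

section Deviation

variable {d : ℕ} {A : Finset (Fin d → ℝ)}

/-- The conditional mean `⟨b, θ⟩ + ε(b)` of the reward of each action `b`. -/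
def meanReward (θ : Fin d → ℝ) (ε : A → ℝ) (b : A) : ℝ :=
  b.1 ⬝ᵥ θ + ε b

/-- The one-round regret against `x`, minus its estimate, plus the stability term
`2 η aᵀ Σ(p)⁻¹ a` of the FTRL analysis. -/
noncomputable def roundDeviation (η : ℝ) (x θ : Fin d → ℝ) (p : A → ℝ) (a : A) (r : ℝ) : ℝ :=
  (x - a.1) ⬝ᵥ θ + 2 * η * (a.1 ⬝ᵥ ((secondMoment p)⁻¹ *ᵥ a.1))
    - (x - mean p) ⬝ᵥ estimator p a r

/-- The part of `roundDeviation` that does not involve the observed reward. -/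
noncomputable def actionPart (η : ℝ) (x θ : Fin d → ℝ) (p : A → ℝ) (a : A) : ℝ :=
  (x - a.1) ⬝ᵥ θ + 2 * η * (a.1 ⬝ᵥ ((secondMoment p)⁻¹ *ᵥ a.1))

/-- The coefficient of the observed reward in `roundDeviation`. -/
noncomputable def rewardPart (x : Fin d → ℝ) (p : A → ℝ) (a : A) : ℝ :=
  -((x - mean p) ⬝ᵥ ((secondMoment p)⁻¹ *ᵥ a.1))

theorem roundDeviation_eq (η : ℝ) (x θ : Fin d → ℝ) (p : A → ℝ) (a : A) (r : ℝ) :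
    roundDeviation η x θ p a r = actionPart η x θ p a + r * rewardPart x p a := by
  rw [roundDeviation, actionPart, rewardPart, estimator, dotProduct_smul, smul_eq_mul, mul_neg,
    sub_eq_add_neg]

theorem compensator_smul {ι : Type*} [Fintype ι] (l : ℝ) (R p g h : ι → ℝ) :
    compensator R p (l • g) (l • h) = l * ∑ x, p x * (g x + R x * h x)
      + l ^ 2 * (2 * ∑ x, p x * g x ^ 2 + 2 * ∑ x, p x * h x ^ 2) := by
  simp only [compensator, Pi.smul_apply, smul_eq_mul, Finset.mul_sum, ← Finset.sum_add_distrib]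
  exact Finset.sum_congr rfl fun x _ => by ring

theorem abs_mean_dotProduct_le {q : A → ℝ} (hq : q ∈ stdSimplex ℝ A) {θ : Fin d → ℝ}
    (hθ : ∀ b : A, |b.1 ⬝ᵥ θ| ≤ 1) : |mean q ⬝ᵥ θ| ≤ 1 :=
  calc |mean q ⬝ᵥ θ| ≤ ∑ b : A, |q b * (b.1 ⬝ᵥ θ)| := by
        rw [mean_dotProduct]
        exact Finset.abs_sum_le_sum_abs _ _
    _ ≤ ∑ b, q b := Finset.sum_le_sum fun b _ => by
        rw [abs_mul, abs_of_nonneg (hq.1 b)]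
        exact mul_le_of_le_one_right (hq.1 b) (hθ b)
    _ = 1 := hq.2

theorem abs_sub_dotProduct_le {θ : Fin d → ℝ} (hθ : ∀ b : A, |b.1 ⬝ᵥ θ| ≤ 1) (x a : A) :
    |(x.1 - a.1) ⬝ᵥ θ| ≤ 2 := by
  rw [sub_dotProduct]
  exact (abs_sub _ _).trans (by linarith [hθ x, hθ a])

theorem sum_mul_abs_le_of_sum_mul_sq_le {ι : Type*} [Fintype ι] {p k : ι → ℝ}
    (hp : p ∈ stdSimplex ℝ ι) {s : ℝ} (hs : 0 ≤ s) (h : ∑ x, p x * k x ^ 2 ≤ s ^ 2) :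
    ∑ x, p x * |k x| ≤ s := by
  have jensen := (even_two.convexOn_pow (𝕜 := ℝ)).map_sum_le (t := Finset.univ) (w := p)
    (p := fun x => |k x|) (fun x _ => hp.1 x) hp.2 fun x _ => Set.mem_univ _
  simp only [smul_eq_mul, sq_abs] at jensen
  exact le_of_sq_le_sq (jensen.trans h) hs

namespace IsSpread

variable {β : ℝ} {p : A → ℝ}

theorem quad_inv_sub_mean_le (hp : IsSpread β p) (x : Fin d → ℝ) :
    (x - mean p) ⬝ᵥ ((secondMoment p)⁻¹ *ᵥ (x - mean p))
      ≤ 2 * (x ⬝ᵥ ((secondMoment p)⁻¹ *ᵥ x)) + 2 := by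
  have := quad_add_le hp.secondMoment_posDef.inv.posSemidef x (-mean p)
  rw [← sub_eq_add_neg, Matrix.mulVec_neg, neg_dotProduct_neg] at this
  linarith [hp.quad_inv_mean_le]

theorem abs_actionPart_le (hp : IsSpread β p) {η : ℝ} (hη₀ : 0 ≤ η) (hη₁ : η ≤ 1)
    {θ : Fin d → ℝ} (hθ : ∀ b : A, |b.1 ⬝ᵥ θ| ≤ 1) (x a : A) :
    |actionPart η x.1 θ p a| ≤ 2 + 2 * β := by
  have quad_nonneg := quad_nonneg hp.secondMoment_posDef.inv.posSemidef a.1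
  refine (abs_add_le _ _).trans (add_le_add (abs_sub_dotProduct_le hθ x a) ?_)
  rw [abs_of_nonneg (by positivity)]
  nlinarith [hp.quad_inv_action_le a]

theorem abs_rewardPart_le (hp : IsSpread β p) (x a : A) : |rewardPart x.1 p a| ≤ 2 * β := by
  have hS := hp.secondMoment_posDef.inv.posSemidef
  have one_le := hp.one_le a
  rw [rewardPart, abs_neg]
  refine abs_le_of_sq_le_sq ?_ (by linarith)
  calc ((x.1 - mean p) ⬝ᵥ ((secondMoment p)⁻¹ *ᵥ a.1)) ^ 2
      ≤ ((x.1 - mean p) ⬝ᵥ ((secondMoment p)⁻¹ *ᵥ (x.1 - mean p)))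
          * (a.1 ⬝ᵥ ((secondMoment p)⁻¹ *ᵥ a.1)) := sq_dotProduct_mulVec_le hS _ _
    _ ≤ (2 * β + 2) * β := by
        refine mul_le_mul ?_ (hp.quad_inv_action_le a) (quad_nonneg hS _) (by linarith)
        linarith [hp.quad_inv_sub_mean_le x.1, hp.quad_inv_action_le x]
    _ ≤ (2 * β) ^ 2 := by nlinarith

theorem sum_mul_actionPart_add_le (hp : IsSpread β p) {θ : Fin d → ℝ} {ε : A → ℝ} {e s : ℝ}
    (hε : ∀ b, |ε b| ≤ e) (he : 0 ≤ e) (η : ℝ) (x : Fin d → ℝ) (hs : 0 ≤ s)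
    (hxs : 2 * (x ⬝ᵥ ((secondMoment p)⁻¹ *ᵥ x)) + 2 ≤ s ^ 2) :
    ∑ b, p b * (actionPart η x θ p b + meanReward θ ε b * rewardPart x p b)
      ≤ 2 * η * d + e * s := by
  set k : A → ℝ := fun b => (x - mean p) ⬝ᵥ ((secondMoment p)⁻¹ *ᵥ b.1) with hk
  have sum_dist := hp.mem.2
  have sum_sub : ∑ b : A, p b * ((x - b.1) ⬝ᵥ θ) = (x - mean p) ⬝ᵥ θ := by
    simp only [sub_dotProduct, mul_sub, Finset.sum_sub_distrib, mean_dotProduct, ← Finset.sum_mul,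
      sum_dist, one_mul]
  have sum_abs_k_le : ∑ b, p b * |k b| ≤ s := by
    refine sum_mul_abs_le_of_sum_mul_sq_le hp.mem hs ?_
    exact (hp.sum_mul_sq_dotProduct_inv _).trans_le ((hp.quad_inv_sub_mean_le x).trans hxs)
  have misspecification_le : ∑ b, p b * -(k b * ε b) ≤ e * s :=
    calc ∑ b, p b * -(k b * ε b) ≤ ∑ b, p b * (e * |k b|) := by
          refine Finset.sum_le_sum fun b _ => mul_le_mul_of_nonneg_left ?_ (hp.mem.1 b)
          refine (neg_le_abs _).trans ?_
          rw [abs_mul, mul_comm]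
          exact mul_le_mul_of_nonneg_right (hε b) (abs_nonneg _)
      _ = e * ∑ b, p b * |k b| := by
          rw [Finset.mul_sum]
          exact Finset.sum_congr rfl fun b _ => by ring
      _ ≤ e * s := mul_le_mul_of_nonneg_left sum_abs_k_le he
  calc ∑ b, p b * (actionPart η x θ p b + meanReward θ ε b * rewardPart x p b)
      = ∑ b : A, p b * ((x - b.1) ⬝ᵥ θ)
          + 2 * η * ∑ b : A, p b * (b.1 ⬝ᵥ ((secondMoment p)⁻¹ *ᵥ b.1))
          - ∑ b : A, p b * (k b * (b.1 ⬝ᵥ θ)) + ∑ b, p b * -(k b * ε b) := by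
        simp only [Finset.mul_sum, ← Finset.sum_add_distrib, ← Finset.sum_sub_distrib]
        refine Finset.sum_congr rfl fun b _ => ?_
        simp only [actionPart, rewardPart, meanReward, hk]
        ring
    _ = 2 * η * d + ∑ b, p b * -(k b * ε b) := by
        rw [sum_sub, hp.sum_quad_inv_action, hp.sum_mul_dotProduct_inv]
        ring
    _ ≤ 2 * η * d + e * s := by gcongr

theorem sum_mul_sq_actionPart_le (hp : IsSpread β p) {η : ℝ} (hηβ : η ^ 2 * β ≤ 2)
    {θ : Fin d → ℝ} (hθ : ∀ b : A, |b.1 ⬝ᵥ θ| ≤ 1) (x : A) :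
    ∑ b, p b * actionPart η x.1 θ p b ^ 2 ≤ 8 + 16 * d := by
  have sq_actionPart_le : ∀ b : A, actionPart η x.1 θ p b ^ 2
      ≤ 8 + 16 * (b.1 ⬝ᵥ ((secondMoment p)⁻¹ *ᵥ b.1)) := by
    intro b
    rw [actionPart]
    set u := (x.1 - b.1) ⬝ᵥ θ
    set q := b.1 ⬝ᵥ ((secondMoment p)⁻¹ *ᵥ b.1)
    have sq_u_le : u ^ 2 ≤ 4 := by
      have := sq_le_sq' (by linarith [abs_le.1 (abs_sub_dotProduct_le hθ x b)])
        (abs_le.1 (abs_sub_dotProduct_le hθ x b)).2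
      linarith
    have sq_mul_le : η ^ 2 * q ^ 2 ≤ 2 * q := by
      have q_nonneg : 0 ≤ q := quad_nonneg hp.secondMoment_posDef.inv.posSemidef b.1
      have := mul_le_mul_of_nonneg_left (hp.quad_inv_action_le b) (sq_nonneg η)
      calc η ^ 2 * q ^ 2 = η ^ 2 * q * q := by ring
        _ ≤ 2 * q := mul_le_mul_of_nonneg_right (this.trans hηβ) q_nonneg
    linarith [sq_nonneg (u - 2 * η * q)]
  calc ∑ b, p b * actionPart η x.1 θ p b ^ 2
      ≤ ∑ b : A, p b * (8 + 16 * (b.1 ⬝ᵥ ((secondMoment p)⁻¹ *ᵥ b.1))) :=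
        Finset.sum_le_sum fun b _ => mul_le_mul_of_nonneg_left (sq_actionPart_le b) (hp.mem.1 b)
    _ = (∑ b, p b) * 8 + 16 * ∑ b : A, p b * (b.1 ⬝ᵥ ((secondMoment p)⁻¹ *ᵥ b.1)) := by
        rw [Finset.sum_mul, Finset.mul_sum, ← Finset.sum_add_distrib]
        exact Finset.sum_congr rfl fun b _ => by ring
    _ = 8 + 16 * d := by rw [hp.mem.2, hp.sum_quad_inv_action, one_mul]

theorem sum_mul_sq_rewardPart_le (hp : IsSpread β p) (x : Fin d → ℝ) :
    ∑ b, p b * rewardPart x p b ^ 2 ≤ 2 * (x ⬝ᵥ ((secondMoment p)⁻¹ *ᵥ x)) + 2 := by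
  simp only [rewardPart, neg_sq, hp.sum_mul_sq_dotProduct_inv]
  exact hp.quad_inv_sub_mean_le x

theorem compensator_le (hp : IsSpread β p) (hd : 1 ≤ d) {l η e s : ℝ} (hl : 0 ≤ l)
    (hηβ : η ^ 2 * β ≤ 2) {θ : Fin d → ℝ} (hθ : ∀ b : A, |b.1 ⬝ᵥ θ| ≤ 1) {ε : A → ℝ}
    (he : 0 ≤ e) (hε : ∀ b, |ε b| ≤ e) (x : A) (hs : 0 ≤ s)
    (hxs : 2 * (x.1 ⬝ᵥ ((secondMoment p)⁻¹ *ᵥ x.1)) + 2 ≤ s ^ 2) :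
    compensator (meanReward θ ε) p (l • actionPart η x.1 θ p) (l • rewardPart x.1 p)
      ≤ l * (2 * η * d + e * s) + l ^ 2 * (52 * d + 2 * s ^ 2) := by
  have one_le_d : (1 : ℝ) ≤ d := by exact_mod_cast hd
  rw [compensator_smul]
  refine add_le_add (mul_le_mul_of_nonneg_left
    (hp.sum_mul_actionPart_add_le hε he η x.1 hs hxs) hl) ?_
  refine mul_le_mul_of_nonneg_left ?_ (sq_nonneg l)
  linarith [hp.sum_mul_sq_actionPart_le hηβ hθ x, hp.sum_mul_sq_rewardPart_le x.1]

theorem abs_dotProduct_le_of_quad_inv_le (hp : IsSpread β p) {v θ : Fin d → ℝ} {c : ℝ}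
    (hc : 0 ≤ c) (hv : v ⬝ᵥ ((secondMoment p)⁻¹ *ᵥ v) ≤ c ^ 2) (hθ : ∀ b : A, |b.1 ⬝ᵥ θ| ≤ 1) :
    |v ⬝ᵥ θ| ≤ c := by
  have hS := hp.secondMoment_posDef
  have quad_le_one : θ ⬝ᵥ (secondMoment p *ᵥ θ) ≤ 1 := by
    rw [quad_secondMoment, ← hp.mem.2]
    refine Finset.sum_le_sum fun b _ => mul_le_of_le_one_right (hp.mem.1 b) ?_
    rw [dotProduct_comm θ]
    exact (sq_le_one_iff_abs_le_one _).2 (hθ b)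
  refine abs_le_of_sq_le_sq ((sq_dotProduct_le hS v θ).trans ?_) hc
  exact (mul_le_of_le_one_right (quad_nonneg hS.inv.posSemidef v) quad_le_one).trans hv

theorem abs_dotProduct_estimator_le_of_quad_inv_le (hp : IsSpread β p) {v : Fin d → ℝ} {c : ℝ}
    (hc : 0 ≤ c) (hv : v ⬝ᵥ ((secondMoment p)⁻¹ *ᵥ v) ≤ c ^ 2) (a : A) {r : ℝ} (hr : |r| ≤ 1) :
    |v ⬝ᵥ estimator p a r| ≤ c * β := by
  have hS := hp.secondMoment_posDef.inv.posSemidef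
  have one_le := hp.one_le a
  rw [estimator, dotProduct_smul, smul_eq_mul, abs_mul]
  refine (mul_le_of_le_one_left (abs_nonneg _) hr).trans ?_
  refine abs_le_of_sq_le_sq ?_ (by positivity)
  calc (v ⬝ᵥ ((secondMoment p)⁻¹ *ᵥ a.1)) ^ 2
      ≤ (v ⬝ᵥ ((secondMoment p)⁻¹ *ᵥ v)) * (a.1 ⬝ᵥ ((secondMoment p)⁻¹ *ᵥ a.1)) :=
        sq_dotProduct_mulVec_le hS v a.1
    _ ≤ c ^ 2 * β := mul_le_mul hv (hp.quad_inv_action_le a) (quad_nonneg hS _) (sq_nonneg c)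
    _ ≤ c ^ 2 * β ^ 2 := mul_le_mul_of_nonneg_left (by nlinarith) (sq_nonneg c)
    _ = (c * β) ^ 2 := by ring

end IsSpread

end Deviation

/-! ### Predictability -/

section Predictability

variable {d : ℕ} {A : Finset (Fin d → ℝ)}

theorem measurable_dotProduct {Ω n : Type*} [Fintype n] {_ : MeasurableSpace Ω} {f g : Ω → n → ℝ}
    (hf : Measurable f) (hg : Measurable g) : Measurable fun ω => f ω ⬝ᵥ g ω := by
  unfold dotProduct
  fun_prop

theorem measurable_mean : Measurable (mean : (A → ℝ) → Fin d → ℝ) := by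
  have : Continuous (mean : (A → ℝ) → Fin d → ℝ) := by
    unfold mean
    fun_prop
  exact this.measurable

theorem measurable_inv_secondMoment_mulVec (v : Fin d → ℝ) :
    Measurable fun p : A → ℝ => (secondMoment p)⁻¹ *ᵥ v := by
  have continuous_secondMoment : Continuous fun p : A → ℝ => secondMoment p := by
    unfold secondMoment
    fun_prop
  have continuous_adjugate_mulVec : Continuous fun p : A → ℝ => (secondMoment p).adjugate *ᵥ v :=
    continuous_secondMoment.matrix_adjugate.matrix_mulVec continuous_const
  simp only [Matrix.inv_def, Ring.inverse_eq_inv', Matrix.smul_mulVec]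
  exact continuous_secondMoment.matrix_det.measurable.inv.smul continuous_adjugate_mulVec.measurable

theorem measurable_actionPart {Ω : Type*} {_ : MeasurableSpace Ω} {θ : Ω → Fin d → ℝ}
    {p : Ω → A → ℝ} (hθ : Measurable θ) (hp : Measurable p) (η : ℝ) (x : Fin d → ℝ) :
    Measurable fun ω => actionPart η x (θ ω) (p ω) := by
  refine measurable_pi_lambda _ fun b => ?_
  exact (measurable_dotProduct measurable_const hθ).add ((measurable_dotProduct measurable_const
    ((measurable_inv_secondMoment_mulVec b.1).comp hp)).const_mul _)

theorem measurable_rewardPart (x : Fin d → ℝ) : Measurable fun p : A → ℝ => rewardPart x p :=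
  measurable_pi_lambda _ fun b => (measurable_dotProduct (measurable_const.sub measurable_mean)
    (measurable_inv_secondMoment_mulVec b.1)).neg

namespace IsMisspecifiedBandit

variable {Ω : Type*} [mΩ : MeasurableSpace Ω] {P : Measure Ω} {ℱ : Filtration ℕ mΩ} {T : ℕ}
  {C : ℝ} {θ : ℕ → Ω → Fin d → ℝ} {ε p : ℕ → Ω → A → ℝ} {a : ℕ → Ω → A} {r : ℕ → Ω → ℝ}

theorem abs_dotProduct_theta_le (hb : IsMisspecifiedBandit P ℱ T C θ ε p a r) {t : ℕ}
    (ht : t ∈ Finset.Icc 1 T) (ω : Ω) (x : A) : |x.1 ⬝ᵥ θ t ω| ≤ 1 :=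
  hb.abs_inner_le t ht ω x.1 x.2

theorem abs_eps_le (hb : IsMisspecifiedBandit P ℱ T C θ ε p a r) {t : ℕ}
    (ht : t ∈ Finset.Icc 1 T) (ω : Ω) (x : A) : |ε t ω x| ≤ C :=
  calc |ε t ω x| ≤ ⨆ y : A, |ε t ω y| :=
        le_ciSup (f := fun y : A => |ε t ω y|) (Set.finite_range _).bddAbove x
    _ ≤ ∑ s ∈ Finset.Icc 1 T, ⨆ y : A, |ε s ω y| :=
        Finset.single_le_sum (f := fun s => ⨆ y : A, |ε s ω y|)
          (fun _ _ => Real.iSup_nonneg fun _ => abs_nonneg _) ht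
    _ ≤ C := hb.misspecification_le ω

theorem isFiniteBandit (hb : IsMisspecifiedBandit P ℱ T C θ ε p a r)
    (hp : ∀ t ∈ Finset.Icc 1 T, ∀ ω, p t ω ∈ stdSimplex ℝ A) :
    IsFiniteBandit P ℱ T (1 + C) (fun t ω => meanReward (θ t ω) (ε t ω)) p a r where
  measurable_mean t ht := @measurable_pi_lambda _ _ _ (_) _ _ fun x =>
    (measurable_dotProduct measurable_const (hb.measurable_theta t ht)).add
      ((measurable_pi_apply x).comp (hb.measurable_eps t ht))
  measurable_dist := hb.measurable_dist
  measurable_action := hb.measurable_action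
  measurable_reward := hb.measurable_reward
  dist_mem := hp
  abs_mean_le _ ht ω x := (abs_add_le _ _).trans
    (add_le_add (hb.abs_dotProduct_theta_le ht ω x) (hb.abs_eps_le ht ω x))
  abs_reward_le := hb.abs_reward_le
  action_law := hb.action_law
  reward_mean := hb.reward_mean

theorem isPredictablePair (hb : IsMisspecifiedBandit P ℱ T C θ ε p a r) {β l η : ℝ}
    (hp : ∀ t ∈ Finset.Icc 1 T, ∀ ω, IsSpread β (p t ω)) (hl : 0 ≤ l)
    (hlβ : 8 * β * l ≤ 1) (hβ : 2 ≤ β) (hη₀ : 0 ≤ η) (hη₁ : η ≤ 1) (x : A) :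
    IsPredictablePair ℱ T (fun t ω => l • actionPart η x.1 (θ t ω) (p t ω))
      (fun t ω => l • rewardPart x.1 (p t ω)) where
  measurable_fst t ht := (measurable_actionPart (hb.measurable_theta t ht)
    (hb.measurable_dist t ht) η x.1).const_smul l
  measurable_snd t ht :=
    ((measurable_rewardPart x.1).comp (hb.measurable_dist t ht)).const_smul l
  abs_add_abs_le t ht ω b := by
    simp only [Pi.smul_apply, smul_eq_mul, abs_mul, abs_of_nonneg hl, ← mul_add]
    have abs_action_le :=
      (hp t ht ω).abs_actionPart_le hη₀ hη₁ (hb.abs_dotProduct_theta_le ht ω) x b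
    have abs_reward_le := (hp t ht ω).abs_rewardPart_le x b
    calc _ ≤ l * (8 * β) := mul_le_mul_of_nonneg_left (by linarith) hl
      _ ≤ 1 := by linarith

end IsMisspecifiedBandit

end Predictability

/-! ### The cumulative deviation on the good event -/

section Pathwise

variable {d : ℕ} {A : Finset (Fin d → ℝ)} {T : ℕ} {β η C : ℝ}
  {θ : ℕ → Fin d → ℝ} {ε p : ℕ → A → ℝ} {a : ℕ → A} {r : ℕ → ℝ}

theorem compensatedSum_smul_parts (R : ℕ → A → ℝ) (l η : ℝ) (x : Fin d → ℝ) (n : ℕ) :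
    compensatedSum R p (fun t => l • actionPart η x (θ t) (p t))
        (fun t => l • rewardPart x (p t)) a r n
      = l * ∑ t ∈ Finset.Icc 1 n, roundDeviation η x (θ t) (p t) (a t) (r t)
        - ∑ t ∈ Finset.Icc 1 n, compensator (R t) (p t) (l • actionPart η x (θ t) (p t))
          (l • rewardPart x (p t)) := by
  rw [compensatedSum, Finset.sum_sub_distrib, Finset.mul_sum]
  congr 1
  refine Finset.sum_congr rfl fun t _ => ?_
  simp only [roundDeviation_eq, Pi.smul_apply, smul_eq_mul]
  ring

theorem sum_compensator_le (hd : 1 ≤ d) (hηβ : η ^ 2 * β ≤ 2)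
    (hp : ∀ t ∈ Finset.Icc 1 T, IsSpread β (p t))
    (hθ : ∀ t ∈ Finset.Icc 1 T, ∀ b : A, |b.1 ⬝ᵥ θ t| ≤ 1) {e : ℕ → ℝ}
    (hε : ∀ t ∈ Finset.Icc 1 T, ∀ b, |ε t b| ≤ e t) (he : ∑ t ∈ Finset.Icc 1 T, e t ≤ C)
    {l : ℝ} (hl : 0 ≤ l) {x : A} {s : ℝ} (hs : 0 ≤ s)
    (hxs : ∀ t ∈ Finset.Icc 1 T, 2 * (x.1 ⬝ᵥ ((secondMoment (p t))⁻¹ *ᵥ x.1)) + 2 ≤ s ^ 2) :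
    ∑ t ∈ Finset.Icc 1 T, compensator (meanReward (θ t) (ε t)) (p t)
        (l • actionPart η x.1 (θ t) (p t)) (l • rewardPart x.1 (p t))
      ≤ l * (2 * η * d * T + C * s + l * ((52 * d + 2 * s ^ 2) * T)) :=
  calc ∑ t ∈ Finset.Icc 1 T, compensator (meanReward (θ t) (ε t)) (p t)
        (l • actionPart η x.1 (θ t) (p t)) (l • rewardPart x.1 (p t))
      ≤ ∑ t ∈ Finset.Icc 1 T,
          (l * (2 * η * d + e t * s) + l ^ 2 * (52 * d + 2 * s ^ 2)) :=
        Finset.sum_le_sum fun t ht => (hp t ht).compensator_le hd hl hηβ (hθ t ht)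
          ((abs_nonneg _).trans (hε t ht x)) (hε t ht) x hs (hxs t ht)
    _ = l * (2 * η * d * T + (∑ t ∈ Finset.Icc 1 T, e t) * s
          + l * ((52 * d + 2 * s ^ 2) * T)) := by
        simp only [Finset.sum_add_distrib, ← Finset.mul_sum, ← Finset.sum_mul, Finset.sum_const,
          Nat.card_Icc, Nat.add_sub_cancel, nsmul_eq_mul]
        ring
    _ ≤ l * (2 * η * d * T + C * s + l * ((52 * d + 2 * s ^ 2) * T)) := by gcongr

theorem sum_roundDeviation_le_of_compensatedSum_le (hd : 1 ≤ d) (hηβ : η ^ 2 * β ≤ 2)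
    (hp : ∀ t ∈ Finset.Icc 1 T, IsSpread β (p t))
    (hθ : ∀ t ∈ Finset.Icc 1 T, ∀ b : A, |b.1 ⬝ᵥ θ t| ≤ 1) {e : ℕ → ℝ}
    (hε : ∀ t ∈ Finset.Icc 1 T, ∀ b, |ε t b| ≤ e t) (he : ∑ t ∈ Finset.Icc 1 T, e t ≤ C)
    {l : ℝ} (hl : 0 < l) {x : A} {s : ℝ} (hs : 0 ≤ s)
    (hxs : ∀ t ∈ Finset.Icc 1 T, 2 * (x.1 ⬝ᵥ ((secondMoment (p t))⁻¹ *ᵥ x.1)) + 2 ≤ s ^ 2)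
    {L : ℝ} (hL : compensatedSum (fun t => meanReward (θ t) (ε t)) p
      (fun t => l • actionPart η x.1 (θ t) (p t)) (fun t => l • rewardPart x.1 (p t)) a r T ≤ L) :
    ∑ t ∈ Finset.Icc 1 T, roundDeviation η x.1 (θ t) (p t) (a t) (r t)
      ≤ L / l + (2 * η * d * T + C * s + l * ((52 * d + 2 * s ^ 2) * T)) := by
  rw [compensatedSum_smul_parts, sub_le_iff_le_add] at hL
  refine le_of_mul_le_mul_left ?_ hl
  rw [mul_add, mul_div_cancel₀ _ hl.ne']
  exact hL.trans
    (add_le_add_right (sum_compensator_le hd hηβ hp hθ hε he hl.le hs hxs) L)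

theorem sum_roundDeviation_le_add {c : ℝ} (hc : 0 ≤ c)
    (hp : ∀ t ∈ Finset.Icc 1 T, IsSpread β (p t))
    (hθ : ∀ t ∈ Finset.Icc 1 T, ∀ b : A, |b.1 ⬝ᵥ θ t| ≤ 1)
    (hr : ∀ t ∈ Finset.Icc 1 T, |r t| ≤ 1) {x y : Fin d → ℝ}
    (hxy : ∀ t ∈ Finset.Icc 1 T, (x - y) ⬝ᵥ ((secondMoment (p t))⁻¹ *ᵥ (x - y)) ≤ c ^ 2) :
    ∑ t ∈ Finset.Icc 1 T, roundDeviation η x (θ t) (p t) (a t) (r t)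
      ≤ ∑ t ∈ Finset.Icc 1 T, roundDeviation η y (θ t) (p t) (a t) (r t)
        + T * (c * (1 + β)) := by
  have round_le : ∀ t ∈ Finset.Icc 1 T, roundDeviation η x (θ t) (p t) (a t) (r t)
      ≤ roundDeviation η y (θ t) (p t) (a t) (r t) + c * (1 + β) := by
    intro t ht
    have gain_le := (abs_le.1
      ((hp t ht).abs_dotProduct_le_of_quad_inv_le hc (hxy t ht) (hθ t ht))).2
    have estimate_ge := (abs_le.1
      ((hp t ht).abs_dotProduct_estimator_le_of_quad_inv_le hc (hxy t ht) (a t) (hr t ht))).1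
    rw [sub_dotProduct] at gain_le estimate_ge
    simp only [roundDeviation, sub_dotProduct]
    linarith
  refine (Finset.sum_le_sum round_le).trans_eq ?_
  rw [Finset.sum_add_distrib, Finset.sum_const, Nat.card_Icc, Nat.add_sub_cancel, nsmul_eq_mul]

theorem IsSpread.quad_inv_le_of_near {p : A → ℝ} (hp : IsSpread β p)
    {B : Matrix (Fin d) (Fin d) ℝ} (hB : (secondMoment p)⁻¹ ≤ B) {x y : Fin d → ℝ} {c : ℝ}
    (hxy : (x - y) ⬝ᵥ ((secondMoment p)⁻¹ *ᵥ (x - y)) ≤ c) :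
    y ⬝ᵥ ((secondMoment p)⁻¹ *ᵥ y) ≤ 2 * (x ⬝ᵥ (B *ᵥ x)) + 2 * c := by
  have quad_le := quad_add_le hp.secondMoment_posDef.inv.posSemidef x (-(x - y))
  rw [Matrix.mulVec_neg, neg_dotProduct_neg, ← sub_eq_add_neg, sub_sub_cancel] at quad_le
  linarith [quad_le_quad hB x]

theorem mul_le_mul_sq_add_sq_div {α : ℝ} (hα : 0 < α) (u v : ℝ) :
    u * v ≤ α / 16 * v ^ 2 + 4 * u ^ 2 / α := by
  have sq_eq : α / 16 * v ^ 2 + 4 * u ^ 2 / α - u * v = (α * v - 8 * u) ^ 2 / (16 * α) := by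
    field_simp
    ring
  have : 0 ≤ (α * v - 8 * u) ^ 2 / (16 * α) := by positivity
  linarith

theorem second_order_term_le (hd : 1 ≤ d) (hβ : 0 < β) {α X : ℝ} (hTα : T / β ≤ α / 2)
    (hX : 0 ≤ X) : 1 / (8 * β) * ((52 * d + 2 * (4 * X + 6)) * T)
      ≤ 7 * d * (T / β) + α / 2 * X + T / β := by
  have one_le_d : (1 : ℝ) ≤ d := by exact_mod_cast hd
  have T_div_nonneg : 0 ≤ T / β := by positivity
  calc 1 / (8 * β) * ((52 * d + 2 * (4 * X + 6)) * T)
      = (13 / 2 * d + 3 / 2) * (T / β) + T / β * X := by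
        field_simp
        ring
    _ ≤ (7 * d + 1) * (T / β) + α / 2 * X :=
        add_le_add (mul_le_mul_of_nonneg_right (by linarith) T_div_nonneg)
          (mul_le_mul_of_nonneg_right hTα hX)
    _ = 7 * d * (T / β) + α / 2 * X + T / β := by ring

theorem sum_roundDeviation_le (hd : 1 ≤ d) (hT : 1 ≤ T) (hβ : 0 < β) (hηβ : η ^ 2 * β ≤ 2)
    {α : ℝ} (hα : 0 < α) (hTα : T / β ≤ α / 2) (hp : ∀ t ∈ Finset.Icc 1 T, IsSpread β (p t))
    (hθ : ∀ t ∈ Finset.Icc 1 T, ∀ b : A, |b.1 ⬝ᵥ θ t| ≤ 1)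
    (hr : ∀ t ∈ Finset.Icc 1 T, |r t| ≤ 1) {e : ℕ → ℝ}
    (hε : ∀ t ∈ Finset.Icc 1 T, ∀ b, |ε t b| ≤ e t) (he : ∑ t ∈ Finset.Icc 1 T, e t ≤ C)
    {x y : A} (hxy : ∀ t ∈ Finset.Icc 1 T,
      (x.1 - y.1) ⬝ᵥ ((secondMoment (p t))⁻¹ *ᵥ (x.1 - y.1)) ≤ (1 / (T : ℝ)) ^ 2)
    {L : ℝ} (hy : compensatedSum (fun t => meanReward (θ t) (ε t)) p
      (fun t => (1 / (8 * β)) • actionPart η y.1 (θ t) (p t))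
      (fun t => (1 / (8 * β)) • rewardPart y.1 (p t)) a r T ≤ L) :
    ∑ t ∈ Finset.Icc 1 T, roundDeviation η x.1 (θ t) (p t) (a t) (r t)
      ≤ 3 / 4 * α * (x.1 ⬝ᵥ (bonusSeq p T *ᵥ x.1))
        + (8 * β * L + 2 * η * d * T + 7 * d * (T / β) + 3 / 8 * α + 4 * C ^ 2 / α + T / β
          + 1 + β) := by
  have one_le_T : (1 : ℝ) ≤ T := by exact_mod_cast hT
  set X := x.1 ⬝ᵥ (bonusSeq p T *ᵥ x.1)
  have X_nonneg : 0 ≤ X := quad_nonneg (bonusSeq_posSemidef hp) x.1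
  obtain ⟨s, s_nonneg, s_sq⟩ : ∃ s : ℝ, 0 ≤ s ∧ s ^ 2 = 4 * X + 6 :=
    ⟨√(4 * X + 6), Real.sqrt_nonneg _, Real.sq_sqrt (by linarith)⟩
  have net_error_le : (1 / (T : ℝ)) ^ 2 ≤ 1 :=
    pow_le_one₀ (by positivity) ((div_le_one (by linarith)).2 one_le_T)
  have y_quad_le : ∀ t ∈ Finset.Icc 1 T,
      2 * (y.1 ⬝ᵥ ((secondMoment (p t))⁻¹ *ᵥ y.1)) + 2 ≤ s ^ 2 := by
    intro t ht
    linarith [(hp t ht).quad_inv_le_of_near (inv_secondMoment_le_bonusSeq hp ht)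
      ((hxy t ht).trans net_error_le)]
  have y_deviation_le := sum_roundDeviation_le_of_compensatedSum_le hd hηβ hp hθ hε he
    (by positivity) s_nonneg y_quad_le hy
  have transfer : ∑ t ∈ Finset.Icc 1 T, roundDeviation η x.1 (θ t) (p t) (a t) (r t)
      ≤ ∑ t ∈ Finset.Icc 1 T, roundDeviation η y.1 (θ t) (p t) (a t) (r t) + (1 + β) := by
    have := sum_roundDeviation_le_add (η := η) (a := a) (by positivity) hp hθ hr hxy
    rwa [← mul_assoc, mul_one_div_cancel (by positivity), one_mul] at this
  have second_order_le := second_order_term_le hd hβ hTα X_nonneg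
  rw [← s_sq] at second_order_le
  have misspecification_le := mul_le_mul_sq_add_sq_div hα C s
  rw [s_sq] at misspecification_le
  linarith

theorem sum_mul_sum_roundDeviation {q : A → ℝ} (hq : ∑ x, q x = 1) :
    ∑ x : A, q x * ∑ t ∈ Finset.Icc 1 T, roundDeviation η x.1 (θ t) (p t) (a t) (r t)
      = ∑ t ∈ Finset.Icc 1 T, roundDeviation η (mean q) (θ t) (p t) (a t) (r t) := by
  simp only [Finset.mul_sum]
  rw [Finset.sum_comm]
  refine Finset.sum_congr rfl fun t _ => ?_
  simp only [roundDeviation, sub_dotProduct, mul_add, mul_sub, Finset.sum_add_distrib,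
    Finset.sum_sub_distrib, ← Finset.sum_mul, hq, one_mul, mean_dotProduct q]

theorem EstimatedRegretBound.regret_le {q : A → ℝ} {α E : ℝ}
    (hest : EstimatedRegretBound T α β η p a r q) (hq : q ∈ stdSimplex ℝ A) (hT : 1 ≤ T)
    (hα : 0 ≤ α) (hβ : 0 < β) (hp : ∀ t ∈ Finset.Icc 1 T, IsSpread β (p t))
    (hdev : ∀ x : A, ∑ t ∈ Finset.Icc 1 T, roundDeviation η x.1 (θ t) (p t) (a t) (r t)
      ≤ 3 / 4 * α * (x.1 ⬝ᵥ (bonusSeq p T *ᵥ x.1)) + E) :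
    regret T θ a q ≤ E + (d + 1) * Real.log β / η + 2 * α * (d + d * Real.log (T * β)) := by
  have trace_eq : (secondMoment q * bonusSeq p T).trace
      = ∑ x : A, q x * (x.1 ⬝ᵥ (bonusSeq p T *ᵥ x.1)) :=
    trace_sum_smul_vecMulVec_mul q _ _
  have trace_nonneg : 0 ≤ (secondMoment q * bonusSeq p T).trace :=
    trace_eq ▸ Finset.sum_nonneg fun x _ => mul_nonneg (hq.1 x)
      (quad_nonneg (bonusSeq_posSemidef hp) x.1)
  have deviation_le : ∑ t ∈ Finset.Icc 1 T, roundDeviation η (mean q) (θ t) (p t) (a t) (r t)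
      ≤ 3 / 4 * α * (secondMoment q * bonusSeq p T).trace + E :=
    calc ∑ t ∈ Finset.Icc 1 T, roundDeviation η (mean q) (θ t) (p t) (a t) (r t)
        ≤ ∑ x : A, q x * (3 / 4 * α * (x.1 ⬝ᵥ (bonusSeq p T *ᵥ x.1)) + E) := by
          rw [← sum_mul_sum_roundDeviation hq.2]
          exact Finset.sum_le_sum fun x _ => mul_le_mul_of_nonneg_left (hdev x) (hq.1 x)
      _ = 3 / 4 * α * (secondMoment q * bonusSeq p T).trace + (∑ x, q x) * E := by
          rw [trace_eq, Finset.mul_sum, Finset.sum_mul, ← Finset.sum_add_distrib]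
          exact Finset.sum_congr rfl fun x _ => by ring
      _ = 3 / 4 * α * (secondMoment q * bonusSeq p T).trace + E := by rw [hq.2, one_mul]
  have growth_le := mul_le_mul_of_nonneg_left (sum_trace_bonus_le hp hT hβ)
    (mul_nonneg zero_le_two hα)
  simp only [EstimatedRegretBound, regret, roundDeviation, Finset.sum_add_distrib,
    Finset.sum_sub_distrib, ← Finset.mul_sum] at deviation_le hest ⊢
  linarith [mul_nonneg hα trace_nonneg]

end Pathwise

/-! ### Rates and logarithms -/

section Rates

variable {d T : ℕ} {C η δ Λ : ℝ}

theorem log_le_sqrt {x : ℝ} (hx : 0 < x) : Real.log x ≤ √x := by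
  have log_half_le := Real.log_le_sub_one_of_pos (half_pos (Real.sqrt_pos.2 hx))
  rw [Real.log_div (Real.sqrt_pos.2 hx).ne' two_ne_zero, Real.log_sqrt hx.le] at log_half_le
  linarith [Real.log_two_lt_d9]

theorem two_thirds_lt_log (hT : 2 ≤ T) : 2 / 3 < Real.log T := by
  have log_two_le : Real.log 2 ≤ Real.log T := Real.log_le_log two_pos (by exact_mod_cast hT)
  linarith [Real.log_two_gt_d9]

theorem log_le_log_div (hT : 1 ≤ T) (hδ₀ : 0 < δ) (hδ₁ : δ ≤ 1) :
    Real.log T ≤ Real.log (T / δ) :=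
  Real.log_le_log (by exact_mod_cast hT) (le_div_self T.cast_nonneg hδ₀ hδ₁)

theorem log_two_mul_sqrt_le (hT : 2 ≤ T) : Real.log (2 * √(T : ℝ)) ≤ 3 / 2 * Real.log T := by
  have T_pos : (0 : ℝ) < T := by exact_mod_cast (by omega : 0 < T)
  have log_two_le : Real.log 2 ≤ Real.log T := Real.log_le_log two_pos (by exact_mod_cast hT)
  rw [Real.log_mul two_ne_zero (Real.sqrt_pos.2 T_pos).ne', Real.log_sqrt T_pos.le]
  linarith

theorem log_mul_two_mul_sqrt_le (hT : 2 ≤ T) :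
    Real.log (T * (2 * √(T : ℝ))) ≤ 5 / 2 * Real.log T := by
  have T_pos : (0 : ℝ) < T := by exact_mod_cast (by omega : 0 < T)
  rw [Real.log_mul T_pos.ne' (by positivity)]
  linarith [log_two_mul_sqrt_le hT]

theorem mixRate_pos (hd : 1 ≤ d) (hT : 1 ≤ T) : 0 < mixRate d T :=
  div_pos (by exact_mod_cast hd) (Real.sqrt_pos.2 (by exact_mod_cast hT))

theorem mixRate_le_one (hdT : d ^ 2 ≤ T) : mixRate d T ≤ 1 :=
  div_le_one_of_le₀ (Real.le_sqrt_of_sq_le (by exact_mod_cast hdT)) (Real.sqrt_nonneg _)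

theorem mixRate_mul (d T : ℕ) : mixRate d T * T = d * √(T : ℝ) := by
  rw [mixRate, div_mul_eq_mul_div, mul_div_assoc, Real.div_sqrt]

theorem add_one_div_mixRate_le (hd : 1 ≤ d) : (d + 1) / mixRate d T ≤ 2 * √(T : ℝ) := by
  have one_le_d : (1 : ℝ) ≤ d := by exact_mod_cast hd
  rw [mixRate, div_div_eq_mul_div, div_le_iff₀ (by linarith)]
  nlinarith [Real.sqrt_nonneg (T : ℝ)]

theorem sqrt_le_bonusRate (d T : ℕ) (C : ℝ) : √(T : ℝ) ≤ bonusRate d T C :=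
  le_max_right _ _

theorem bonusRate_mul_le (hC : 0 ≤ C) :
    bonusRate d T C * (d * Real.log T)
      ≤ C * √(d * Real.log T) + d * √(T : ℝ) * Real.log T := by
  have dlog_nonneg : 0 ≤ d * Real.log T := mul_nonneg d.cast_nonneg (Real.log_natCast_nonneg T)
  calc bonusRate d T C * (d * Real.log T)
      ≤ (C / √(d * Real.log T) + √(T : ℝ)) * (d * Real.log T) :=
        mul_le_mul_of_nonneg_right (max_le_add_of_nonneg (by positivity) (Real.sqrt_nonneg _))
          dlog_nonneg
    _ = C * √(d * Real.log T) + d * √(T : ℝ) * Real.log T := by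
        rw [add_mul, div_mul_eq_mul_div, mul_div_assoc, Real.div_sqrt]
        ring

theorem sq_div_bonusRate_le (hd : 1 ≤ d) (hT : 2 ≤ T) (hC : 0 ≤ C) :
    C ^ 2 / bonusRate d T C ≤ C * √(d * Real.log T) := by
  have d_pos : (0 : ℝ) < d := by exact_mod_cast hd
  have log_pos : 0 < Real.log T := by linarith [two_thirds_lt_log hT]
  have le_rate : C / √(d * Real.log T) ≤ bonusRate d T C := le_max_left _ _
  have rate_pos : 0 < bonusRate d T C :=
    (Real.sqrt_pos.2 (by exact_mod_cast (by omega : 0 < T))).trans_le (sqrt_le_bonusRate d T C)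
  rw [div_le_iff₀ (Real.sqrt_pos.2 (mul_pos d_pos log_pos))] at le_rate
  rw [div_le_iff₀ rate_pos, sq, mul_assoc]
  exact mul_le_mul_of_nonneg_left (le_rate.trans_eq (mul_comm _ _)) hC

theorem bonus_terms_le (hd : 1 ≤ d) (hT : 2 ≤ T) (hC : 0 ≤ C) (hΛ : Real.log T ≤ Λ) :
    3 / 8 * bonusRate d T C + 4 * C ^ 2 / bonusRate d T C
        + 2 * bonusRate d T C * (d + d * Real.log (T * (2 * √(T : ℝ))))
      ≤ 13 * (d * √(T : ℝ) * Λ + C * √(d * Real.log T)) := by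
  have one_le_d : (1 : ℝ) ≤ d := by exact_mod_cast hd
  have log_gt := two_thirds_lt_log hT
  set α := bonusRate d T C
  set l := Real.log T
  have α_nonneg : 0 ≤ α := (Real.sqrt_nonneg _).trans (sqrt_le_bonusRate d T C)
  have d_le : (d : ℝ) ≤ 3 / 2 * (d * l) := by nlinarith
  have misspecification_le : 4 * C ^ 2 / α ≤ 4 * (C * √(d * l)) := by
    rw [mul_div_assoc]
    exact mul_le_mul_of_nonneg_left (sq_div_bonusRate_le hd hT hC) (by norm_num)
  have growth_le : 3 / 8 + 2 * (d + d * Real.log (T * (2 * √(T : ℝ)))) ≤ 9 * (d * l) := by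
    linarith [mul_le_mul_of_nonneg_left (log_mul_two_mul_sqrt_le hT) d.cast_nonneg]
  have rate_le : α * (d * l) ≤ d * √(T : ℝ) * Λ + C * √(d * l) := by
    linarith [bonusRate_mul_le (d := d) (T := T) hC,
      mul_le_mul_of_nonneg_left hΛ (by positivity : 0 ≤ d * √(T : ℝ))]
  have main_le : 0 ≤ d * √(T : ℝ) * Λ := by
    have : 0 ≤ Λ := by linarith
    positivity
  linarith [mul_le_mul_of_nonneg_left growth_le α_nonneg]

theorem mul_sqrt_le_of_sq_mul_le (hT : 2 ≤ T) (hη : η ^ 2 * T ≤ Real.log T)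
    (hΛ : Real.log T ≤ Λ) : η * √(T : ℝ) ≤ 3 / 2 * Λ := by
  have log_gt := two_thirds_lt_log hT
  refine (abs_le_of_sq_le_sq' ?_ (by linarith)).2
  rw [mul_pow, Real.sq_sqrt T.cast_nonneg]
  nlinarith

theorem exploration_terms_le (hd : 1 ≤ d) (hT : 2 ≤ T) (hη : η ^ 2 * T ≤ Real.log T)
    (hΛ : Real.log T ≤ Λ) {L : ℝ} (hL : L ≤ 5 * d * Λ) :
    8 * (2 * √(T : ℝ)) * L + 2 * η * d * T + 7 * d * (T / (2 * √(T : ℝ)))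
        + T / (2 * √(T : ℝ)) + 1 + 2 * √(T : ℝ) + 2 * (d * √(T : ℝ))
      ≤ 97 * (d * √(T : ℝ) * Λ) := by
  have one_le_d : (1 : ℝ) ≤ d := by exact_mod_cast hd
  have one_le_sqrt : 1 ≤ √(T : ℝ) := Real.one_le_sqrt.2 (by exact_mod_cast (by omega : 1 ≤ T))
  have log_gt := two_thirds_lt_log hT
  have div_eq : T / (2 * √(T : ℝ)) = √(T : ℝ) / 2 := by
    rw [mul_comm, ← div_div, Real.div_sqrt]
  have net_le := mul_le_mul_of_nonneg_left hL (by positivity : 0 ≤ 8 * (2 * √(T : ℝ)))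
  have learning_le : 2 * η * d * T ≤ 3 * (d * √(T : ℝ) * Λ) :=
    calc 2 * η * d * T = 2 * (d * √(T : ℝ)) * (η * √(T : ℝ)) := by
          linear_combination -2 * η * d * Real.mul_self_sqrt (T.cast_nonneg (α := ℝ))
      _ ≤ 2 * (d * √(T : ℝ)) * (3 / 2 * Λ) :=
          mul_le_mul_of_nonneg_left (mul_sqrt_le_of_sq_mul_le hT hη hΛ) (by positivity)
      _ = 3 * (d * √(T : ℝ) * Λ) := by ring
  have sqrt_le : √(T : ℝ) ≤ d * √(T : ℝ) := le_mul_of_one_le_left (by positivity) one_le_d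
  have dsqrt_le : d * √(T : ℝ) ≤ 3 / 2 * (d * √(T : ℝ) * Λ) := by
    have := mul_le_mul_of_nonneg_left (log_gt.le.trans hΛ) (by positivity : 0 ≤ d * √(T : ℝ))
    linarith
  rw [div_eq]
  linarith

theorem barrier_term_le (hd : 1 ≤ d) (hT : 2 ≤ T) (hη : 0 < η) :
    (d + 1) * Real.log (2 * √(T : ℝ)) / η ≤ 3 * d * Real.log T / η := by
  have one_le_d : (1 : ℝ) ≤ d := by exact_mod_cast hd
  refine div_le_div_of_nonneg_right ?_ hη.le
  calc (d + 1) * Real.log (2 * √(T : ℝ)) ≤ (2 * d) * (3 / 2 * Real.log T) :=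
        mul_le_mul (by linarith) (log_two_mul_sqrt_le hT)
          (Real.log_nonneg (by
            linarith [Real.one_le_sqrt.2 (by exact_mod_cast (by omega : 1 ≤ T) : (1 : ℝ) ≤ T)]))
          (by positivity)
    _ = 3 * d * Real.log T := by ring

theorem log_card_div_le (hd : 1 ≤ d) (hT : 2 ≤ T) {n : ℕ} (hn : 0 < n)
    (hnT : n ≤ (2 * (2 * T ^ 2) + 1) ^ d) (hδ₀ : 0 < δ) (hδ₁ : δ ≤ 1) :
    Real.log (n / δ) ≤ 5 * d * Real.log (T / δ) := by
  have base_le : 2 * (2 * T ^ 2) + 1 ≤ T ^ 5 := by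
    have four_le : 2 ^ 2 ≤ T ^ 2 := Nat.pow_le_pow_left hT 2
    have eight_le : 2 ^ 3 ≤ T ^ 3 := Nat.pow_le_pow_left hT 3
    calc 2 * (2 * T ^ 2) + 1 ≤ T ^ 2 * 2 ^ 3 := by omega
      _ ≤ T ^ 2 * T ^ 3 := Nat.mul_le_mul_left _ eight_le
      _ = T ^ 5 := by ring
  have log_n_le : Real.log n ≤ (5 * d : ℕ) * Real.log T := by
    rw [← Real.log_pow]
    refine Real.log_le_log (by exact_mod_cast hn) ?_
    exact_mod_cast (hnT.trans (Nat.pow_le_pow_left base_le d)).trans_eq (pow_mul T 5 d).symm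
  have log_δ_nonpos : Real.log δ ≤ 0 := Real.log_nonpos hδ₀.le hδ₁
  have one_le_d : (1 : ℝ) ≤ d := by exact_mod_cast hd
  rw [Real.log_div (by exact_mod_cast hn.ne') hδ₀.ne',
    Real.log_div (by exact_mod_cast (by omega : T ≠ 0)) hδ₀.ne']
  push_cast at log_n_le
  nlinarith

end Rates

/-! ### Regret bounds -/

section Regret

variable {d T : ℕ} {A : Finset (Fin d → ℝ)}

theorem regret_le_two_mul {θ : ℕ → Fin d → ℝ} {q : A → ℝ} (hq : q ∈ stdSimplex ℝ A)
    (hθ : ∀ t ∈ Finset.Icc 1 T, ∀ b : A, |b.1 ⬝ᵥ θ t| ≤ 1) (a : ℕ → A) :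
    regret T θ a q ≤ 2 * T := by
  calc regret T θ a q ≤ ∑ _t ∈ Finset.Icc 1 T, (2 : ℝ) := by
        refine Finset.sum_le_sum fun t ht => ?_
        rw [sub_dotProduct]
        linarith [(abs_le.1 (abs_mean_dotProduct_le hq (hθ t ht))).2,
          (abs_le.1 (hθ t ht (a t))).1]
    _ = 2 * T := by simp [mul_comm]

theorem regret_le_mixed {θ : ℕ → Fin d → ℝ} {q ρ : A → ℝ} (hq : q ∈ stdSimplex ℝ A)
    (hρ : ρ ∈ stdSimplex ℝ A) {γ : ℝ} (hγ : 0 ≤ γ)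
    (hθ : ∀ t ∈ Finset.Icc 1 T, ∀ b : A, |b.1 ⬝ᵥ θ t| ≤ 1) (a : ℕ → A) :
    regret T θ a q ≤ regret T θ a ((1 - γ) • q + γ • ρ) + 2 * (γ * T) := by
  have mean_mix : mean ((1 - γ) • q + γ • ρ) = (1 - γ) • mean q + γ • mean ρ := by
    simp only [mean, Finset.smul_sum, ← Finset.sum_add_distrib, Pi.add_apply, Pi.smul_apply,
      smul_eq_mul, smul_smul, add_smul]
  calc regret T θ a q
      ≤ ∑ t ∈ Finset.Icc 1 T, ((mean ((1 - γ) • q + γ • ρ) - (a t).1) ⬝ᵥ θ t + 2 * γ) := by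
        refine Finset.sum_le_sum fun t ht => ?_
        rw [mean_mix]
        simp only [sub_dotProduct, add_dotProduct, smul_dotProduct, smul_eq_mul]
        have gain_q_le := (abs_le.1 (abs_mean_dotProduct_le hq (hθ t ht))).2
        have gain_ρ_ge := (abs_le.1 (abs_mean_dotProduct_le hρ (hθ t ht))).1
        nlinarith
    _ = regret T θ a ((1 - γ) • q + γ • ρ) + 2 * (γ * T) := by
        rw [Finset.sum_add_distrib, Finset.sum_const, Nat.card_Icc, Nat.add_sub_cancel,
          nsmul_eq_mul, regret]
        ring

theorem IsJohnExploration.isSpread_mixed {ρ : A → ℝ} (hρ : IsJohnExploration A ρ) (hd : 1 ≤ d)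
    (hT : 1 ≤ T) (hdT : d ^ 2 ≤ T) {q : A → ℝ} (hq : q ∈ mixedSimplex (mixRate d T) ρ) :
    IsSpread (2 * √(T : ℝ)) q :=
  ((hρ.isSpread hd).of_mem_mixedSimplex (mixRate_pos hd hT) (mixRate_le_one hdT) (by positivity)
    hq).mono (add_one_div_mixRate_le hd)

theorem IsSpread.exists_uniform_net {β : ℝ} {ρ : A → ℝ} (hρ : IsSpread β ρ) (hβ : 0 < β) {m : ℕ}
    (hm : 1 ≤ m) :
    ∃ N : Finset A, N.card ≤ (2 * m + 1) ^ d ∧ ∀ x : A, ∃ y ∈ N, ∀ q : A → ℝ, IsSpread β q →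
      (x.1 - y.1) ⬝ᵥ ((secondMoment q)⁻¹ *ᵥ (x.1 - y.1)) ≤ d * β ^ 2 / m ^ 2 := by
  obtain ⟨N, card_le, near⟩ := hρ.exists_net hβ hm
  refine ⟨N, card_le, fun x => ?_⟩
  obtain ⟨y, hy, quad_le⟩ := near x
  refine ⟨y, hy, fun q hq => ?_⟩
  have inv_le := inv_le_smul_inv hρ.secondMoment_posDef hq.secondMoment_posDef
    (hq.secondMoment_le hρ.mem)
  calc (x.1 - y.1) ⬝ᵥ ((secondMoment q)⁻¹ *ᵥ (x.1 - y.1))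
      ≤ (x.1 - y.1) ⬝ᵥ ((β • (secondMoment ρ)⁻¹) *ᵥ (x.1 - y.1)) := quad_le_quad inv_le _
    _ = β * ((x.1 - y.1) ⬝ᵥ ((secondMoment ρ)⁻¹ *ᵥ (x.1 - y.1))) := by
        rw [Matrix.smul_mulVec, dotProduct_smul, smul_eq_mul]
    _ ≤ β * (d * β / m ^ 2) := mul_le_mul_of_nonneg_left quad_le hβ.le
    _ = d * β ^ 2 / m ^ 2 := by ring

theorem net_scale_le (hT : 1 ≤ T) (hdT : d ^ 2 ≤ T) :
    d * (2 * √(T : ℝ)) ^ 2 / ((2 * T ^ 2 : ℕ) : ℝ) ^ 2 ≤ (1 / (T : ℝ)) ^ 2 := by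
  have T_pos : (0 : ℝ) < T := by exact_mod_cast hT
  have d_le : (d : ℝ) ≤ T := by exact_mod_cast (Nat.le_self_pow two_ne_zero d).trans hdT
  rw [mul_pow, Real.sq_sqrt T_pos.le, div_pow, div_le_div_iff₀ (by positivity) (by positivity)]
  push_cast
  nlinarith [pow_pos T_pos 3]

theorem sq_mul_sqrt_le_one {η : ℝ} (hT : 1 ≤ T) (hη : η ^ 2 * T ≤ Real.log T) :
    η ^ 2 * √(T : ℝ) ≤ 1 := by
  have T_pos : (0 : ℝ) < T := by exact_mod_cast hT
  refine le_of_mul_le_mul_right ?_ (Real.sqrt_pos.2 T_pos)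
  rw [mul_assoc, Real.mul_self_sqrt T_pos.le, one_mul]
  exact hη.trans (log_le_sqrt T_pos)

theorem regret_le_of_near {C η Λ L : ℝ} {ρ : A → ℝ} {θ : ℕ → Fin d → ℝ} {ε p : ℕ → A → ℝ}
    {a : ℕ → A} {r : ℕ → ℝ} (hd : 1 ≤ d) (hT : 2 ≤ T) (hdT : d ^ 2 ≤ T)
    (hρ : ρ ∈ stdSimplex ℝ A) (hC : 0 ≤ C) (hη : 0 < η) (hηT : η ^ 2 * T ≤ Real.log T)
    (hp : ∀ t ∈ Finset.Icc 1 T, IsSpread (2 * √(T : ℝ)) (p t))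
    (hθ : ∀ t ∈ Finset.Icc 1 T, ∀ b : A, |b.1 ⬝ᵥ θ t| ≤ 1)
    (hr : ∀ t ∈ Finset.Icc 1 T, |r t| ≤ 1) {e : ℕ → ℝ}
    (hε : ∀ t ∈ Finset.Icc 1 T, ∀ b, |ε t b| ≤ e t) (he : ∑ t ∈ Finset.Icc 1 T, e t ≤ C)
    (hΛ : Real.log T ≤ Λ) (hL : L ≤ 5 * d * Λ)
    (near : ∀ x : A, ∃ y : A, (∀ t ∈ Finset.Icc 1 T,
        (x.1 - y.1) ⬝ᵥ ((secondMoment (p t))⁻¹ *ᵥ (x.1 - y.1)) ≤ (1 / (T : ℝ)) ^ 2)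
      ∧ compensatedSum (fun t => meanReward (θ t) (ε t)) p
          (fun t => (1 / (8 * (2 * √(T : ℝ)))) • actionPart η y.1 (θ t) (p t))
          (fun t => (1 / (8 * (2 * √(T : ℝ)))) • rewardPart y.1 (p t)) a r T ≤ L)
    (hest : ∀ q ∈ mixedSimplex (mixRate d T) ρ,
      EstimatedRegretBound T (bonusRate d T C) (2 * √(T : ℝ)) η p a r q)
    {q : A → ℝ} (hq : q ∈ stdSimplex ℝ A) :
    regret T θ a q ≤ 3 * d * Real.log T / η
      + 110 * (d * √(T : ℝ) * Λ + C * √(d * Real.log T)) := by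
  have sqrt_pos : 0 < √(T : ℝ) := Real.sqrt_pos.2 (by exact_mod_cast (by omega : 0 < T))
  have α_pos : 0 < bonusRate d T C := sqrt_pos.trans_le (sqrt_le_bonusRate d T C)
  have γ_pos : 0 < mixRate d T := mixRate_pos hd (by omega)
  have div_le : T / (2 * √(T : ℝ)) ≤ bonusRate d T C / 2 := by
    rw [mul_comm, ← div_div, Real.div_sqrt]
    linarith [sqrt_le_bonusRate d T C]
  have ηβ_le : η ^ 2 * (2 * √(T : ℝ)) ≤ 2 := by
    linarith [sq_mul_sqrt_le_one (by omega) hηT]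
  have mix_mem : (1 - mixRate d T) • q + mixRate d T • ρ ∈ mixedSimplex (mixRate d T) ρ :=
    ⟨q, hq, rfl⟩
  have mixed_regret_le := (hest _ mix_mem).regret_le (θ := θ)
    (mixedSimplex_subset γ_pos.le (mixRate_le_one hdT) hρ mix_mem) (by omega) α_pos.le
    (by positivity) hp (fun x => (near x).elim fun y hy => sum_roundDeviation_le hd (by omega)
      (by positivity) ηβ_le α_pos div_le hp hθ hr hε he hy.1 hy.2)
  have regret_le := regret_le_mixed hq hρ γ_pos.le hθ a
  rw [mixRate_mul] at regret_le
  linarith [exploration_terms_le hd hT hηT hΛ hL, bonus_terms_le hd hT hC hΛ,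
    barrier_term_le hd hT hη, mul_nonneg hC (Real.sqrt_nonneg (d * Real.log T))]

end Regret

section HighProbability

variable {d T : ℕ} {A : Finset (Fin d → ℝ)} {Ω : Type*} [mΩ : MeasurableSpace Ω] {P : Measure Ω}
  [IsProbabilityMeasure P] {ℱ : Filtration ℕ mΩ} {C δ : ℝ} {ρ : A → ℝ}
  {θ : ℕ → Ω → Fin d → ℝ} {ε p : ℕ → Ω → A → ℝ} {a : ℕ → Ω → A} {r : ℕ → Ω → ℝ}

theorem IsMisspecifiedBandit.le_measureReal_forall_mem_compensatedSum_le
    (hb : IsMisspecifiedBandit P ℱ T C θ ε p a r) {β η : ℝ} (hβ : 2 ≤ β) (hη₀ : 0 ≤ η)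
    (hη₁ : η ≤ 1) (hδ : 0 < δ) (hp : ∀ t ∈ Finset.Icc 1 T, ∀ ω, IsSpread β (p t ω))
    {N : Finset A} (hN : N.Nonempty) :
    1 - δ ≤ P.real {ω | ∀ y ∈ N,
      compensatedSum (fun t => meanReward (θ t ω) (ε t ω)) (p · ω)
          (fun t => (1 / (8 * β)) • actionPart η y.1 (θ t ω) (p t ω))
          (fun t => (1 / (8 * β)) • rewardPart y.1 (p t ω)) (a · ω) (r · ω) T
        ≤ Real.log (N.card / δ)} := by
  have : Nonempty N := hN.to_subtype
  have scale_le : 8 * β * (1 / (8 * β)) ≤ 1 := (mul_one_div_cancel (by positivity)).le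
  have concentration :=
    (hb.isFiniteBandit fun t ht ω => (hp t ht ω).mem).le_measureReal_forall_compensatedSum_le
      (fun y : N => hb.isPredictablePair hp (by positivity) scale_le hβ hη₀ hη₁ y.1) hδ
  rw [Fintype.card_coe] at concentration
  exact concentration.trans (measureReal_mono fun ω hω y hy => hω ⟨y, hy⟩)

theorem IsMisspecifiedBandit.le_measureReal_regret_le
    (hb : IsMisspecifiedBandit P ℱ T C θ ε p a r) {η : ℝ} (hd : 1 ≤ d) (hT : 2 ≤ T)
    (hdT : d ^ 2 ≤ T) (hρ : IsJohnExploration A ρ) (hC : 0 ≤ C) (hδ₀ : 0 < δ) (hδ₁ : δ ≤ 1)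
    (hη : 0 < η) (hηT : η ^ 2 * T ≤ Real.log T)
    (hp : ∀ ω, ∀ t ∈ Finset.Icc 1 T, p t ω ∈ mixedSimplex (mixRate d T) ρ)
    (hest : ∀ ω, ∀ q ∈ mixedSimplex (mixRate d T) ρ,
      EstimatedRegretBound T (bonusRate d T C) (2 * √(T : ℝ)) η (p · ω) (a · ω) (r · ω) q) :
    1 - δ ≤ P.real {ω | ∀ q ∈ stdSimplex ℝ A, regret T (θ · ω) (a · ω) q
      ≤ 3 * d * Real.log T / η
        + 110 * (d * √(T : ℝ) * Real.log (T / δ) + C * √(d * Real.log T))} := by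
  have one_le_T : 1 ≤ T := by omega
  have one_le_sqrt : 1 ≤ √(T : ℝ) := Real.one_le_sqrt.2 (by exact_mod_cast one_le_T)
  have spread : ∀ q ∈ mixedSimplex (mixRate d T) ρ, IsSpread (2 * √(T : ℝ)) q :=
    fun q hq => hρ.isSpread_mixed hd one_le_T hdT hq
  have spread_p : ∀ t ∈ Finset.Icc 1 T, ∀ ω, IsSpread (2 * √(T : ℝ)) (p t ω) :=
    fun t ht ω => spread _ (hp ω t ht)
  have spread_ρ : IsSpread (2 * √(T : ℝ)) ρ := spread ρ ⟨ρ, hρ.1, by module⟩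
  obtain ⟨N, N_card_le, near⟩ := spread_ρ.exists_uniform_net (m := 2 * T ^ 2) (by positivity)
    (Nat.one_le_iff_ne_zero.2 (by positivity))
  have N_nonempty : N.Nonempty := by
    obtain ⟨x⟩ : Nonempty A := not_isEmpty_iff.1 fun _ => by simpa using hρ.1.2
    obtain ⟨y, hy, -⟩ := near x
    exact ⟨y, hy⟩
  have η_le_one : η ≤ 1 := by
    nlinarith [sq_mul_sqrt_le_one one_le_T hηT]
  refine (hb.le_measureReal_forall_mem_compensatedSum_le (by linarith) hη.le η_le_one hδ₀ spread_p
    N_nonempty).trans (measureReal_mono fun ω hω q hq => ?_)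
  refine regret_le_of_near hd hT hdT hρ.1 hC hη hηT (fun t ht => spread_p t ht ω)
    (fun t ht => hb.abs_dotProduct_theta_le ht ω) (fun t ht => hb.abs_reward_le t ht ω)
    (fun t _ => le_ciSup (Set.finite_range fun x => |ε t ω x|).bddAbove)
    (hb.misspecification_le ω) (log_le_log_div one_le_T hδ₀ hδ₁)
    (log_card_div_le hd hT N_nonempty.card_pos N_card_le hδ₀ hδ₁) (fun x => ?_) (hest ω) hq
  obtain ⟨y, hy, quad_le⟩ := near x
  exact ⟨y, fun t ht => (quad_le _ (spread_p t ht ω)).trans (net_scale_le one_le_T hdT), hω y hy⟩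

end HighProbability

section LearningRate

variable {d T : ℕ} {C : ℝ}

theorem sq_learningRate (T : ℕ) : learningRate T ^ 2 = Real.log T / T :=
  Real.sq_sqrt (div_nonneg (Real.log_natCast_nonneg T) T.cast_nonneg)

theorem learningRate_pos (hT : 2 ≤ T) : 0 < learningRate T :=
  Real.sqrt_pos.2 (div_pos (by linarith [two_thirds_lt_log hT])
    (by exact_mod_cast (by omega : 0 < T)))

theorem sq_learningRate_mul_sqrt_le (hT : 8 * Real.log T ≤ √(T : ℝ)) :
    learningRate T ^ 2 * (2 * √(T : ℝ)) ≤ 1 / 4 := by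
  rw [sq_learningRate, div_mul_eq_mul_div]
  refine div_le_of_le_mul₀ T.cast_nonneg (by norm_num) ?_
  nlinarith [Real.mul_self_sqrt (T.cast_nonneg (α := ℝ)), Real.sqrt_nonneg (T : ℝ)]

theorem log_div_learningRate (hT : 2 ≤ T) :
    Real.log T / learningRate T = √(T : ℝ) * √(Real.log T) := by
  have log_pos : 0 < Real.log T := by linarith [two_thirds_lt_log hT]
  rw [learningRate, Real.sqrt_div log_pos.le, div_div_eq_mul_div, mul_comm, mul_div_assoc,
    Real.div_sqrt]

theorem sqrt_le_learningRateStandard_inv (T : ℕ) (C : ℝ) :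
    16 * √(T : ℝ) ≤ (learningRateStandard T C)⁻¹ := by
  rw [learningRateStandard, one_div, inv_inv]
  exact mul_le_mul_of_nonneg_left (le_max_right _ _) (by norm_num)

theorem learningRateStandard_pos (hT : 1 ≤ T) : 0 < learningRateStandard T C :=
  inv_pos.1 ((mul_pos (by norm_num) (Real.sqrt_pos.2 (by exact_mod_cast hT))).trans_le
    (sqrt_le_learningRateStandard_inv T C))

theorem learningRateStandard_mul_sqrt_le (hT : 1 ≤ T) :
    learningRateStandard T C * √(T : ℝ) ≤ 1 / 16 := by
  have := (le_inv_mul_iff₀ (learningRateStandard_pos (C := C) hT)).1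
    ((sqrt_le_learningRateStandard_inv T C).trans_eq (mul_one _).symm)
  linarith

theorem sq_learningRateStandard_mul_le (hT : 1 ≤ T) :
    learningRateStandard T C ^ 2 * T ≤ 1 / 256 := by
  have rate_nonneg : 0 ≤ learningRateStandard T C * √(T : ℝ) :=
    mul_nonneg (learningRateStandard_pos hT).le (Real.sqrt_nonneg _)
  calc learningRateStandard T C ^ 2 * T = (learningRateStandard T C * √(T : ℝ)) ^ 2 := by
        rw [mul_pow, Real.sq_sqrt T.cast_nonneg]
    _ ≤ (1 / 16) ^ 2 := pow_le_pow_left₀ rate_nonneg (learningRateStandard_mul_sqrt_le hT) 2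
    _ = 1 / 256 := by norm_num

theorem sq_learningRateStandard_mul_sqrt_le (hT : 1 ≤ T) :
    4 * (learningRateStandard T C ^ 2 * (2 * √(T : ℝ))) ≤ 1 / 4 := by
  have one_le_T : (1 : ℝ) ≤ T := by exact_mod_cast hT
  linarith [sq_learningRateStandard_mul_le (C := C) hT,
    mul_le_mul_of_nonneg_left (Real.sqrt_le_self_iff.2 (.inr one_le_T))
      (sq_nonneg (learningRateStandard T C))]

theorem learningRateStandard_mul_bonusRate_le (hd : 1 ≤ d) (hT : 2 ≤ T) (hC : 0 ≤ C) :
    learningRateStandard T C * bonusRate d T C ≤ 1 / 4 := by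
  have one_le_d : (1 : ℝ) ≤ d := by exact_mod_cast hd
  have log_pos : 0 < Real.log T := by linarith [two_thirds_lt_log hT]
  have sqrt_pos : 0 < √(T : ℝ) := Real.sqrt_pos.2 (by exact_mod_cast (by omega : 0 < T))
  have rate_le : bonusRate d T C ≤ max (C / √(Real.log T)) √(T : ℝ) :=
    max_le_max_right _ (div_le_div_of_nonneg_left hC (Real.sqrt_pos.2 log_pos)
      (Real.sqrt_le_sqrt (le_mul_of_one_le_left log_pos.le one_le_d)))
  rw [learningRateStandard, div_mul_eq_mul_div,
    div_le_iff₀ (mul_pos (by norm_num) (sqrt_pos.trans_le (le_max_right _ _)))]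
  linarith [sqrt_pos.trans_le (sqrt_le_bonusRate d T C)]

theorem log_div_learningRateStandard_le (hC : 0 ≤ C) :
    Real.log T / learningRateStandard T C
      ≤ 16 * (√(T : ℝ) * Real.log T + C * √(Real.log T)) := by
  rw [learningRateStandard, div_div_eq_mul_div, div_one]
  calc Real.log T * (16 * max (C / √(Real.log T)) √(T : ℝ))
      ≤ Real.log T * (16 * (C / √(Real.log T) + √(T : ℝ))) :=
        mul_le_mul_of_nonneg_left
          (mul_le_mul_of_nonneg_left
            (max_le_add_of_nonneg (by positivity) (Real.sqrt_nonneg _)) (by norm_num))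
          (Real.log_natCast_nonneg T)
    _ = 16 * (√(T : ℝ) * Real.log T + C * (Real.log T / √(Real.log T))) := by ring
    _ = 16 * (√(T : ℝ) * Real.log T + C * √(Real.log T)) := by rw [Real.div_sqrt]

theorem le_of_sqrt_lt_log {Λ : ℝ} (hd : 1 ≤ d) (hT : √(T : ℝ) < 8 * Real.log T)
    (hΛ : Real.log T ≤ Λ) : 2 * (T : ℝ) ≤ 16 * (d * √(T : ℝ) * Λ) := by
  have one_le_d : (1 : ℝ) ≤ d := by exact_mod_cast hd
  calc 2 * (T : ℝ) = 2 * √(T : ℝ) * √(T : ℝ) := by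
        rw [mul_assoc, Real.mul_self_sqrt T.cast_nonneg]
    _ ≤ 2 * √(T : ℝ) * (8 * Λ) := by gcongr; linarith
    _ = 16 * (1 * √(T : ℝ) * Λ) := by ring
    _ ≤ 16 * (d * √(T : ℝ) * Λ) := by
        have : 0 ≤ Λ := (Real.log_natCast_nonneg T).trans hΛ
        gcongr

end LearningRate

section Algorithms

variable {d T : ℕ} {A : Finset (Fin d → ℝ)} {Ω : Type*} [mΩ : MeasurableSpace Ω] {P : Measure Ω}
  [IsProbabilityMeasure P] {ℱ : Filtration ℕ mΩ} {C δ : ℝ} {ρ : A → ℝ}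
  {θ : ℕ → Ω → Fin d → ℝ} {ε p : ℕ → Ω → A → ℝ} {a : ℕ → Ω → A} {r : ℕ → Ω → ℝ}

theorem IsMisspecifiedBandit.fixedPoint_le_measureReal_regret_le
    (hb : IsMisspecifiedBandit P ℱ T C θ ε p a r)
    (hF : ∀ ω, FollowsFixedPointFTRL T (mixRate d T) (bonusRate d T C) (learningRate T) ρ
      (p · ω) (a · ω) (r · ω))
    (hd : 1 ≤ d) (hT : 2 ≤ T) (hdT : d ^ 2 ≤ T) (hρ : IsJohnExploration A ρ) (hC : 0 ≤ C)
    (hδ₀ : 0 < δ) (hδ₁ : δ ≤ 1) :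
    1 - δ ≤ P.real {ω | ∀ q ∈ stdSimplex ℝ A, regret T (θ · ω) (a · ω) q
      ≤ 115 * (d * √(T : ℝ) * Real.log (T / δ) + C * √(d * Real.log T))} := by
  have one_le_T : 1 ≤ T := by omega
  have T_ne_zero : (T : ℝ) ≠ 0 := by exact_mod_cast (by omega : T ≠ 0)
  have log_le := log_le_log_div one_le_T hδ₀ hδ₁
  have log_gt := two_thirds_lt_log hT
  have misspecification_nonneg : 0 ≤ C * √(d * Real.log T) := mul_nonneg hC (Real.sqrt_nonneg _)
  have main_nonneg : 0 ≤ d * √(T : ℝ) * Real.log (T / δ) :=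
    mul_nonneg (by positivity) (by linarith)
  rcases lt_or_ge √(T : ℝ) (8 * Real.log T) with small | large
  · have trivial_bound : {ω | ∀ q ∈ stdSimplex ℝ A, regret T (θ · ω) (a · ω) q
        ≤ 115 * (d * √(T : ℝ) * Real.log (T / δ) + C * √(d * Real.log T))} = Set.univ :=
      Set.eq_univ_of_forall fun ω q hq =>
        (regret_le_two_mul hq (fun t ht => hb.abs_dotProduct_theta_le ht ω) _).trans
          (by linarith [le_of_sqrt_lt_log hd small log_le])
    rw [trivial_bound, probReal_univ]
    linarith
  · refine (hb.le_measureReal_regret_le hd hT hdT hρ hC hδ₀ hδ₁ (learningRate_pos hT)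
      (by rw [sq_learningRate, div_mul_cancel₀ _ T_ne_zero]) (fun ω t ht => (hF ω t ht).1)
      fun ω q hq => (hF ω).estimatedRegretBound (learningRate_pos hT)
        ((Real.sqrt_nonneg _).trans (sqrt_le_bonusRate d T C)) (by positivity)
        (sq_learningRate_mul_sqrt_le large) (fun t ht => hb.abs_reward_le t ht ω)
        (fun q hq => hρ.isSpread_mixed hd one_le_T hdT hq) hq).trans
      (measureReal_mono fun ω hω q hq => (hω q hq).trans ?_)
    have sqrt_log_le : √(Real.log T) ≤ 3 / 2 * Real.log (T / δ) :=
      (Real.sqrt_le_left (by linarith)).2 (by nlinarith)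
    have barrier_le := mul_le_mul_of_nonneg_left sqrt_log_le
      (by positivity : 0 ≤ d * √(T : ℝ))
    rw [mul_div_assoc, log_div_learningRate hT]
    linarith

theorem IsMisspecifiedBandit.standard_le_measureReal_regret_le
    (hb : IsMisspecifiedBandit P ℱ T C θ ε p a r)
    (hF : ∀ ω, FollowsStandardFTRL T (mixRate d T) (bonusRate d T C) (learningRateStandard T C) ρ
      (p · ω) (a · ω) (r · ω))
    (hd : 1 ≤ d) (hT : 2 ≤ T) (hdT : d ^ 2 ≤ T) (hρ : IsJohnExploration A ρ) (hC : 0 ≤ C)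
    (hδ₀ : 0 < δ) (hδ₁ : δ ≤ 1) :
    1 - δ ≤ P.real {ω | ∀ q ∈ stdSimplex ℝ A, regret T (θ · ω) (a · ω) q
      ≤ 160 * (d * √(T : ℝ) * Real.log (T / δ) + d * C * √(Real.log T))} := by
  have one_le_T : 1 ≤ T := by omega
  have one_le_d : (1 : ℝ) ≤ d := by exact_mod_cast hd
  have log_gt := two_thirds_lt_log hT
  have log_le := log_le_log_div one_le_T hδ₀ hδ₁
  have η_pos : 0 < learningRateStandard T C := learningRateStandard_pos one_le_T
  refine (hb.le_measureReal_regret_le hd hT hdT hρ hC hδ₀ hδ₁ η_pos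
    (by linarith [sq_learningRateStandard_mul_le (C := C) one_le_T])
    (fun ω t ht => (hF ω t ht).1)
    fun ω q hq => (hF ω).estimatedRegretBound η_pos
      ((Real.sqrt_nonneg _).trans (sqrt_le_bonusRate d T C)) (by positivity)
      (sq_learningRateStandard_mul_sqrt_le one_le_T)
      (learningRateStandard_mul_bonusRate_le hd hT hC) (fun t ht => hb.abs_reward_le t ht ω)
      (fun q hq => hρ.isSpread_mixed hd one_le_T hdT hq) hq).trans
    (measureReal_mono fun ω hω q hq => (hω q hq).trans ?_)
  have barrier_le : 3 * d * Real.log T / learningRateStandard T C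
      ≤ 48 * (d * √(T : ℝ) * Real.log T + d * C * √(Real.log T)) := by
    rw [mul_div_assoc]
    linarith [mul_le_mul_of_nonneg_left (log_div_learningRateStandard_le (T := T) hC)
      (by positivity : (0 : ℝ) ≤ 3 * d)]
  have main_le : d * √(T : ℝ) * Real.log T ≤ d * √(T : ℝ) * Real.log (T / δ) :=
    mul_le_mul_of_nonneg_left log_le (by positivity)
  have misspecification_le : C * √(d * Real.log T) ≤ d * C * √(Real.log T) := by
    rw [Real.sqrt_mul d.cast_nonneg, mul_left_comm, ← mul_assoc]
    gcongr
    exact Real.sqrt_le_self_iff.2 (.inr one_le_d)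
  have main_nonneg : 0 ≤ d * √(T : ℝ) * Real.log (T / δ) :=
    mul_nonneg (by positivity) (by linarith)
  have misspecification_nonneg : 0 ≤ d * C * √(Real.log T) := by positivity
  linarith

end Algorithms

end LogDetBandit

open LogDetBandit in
theorem mainTheorem1 :
    (∃ K : ℝ, 0 < K ∧
      ∀ (d T : ℕ), 1 ≤ d → 2 ≤ T → d ^ 2 ≤ T →
      ∀ (A : Finset (Fin d → ℝ)) (ρ : A → ℝ), IsJohnExploration A ρ →
      ∀ (C δ : ℝ), 0 ≤ C → 0 < δ → δ < 1 →
      ∀ (Ω : Type*) (mΩ : MeasurableSpace Ω) (P : MeasureTheory.Measure Ω)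
        (_ : MeasureTheory.IsProbabilityMeasure P) (ℱ : MeasureTheory.Filtration ℕ mΩ)
        (θ : ℕ → Ω → Fin d → ℝ) (ε : ℕ → Ω → A → ℝ)
        (p : ℕ → Ω → A → ℝ) (a : ℕ → Ω → A) (r : ℕ → Ω → ℝ),
        IsMisspecifiedBandit P ℱ T C θ ε p a r →
        (∀ ω, FollowsFixedPointFTRL T (mixRate d T) (bonusRate d T C) (learningRate T) ρ
          (fun t => p t ω) (fun t => a t ω) (fun t => r t ω)) →
        1 - δ ≤ P.real {ω | ∀ pstar ∈ stdSimplex ℝ A,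
          regret T (fun t => θ t ω) (fun t => a t ω) pstar ≤
            K * (d * √(T : ℝ) * Real.log (T / δ) + C * √(d * Real.log T))}) ∧
    (∃ K : ℝ, 0 < K ∧
      ∀ (d T : ℕ), 1 ≤ d → 2 ≤ T → d ^ 2 ≤ T →
      ∀ (A : Finset (Fin d → ℝ)) (ρ : A → ℝ), IsJohnExploration A ρ →
      ∀ (C δ : ℝ), 0 ≤ C → 0 < δ → δ < 1 →
      ∀ (Ω : Type*) (mΩ : MeasurableSpace Ω) (P : MeasureTheory.Measure Ω)
        (_ : MeasureTheory.IsProbabilityMeasure P) (ℱ : MeasureTheory.Filtration ℕ mΩ)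
        (θ : ℕ → Ω → Fin d → ℝ) (ε : ℕ → Ω → A → ℝ)
        (p : ℕ → Ω → A → ℝ) (a : ℕ → Ω → A) (r : ℕ → Ω → ℝ),
        IsMisspecifiedBandit P ℱ T C θ ε p a r →
        (∀ ω, FollowsStandardFTRL T (mixRate d T) (bonusRate d T C) (learningRateStandard T C) ρ
          (fun t => p t ω) (fun t => a t ω) (fun t => r t ω)) →
        1 - δ ≤ P.real {ω | ∀ pstar ∈ stdSimplex ℝ A,
          regret T (fun t => θ t ω) (fun t => a t ω) pstar ≤
            K * (d * √(T : ℝ) * Real.log (T / δ) + d * C * √(Real.log T))}) := by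
  refine ⟨⟨115, by norm_num, ?_⟩, ⟨160, by norm_num, ?_⟩⟩
  · intro d T hd hT hdT A ρ hρ C δ hC hδ hδ1 Ω mΩ P hP ℱ θ ε p a r hb hF
    exact hb.fixedPoint_le_measureReal_regret_le hF hd hT hdT hρ hC hδ hδ1.le
  · intro d T hd hT hdT A ρ hρ C δ hC hδ hδ1 Ω mΩ P hP ℱ θ ε p a r hb hF
    exact hb.standard_le_measureReal_regret_le hF hd hT hdT hρ hC hδ hδ1.le
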